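/- Let $n\ge 1$, let $(M^{n+1},g)$ be a smooth Riemannian manifold with (possibly empty) boundary, and let $\iota:X^n\to M$ be a compact, two-sided, properly embedded smooth hypersurface, possibly with boundary, that meets $\partial M$ orthogonally. Here properly embedded means that $\iota$ is a smooth embedding with $\iota^{-1}(\partial M)=\partial X$; two-sided means that there is a globally defined smooth unit normal vector field along $X$; and meeting $\partial M$ orthogonally means that at every point of $\partial X$ the vectors normal to $X$ are $g$-orthogonal to the vectors normal to $\partial M$. Then there exist $\delta>0$, an open set $U\subseteq M$ containing $\iota(X)$, a diffeomorphism $\Phi:X\times(-\delta,\delta)\to U$ with $\Phi(x,0)=\iota(x)$ for all $x\in X$, a smooth positive function $u\in C^\infty(X\times(-\delta,\delta))$, and a smooth family $(h_t)_{t\in(-\delta,\delta)}$ of smooth Riemannian metrics on $X$ (that is, $h_t(x)$ is jointly smooth in $(x,t)$) such that $$\Phi^*(g|_U)=u(x,t)^2\,dt^2+h_t(x)\qquad\text{on } X\times(-\delta,\delta).$$ -/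

import Mathlib

open scoped Manifold ContDiff
open Bundle

noncomputable section

namespace NormalForm

/-- A smooth Riemannian metric on a `d`-dimensional manifold with (possibly empty) boundary. -/
abbrev Met (d : ℕ) [NeZero d] (M : Type*) [TopologicalSpace M]
    [ChartedSpace (EuclideanHalfSpace d) M] [IsManifold (𝓡∂ d) ∞ M] : Type _ :=
  ContMDiffRiemannianMetric (𝓡∂ d) ∞ (EuclideanSpace ℝ (Fin d))
    (fun p : M => TangentSpace (𝓡∂ d) p)

/-- At a boundary point `p`, the subspace `T_p ∂M` of `T_p M`: the vectors whose image under the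
differential of the chart at `p` lies in the hyperplane bounding the half-space. (Only meant to be
used at boundary points.) -/
def boundaryTangentSpace {d : ℕ} [NeZero d] {M : Type*} [TopologicalSpace M]
    [ChartedSpace (EuclideanHalfSpace d) M] (p : M) : Set (TangentSpace (𝓡∂ d) p) :=
  {v | (show EuclideanSpace ℝ (Fin d) from
    mfderiv (𝓡∂ d) 𝓘(ℝ, EuclideanSpace ℝ (Fin d)) (extChartAt (𝓡∂ d) p) p v) 0 = 0}

section Hypersurface

variable {n : ℕ} [NeZero n]
  {X : Type*} [TopologicalSpace X] [ChartedSpace (EuclideanHalfSpace n) X]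
  {M : Type*} [TopologicalSpace M] [ChartedSpace (EuclideanHalfSpace (n + 1)) M]
  [IsManifold (𝓡∂ (n + 1)) ∞ M]

/-- `ι : X → M` is a proper embedding of a compact `X` in a manifold with boundary: a smooth
embedding under which `∂X` is exactly the part of `X` lying on `∂M`. -/
structure IsProperlyEmbedded (ι : X → M) : Prop where
  isSmoothEmbedding : Manifold.IsSmoothEmbedding (𝓡∂ n) (𝓡∂ (n + 1)) ∞ ι
  preimage_boundary : ι ⁻¹' (𝓡∂ (n + 1)).boundary M = (𝓡∂ n).boundary X

/-- `N ∈ T_{ι x} M` is `g`-normal to the hypersurface at `ι x`, i.e. orthogonal to the image of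
`dι_x`. -/
def IsNormalAt (g : Met (n + 1) M) (ι : X → M) (x : X) (N : TangentSpace (𝓡∂ (n + 1)) (ι x)) :
    Prop :=
  ∀ w : TangentSpace (𝓡∂ n) x, g.inner (ι x) N (mfderiv (𝓡∂ n) (𝓡∂ (n + 1)) ι x w) = 0

/-- The hypersurface is two-sided: it carries a globally defined smooth unit normal vector field. -/
def IsTwoSided (g : Met (n + 1) M) (ι : X → M) : Prop :=
  ∃ ν : (x : X) → TangentSpace (𝓡∂ (n + 1)) (ι x),
    ContMDiff (𝓡∂ n) (𝓡∂ (n + 1)).tangent ∞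
      (fun x => (⟨ι x, ν x⟩ : TangentBundle (𝓡∂ (n + 1)) M)) ∧
    ∀ x, IsNormalAt g ι x (ν x) ∧ g.inner (ι x) (ν x) (ν x) = 1

/-- The hypersurface meets `∂M` orthogonally: at each point of `∂X`, vectors normal to `X` are
orthogonal to vectors normal to `∂M`. -/
def MeetsBoundaryOrthogonally (g : Met (n + 1) M) (ι : X → M) : Prop :=
  ∀ x ∈ (𝓡∂ n).boundary X, ∀ N η : TangentSpace (𝓡∂ (n + 1)) (ι x),
    IsNormalAt g ι x N →
    (∀ v ∈ boundaryTangentSpace (ι x), g.inner (ι x) η v = 0) →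
    g.inner (ι x) N η = 0

end Hypersurface

/-- The open interval `(-δ, δ)`, as an open submanifold of `ℝ`. -/
def interval (δ : ℝ) : TopologicalSpace.Opens ℝ := ⟨Set.Ioo (-δ) δ, isOpen_Ioo⟩

/-- The family `t ↦ h_t` of smooth metrics on `X` depends smoothly on `t ∈ (-δ, δ)`: the tensor
`h_t(x)` is jointly smooth in `(x, t)`. -/
def IsSmoothFamily {n : ℕ} [NeZero n] {X : Type*} [TopologicalSpace X]
    [ChartedSpace (EuclideanHalfSpace n) X] [IsManifold (𝓡∂ n) ∞ X] {δ : ℝ}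
    (h : interval δ → Met n X) : Prop :=
  ContMDiff ((𝓡∂ n).prod 𝓘(ℝ, ℝ))
    ((𝓡∂ n).prod 𝓘(ℝ, EuclideanSpace ℝ (Fin n) →L[ℝ] EuclideanSpace ℝ (Fin n) →L[ℝ] ℝ)) ∞
    (fun q : X × interval δ =>
      TotalSpace.mk' (EuclideanSpace ℝ (Fin n) →L[ℝ] EuclideanSpace ℝ (Fin n) →L[ℝ] ℝ)
        (E := fun x : X => TangentSpace (𝓡∂ n) x →L[ℝ] TangentSpace (𝓡∂ n) x →L[ℝ] ℝ)
        q.1 ((h q.2).inner q.1))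

/-- For `Φ : X × (-δ, δ) → U ⊆ M`, the pulled-back metric `Φ^* g` equals `u² dt² + h_t`. Tangent
vectors of `X × (-δ, δ)` at `(x, t)` are pairs `(v, a)` with `v ∈ T_x X` and `a ∈ ℝ`. -/
def PullbackIsBlock {n : ℕ} [NeZero n]
    {X : Type*} [TopologicalSpace X] [ChartedSpace (EuclideanHalfSpace n) X]
    [IsManifold (𝓡∂ n) ∞ X]
    {M : Type*} [TopologicalSpace M] [ChartedSpace (EuclideanHalfSpace (n + 1)) M]
    [IsManifold (𝓡∂ (n + 1)) ∞ M] (g : Met (n + 1) M) {δ : ℝ} {U : TopologicalSpace.Opens M}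
    (Φ : X × interval δ → U) (u : X × interval δ → ℝ) (h : interval δ → Met n X) : Prop :=
  ∀ (x : X) (t : interval δ) (v w : TangentSpace (𝓡∂ n) x) (a b : ℝ),
    let dΦ := mfderiv ((𝓡∂ n).prod 𝓘(ℝ, ℝ)) (𝓡∂ (n + 1)) (fun q => (Φ q : M)) (x, t)
    g.inner (Φ (x, t) : M) (dΦ (v, a)) (dΦ (w, b)) =
      u (x, t) ^ 2 * (a * b) + (h t).inner x v w

end NormalForm

end

noncomputable section

set_option linter.unusedSectionVars false

namespace NormalForm

open Set Metric Function Filter Topology NNReal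

universe u

/-! Write X for the hypersurface and ν for its unit normal. The heart of the matter is a function f
near X that vanishes on X, increases along ν, and has gradient tangent to ∂M. Put V = grad f / |grad
f|², so that df(V) = 1, and let θ be its flow. Then Φ(x, t) = θ(ι x, t) satisfies f(Φ(x, t)) = t.
Vectors tangent to the slices t = const are therefore killed by df, hence orthogonal to V = dΦ(∂_t).
The mixed terms of Φ^*g vanish, h_t is the metric induced on the slice, and u = |V| = 1/|grad f|.
Normal geodesics would not serve: those starting on ∂X need not stay in ∂M.

Orthogonality enters in the construction of f (`exists_isDefiningOn_tangent`). Along X the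
differential of any defining function is a multiple of g(ν, ·), so on ∂X it already kills the
normals of ∂M. At the remaining points of ∂M a given defining function f₀ is corrected in slice
charts by a multiple of the boundary coordinate, the multiplier being arranged to vanish along X
(`IsDefiningOn.exists_local_tangent`). The corrections do not change f₀ on ∂M, and this is what
allows a partition of unity to glue them without losing tangency (`exists_isDefiningOn_of_local`).

Since V is tangent to ∂M, its flow exists in both time directions up to the boundary. In a
half-space chart the field is extended by the nearest point retraction, and tangency keeps solutions
in the half-space (`exists_localFlow_halfSpace`). The extension is only Lipschitz, so smooth
dependence is proved for fields smooth on a compact convex set alone, by induction through the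
variational equation (`contDiffOn_flow_nat`). Uniqueness of flow lines glues the local flows near
the compact set X (`exists_flow_near_compact`).

Finally Φ is inverted explicitly (`exists_collar`): flowing q for time -f(q) reaches a zero of f,
which lies on X by `IsDefiningOn.exists_zero_subset`, and the other component is f(q). Smoothness of
the X-component holds because ι is an embedding and an immersion. -/

/-! ### Differential equations on compact convex sets: smooth dependence on parameters -/

theorem gronwallBound_le_add_mul_exp {δ K ε x : ℝ} (hK : 1 ≤ K) (hε : 0 ≤ ε) (hδ : 0 ≤ δ)
    (hx : x ≤ 1) : gronwallBound δ K ε x ≤ (δ + ε) * Real.exp K := by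
  have hK0 : K ≠ 0 := by positivity
  rw [gronwallBound_of_K_ne_0 hK0]
  have h1 : Real.exp (K * x) ≤ Real.exp K := Real.exp_le_exp.2 (by nlinarith)
  have h2 : ε / K ≤ ε := div_le_self hε hK
  have h3 := Real.exp_pos (K * x)
  have h4 : ε / K * (Real.exp (K * x) - 1) ≤ ε * Real.exp K := by
    have : 0 ≤ ε / K := by positivity
    nlinarith [Real.exp_pos K]
  have h5 := mul_le_mul_of_nonneg_left h1 hδ
  simp only
  linarith

/-- A linear differential equation with continuous coefficients has solutions on the whole
interval. -/
theorem exists_solution_linear_ode {F : Type*} [NormedAddCommGroup F] [NormedSpace ℝ F]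
    [FiniteDimensional ℝ F] {B : ℝ → F →L[ℝ] F} (hB : ContinuousOn B (Icc 0 1)) (y₀ : F) :
    ∃ y : ℝ → F, y 0 = y₀ ∧
      ∀ t ∈ Icc (0 : ℝ) 1, HasDerivWithinAt y (B t (y t)) (Icc 0 1) t := by
  have : CompleteSpace F := FiniteDimensional.complete ℝ F
  obtain ⟨M, hM⟩ := isCompact_Icc.exists_bound_of_continuousOn hB
  have hM0 : 0 ≤ M := (norm_nonneg _).trans (hM 0 (by simp))
  -- Larger than the Gronwall bound for solutions on [0, 1]. The equation is truncated outside the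
  -- ball of radius `R` to make the field bounded; the bound then shows that the truncation is never
  -- felt.
  set R := ‖y₀‖ * Real.exp M + 1
  have hR : 0 < R := by positivity
  let χ : ContDiffBump (0 : F) := ⟨R, R + 1, hR, by linarith⟩
  let ρ : F → F := fun y => χ y • y
  have hρs : HasCompactSupport ρ := χ.hasCompactSupport.smul_right
  have hρd : ContDiff ℝ 1 ρ := χ.contDiff.smul contDiff_id
  obtain ⟨C, hC⟩ := hρd.lipschitzWith_of_hasCompactSupport hρs (by simp)
  have hρn : ∀ y, ‖ρ y‖ ≤ ‖y‖ := fun y => by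
    simp only [ρ, norm_smul, Real.norm_eq_abs, abs_of_nonneg χ.nonneg]
    exact mul_le_of_le_one_left (norm_nonneg _) χ.le_one
  have hρb : ∀ y, ‖ρ y‖ ≤ R + 1 := fun y => by
    by_cases hy : y ∈ ball (0 : F) (R + 1)
    · exact (hρn y).trans (by simpa using (mem_ball_zero_iff.1 hy).le)
    · have : χ y = 0 := by
        by_contra h
        exact hy (by rw [← χ.support_eq]; exact h)
      simp only [ρ, this, zero_smul, norm_zero]; positivity
  -- A bound for the speed of the truncated field. As the time interval has length 1, it also serves
  -- as the radius of the Picard-Lindelöf ball.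
  let L : ℝ≥0 := ⟨M * (R + 1), by positivity⟩
  have hPL : IsPicardLindelof (fun t y => B t (ρ y)) (tmin := 0) (tmax := 1) ⟨0, by simp⟩ y₀
      L 0 L (⟨M, hM0⟩ * C) := by
    refine ⟨fun t ht => ?_, fun x _ => ?_, fun t ht x _ => ?_, by simp⟩
    · have : LipschitzWith ⟨M, hM0⟩ (B t) :=
        (B t).lipschitz.weaken (by exact_mod_cast hM t ht)
      exact (this.comp hC).lipschitzOnWith
    · exact hB.clm_apply continuousOn_const
    · exact ((B t).le_opNorm _).trans
        (mul_le_mul (hM t ht) (hρb x) (norm_nonneg _) hM0)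
  obtain ⟨y, hy0, hy⟩ := hPL.exists_eq_forall_mem_Icc_hasDerivWithinAt₀
  refine ⟨y, hy0, fun t ht => ?_⟩
  have hyc : ContinuousOn y (Icc 0 1) := fun t ht => (hy t ht).continuousWithinAt
  have hb := norm_le_gronwallBound_of_norm_deriv_right_le (K := M) (ε := 0) hyc
    (fun t ht => (hy t (Ico_subset_Icc_self ht)).mono_of_mem_nhdsWithin
      (Icc_mem_nhdsGE_of_mem ht)) (le_of_eq (by rw [hy0])) (fun t ht => by
      rw [add_zero]
      exact ((B t).le_opNorm _).trans
        (mul_le_mul (hM t (Ico_subset_Icc_self ht)) (hρn _) (norm_nonneg _) hM0)) t ht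
  rw [gronwallBound_ε0] at hb
  have h1 : χ (y t) = 1 := by
    apply χ.one_of_mem_closedBall
    rw [mem_closedBall_zero_iff]
    have : Real.exp (M * (t - 0)) ≤ Real.exp M := Real.exp_le_exp.2 (by nlinarith [ht.2])
    have := mul_le_mul_of_nonneg_left this (norm_nonneg y₀)
    change ‖y t‖ ≤ R
    simp only [R]; linarith
  have := hy t ht
  simpa only [ρ, h1, one_smul] using this

section Flow

variable {P E : Type u} [NormedAddCommGroup P] [NormedSpace ℝ P]
  [NormedAddCommGroup E] [NormedSpace ℝ E] {A : Set P} {K : Set E}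

theorem dist_flow_le {V : E → E} {C : ℝ≥0} (hV : LipschitzOnWith C V K) {x y : ℝ → E}
    (hx : ∀ t ∈ Icc (0 : ℝ) 1, x t ∈ K ∧ HasDerivWithinAt x (V (x t)) (Icc 0 1) t)
    (hy : ∀ t ∈ Icc (0 : ℝ) 1, y t ∈ K ∧ HasDerivWithinAt y (V (y t)) (Icc 0 1) t)
    {t : ℝ} (ht : t ∈ Icc (0 : ℝ) 1) :
    dist (x t) (y t) ≤ dist (x 0) (y 0) * Real.exp C := by
  have := dist_le_of_trajectories_ODE_of_mem (v := fun _ => V) (s := fun _ => K)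
    (fun _ _ => hV) (fun t ht => (hx t ht).2.continuousWithinAt)
    (fun t ht => (hx t (Ico_subset_Icc_self ht)).2.mono_of_mem_nhdsWithin
      (Icc_mem_nhdsGE_of_mem ht)) (fun t ht => (hx t (Ico_subset_Icc_self ht)).1)
    (fun t ht => (hy t ht).2.continuousWithinAt)
    (fun t ht => (hy t (Ico_subset_Icc_self ht)).2.mono_of_mem_nhdsWithin
      (Icc_mem_nhdsGE_of_mem ht)) (fun t ht => (hy t (Ico_subset_Icc_self ht)).1) le_rfl t ht
  refine this.trans (mul_le_mul_of_nonneg_left (Real.exp_le_exp.2 ?_) dist_nonneg)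
  have := C.2
  nlinarith [ht.2]

theorem exists_lipschitzOnWith_of_contDiffOn (hK : IsCompact K) (hKc : Convex ℝ K)
    (hKu : UniqueDiffOn ℝ K) {V : E → E} (hV : ContDiffOn ℝ ∞ V K) :
    ∃ C : ℝ≥0, LipschitzOnWith C V K := by
  obtain ⟨M, hM⟩ := hK.exists_bound_of_continuousOn (hV.continuousOn_fderivWithin hKu (by simp))
  refine ⟨M.toNNReal, hKc.lipschitzOnWith_of_nnnorm_fderivWithin_le
    (hV.differentiableOn (by simp)) fun x hx => ?_⟩
  rw [← NNReal.coe_le_coe, coe_nnnorm]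
  exact (hM x hx).trans (Real.le_coe_toNNReal M)

/-- The solution of the variational equation is the derivative of the flow with respect to the
parameter. -/
theorem hasFDerivWithinAt_flow (hK : IsCompact K) (hKc : Convex ℝ K)
    (hKu : UniqueDiffOn ℝ K) {V : E → E} (hV : ContDiffOn ℝ ∞ V K) {c : P → E} {θ : P → ℝ → E}
    (h0 : ∀ p ∈ A, θ p 0 = c p)
    (hθ : ∀ p ∈ A, ∀ t ∈ Icc (0 : ℝ) 1, θ p t ∈ K ∧
      HasDerivWithinAt (θ p) (V (θ p t)) (Icc 0 1) t)
    {p : P} (hp : p ∈ A) {c' : P →L[ℝ] E} (hc : HasFDerivWithinAt c c' A p)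
    {J : ℝ → P →L[ℝ] E} (hJ0 : J 0 = c')
    (hJ : ∀ t ∈ Icc (0 : ℝ) 1,
      HasDerivWithinAt J ((fderivWithin ℝ V K (θ p t)).comp (J t)) (Icc 0 1) t)
    {t : ℝ} (ht : t ∈ Icc (0 : ℝ) 1) : HasFDerivWithinAt (fun q => θ q t) (J t) A p := by
  obtain ⟨C, hC⟩ := exists_lipschitzOnWith_of_contDiffOn hK hKc hKu hV
  have hWc := hV.continuousOn_fderivWithin hKu (by simp)
  obtain ⟨M', hM'⟩ := hK.exists_bound_of_continuousOn hWc
  set M := max M' 1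
  have hM : ∀ x ∈ K, ‖fderivWithin ℝ V K x‖ ≤ M := fun x hx => (hM' x hx).trans (le_max_left _ _)
  have hM1 : 1 ≤ M := le_max_right _ _
  rw [hasFDerivWithinAt_iff_isLittleO, Asymptotics.isLittleO_iff]
  intro b hb
  set C₁ := (‖c'‖ + 1) * Real.exp C
  have hC₁ : 0 < C₁ := by positivity
  -- Chosen so that the initial error η‖q - p‖ and the defect ηC₁‖q - p‖, amplified by exp M, add up
  -- to exactly b‖q - p‖.
  set η := b / ((1 + C₁) * Real.exp M)
  have hη : 0 < η := by positivity
  have hc' := hasFDerivWithinAt_iff_isLittleO.1 hc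
  rw [Asymptotics.isLittleO_iff] at hc'
  obtain ⟨δ, hδ, hδW⟩ := Metric.uniformContinuousOn_iff.1
    (hK.uniformContinuousOn_of_continuous hWc) η hη
  have hnear : ∀ᶠ q in 𝓝[A] p, C₁ * ‖q - p‖ < δ := by
    have : Tendsto (fun q => C₁ * ‖q - p‖) (𝓝[A] p) (𝓝 0) := by
      have : Continuous fun q => C₁ * ‖q - p‖ := by fun_prop
      have h := this.tendsto p
      simp only [sub_self, norm_zero, mul_zero] at h
      exact h.mono_left nhdsWithin_le_nhds
    exact this.eventually (gt_mem_nhds hδ)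
  filter_upwards [hc' hη, hc' one_pos, hnear, self_mem_nhdsWithin] with q hq hq1 hqδ hqA
  have hcq : ‖c q - c p‖ ≤ (‖c'‖ + 1) * ‖q - p‖ := by
    have h1 : c q - c p = (c q - c p - c' (q - p)) + c' (q - p) := by abel
    rw [h1]
    refine (norm_add_le _ _).trans ?_
    have := c'.le_opNorm (q - p)
    linarith
  have hd : ∀ s ∈ Icc (0 : ℝ) 1, ‖θ q s - θ p s‖ ≤ C₁ * ‖q - p‖ := fun s hs => by
    have := dist_flow_le hC (hθ q hqA) (hθ p hp) hs
    rw [dist_eq_norm, dist_eq_norm, h0 q hqA, h0 p hp] at this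
    refine this.trans ?_
    have := mul_le_mul_of_nonneg_right hcq (Real.exp_pos C).le
    simp only [C₁]; linarith
  -- Gronwall for the linearized equation along `θ p`: `J s (q - p)` solves it exactly, and the
  -- difference of the two trajectories solves it up to the first-order Taylor error of `V`.
  have key := dist_le_of_approx_trajectories_ODE_of_mem (K := ⟨M, by positivity⟩)
    (v := fun s y => fderivWithin ℝ V K (θ p s) y) (s := fun _ => univ) (a := 0) (b := 1)
    (f := fun s => θ q s - θ p s) (g := fun s => J s (q - p))
    (f' := fun s => V (θ q s) - V (θ p s))
    (g' := fun s => (fderivWithin ℝ V K (θ p s)) (J s (q - p)))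
    (εf := η * (C₁ * ‖q - p‖)) (εg := 0) (δ := η * ‖q - p‖)
    (fun s hs => ((fderivWithin ℝ V K (θ p s)).lipschitz.weaken
      (by exact_mod_cast hM _ (hθ p hp s (Ico_subset_Icc_self hs)).1)).lipschitzOnWith)
    (fun s hs => ((hθ q hqA s hs).2.sub (hθ p hp s hs).2).continuousWithinAt)
    (fun s hs => ((hθ q hqA s (Ico_subset_Icc_self hs)).2.sub
      (hθ p hp s (Ico_subset_Icc_self hs)).2).mono_of_mem_nhdsWithin (Icc_mem_nhdsGE_of_mem hs))
    (fun s hs' => by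
      have hs := Ico_subset_Icc_self hs'
      have hqs := (hθ q hqA s hs).1
      have hps := (hθ p hp s hs).1
      -- Mean value inequality on the convex set K ∩ ball, where the derivative of `V` differs from
      -- its value at `θ p s` by at most η.
      have := ((hKc.inter (convex_ball (θ p s) δ)).norm_image_sub_le_of_norm_hasFDerivWithin_le'
        (f := V) (f' := fun x => fderivWithin ℝ V K x) (φ := fderivWithin ℝ V K (θ p s)) (C := η)
        (x := θ p s) (y := θ q s) ?_ ?_ ?_ ?_)
      · rw [dist_eq_norm]
        exact this.trans (mul_le_mul_of_nonneg_left (hd s hs) hη.le)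
      · intro x hx
        exact ((hV.differentiableOn (by simp)) x hx.1).hasFDerivWithinAt.mono inter_subset_left
      · intro x hx
        rw [← dist_eq_norm]
        exact (hδW x hx.1 _ hps hx.2).le
      · exact ⟨hps, mem_ball_self hδ⟩
      · exact ⟨hqs, by rw [mem_ball, dist_eq_norm]; exact (hd s hs).trans_lt hqδ⟩)
    (fun _ _ => mem_univ _)
    (fun s hs => ((hJ s hs).clm_apply (hasDerivWithinAt_const _ _ (q - p))).continuousWithinAt)
    (fun s hs => by
      have := ((hJ s (Ico_subset_Icc_self hs)).clm_apply
        (hasDerivWithinAt_const _ _ (q - p))).mono_of_mem_nhdsWithin (Icc_mem_nhdsGE_of_mem hs)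
      simpa using this)
    (fun s _ => by simp)
    (fun _ _ => mem_univ _)
    (by
      rw [hJ0, h0 q hqA, h0 p hp, dist_eq_norm]
      exact hq) t ht
  rw [dist_eq_norm] at key
  refine key.trans ((gronwallBound_le_add_mul_exp hM1 (by positivity) (by positivity)
    (by linarith [ht.2])).trans (le_of_eq ?_))
  change (η * ‖q - p‖ + (η * (C₁ * ‖q - p‖) + 0)) * Real.exp M = b * ‖q - p‖
  simp only [η]
  field_simp
  ring

end Flow

/-- Smooth dependence of the solutions of a smooth differential equation on a parameter. The
vector field is only assumed to be smooth on a compact convex set `K` containing the solutions. -/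
theorem contDiffOn_flow_nat (k : ℕ) {P E : Type u} [NormedAddCommGroup P] [NormedSpace ℝ P]
    [FiniteDimensional ℝ P] [NormedAddCommGroup E] [NormedSpace ℝ E] [FiniteDimensional ℝ E]
    {A : Set P} {K : Set E} (hA : IsCompact A) (hAu : UniqueDiffOn ℝ A) (hK : IsCompact K)
    (hKc : Convex ℝ K) (hKu : UniqueDiffOn ℝ K) {V : E → E} (hV : ContDiffOn ℝ ∞ V K)
    {c : P → E} (hc : ContDiffOn ℝ ∞ c A) {θ : P → ℝ → E} (h0 : ∀ p ∈ A, θ p 0 = c p)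
    (hθ : ∀ p ∈ A, ∀ t ∈ Icc (0 : ℝ) 1, θ p t ∈ K ∧
      HasDerivWithinAt (θ p) (V (θ p t)) (Icc 0 1) t)
    {t : ℝ} (ht : t ∈ Icc (0 : ℝ) 1) : ContDiffOn ℝ k (fun p => θ p t) A := by
  induction k generalizing E t with
  | zero =>
    obtain ⟨C, hC⟩ := exists_lipschitzOnWith_of_contDiffOn hK hKc hKu hV
    rw [CharP.cast_eq_zero, contDiffOn_zero]
    intro p hp
    have h1 : Tendsto (fun q => dist (c q) (c p) * Real.exp C) (𝓝[A] p) (𝓝 0) := by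
      have := ((hc.continuousOn p hp).dist
        (continuousWithinAt_const (b := c p))).mul_const (Real.exp C)
      simpa [ContinuousWithinAt] using this
    refine tendsto_iff_dist_tendsto_zero.2 (squeeze_zero' (.of_forall fun _ => dist_nonneg) ?_ h1)
    filter_upwards [self_mem_nhdsWithin] with q hq
    have := dist_flow_le hC (hθ q hq) (hθ p hp) ht
    rwa [h0 q hq, h0 p hp] at this
  | succ k ih =>
    have hW : ContDiffOn ℝ ∞ (fderivWithin ℝ V K) K := hV.fderivWithin hKu (by simp)
    have hDc : ContDiffOn ℝ ∞ (fderivWithin ℝ c A) A := hc.fderivWithin hAu (by simp)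
    have hθc : ∀ p ∈ A, ContinuousOn (θ p) (Icc 0 1) :=
      fun p hp t ht => (hθ p hp t ht).2.continuousWithinAt
    have hex : ∀ p ∈ A, ∃ J : ℝ → P →L[ℝ] E, J 0 = fderivWithin ℝ c A p ∧
        ∀ t ∈ Icc (0 : ℝ) 1,
          HasDerivWithinAt J ((fderivWithin ℝ V K (θ p t)).comp (J t)) (Icc 0 1) t := by
      intro p hp
      have hWp : ContinuousOn (fun t => fderivWithin ℝ V K (θ p t)) (Icc 0 1) :=
        hW.continuousOn.comp (hθc p hp) fun t ht => (hθ p hp t ht).1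
      have := exists_solution_linear_ode
        (B := fun t => ContinuousLinearMap.compL ℝ P E E (fderivWithin ℝ V K (θ p t)))
        ((ContinuousLinearMap.compL ℝ P E E).continuous.comp_continuousOn hWp)
        (fderivWithin ℝ c A p)
      simpa only [ContinuousLinearMap.compL_apply] using this
    choose! J hJ0 hJ using hex
    obtain ⟨M, hM⟩ := hK.exists_bound_of_continuousOn hW.continuousOn
    obtain ⟨D, hD⟩ := hA.exists_bound_of_continuousOn hDc.continuousOn
    rcases A.eq_empty_or_nonempty with rfl | ⟨p₀, hp₀⟩
    · exact contDiffOn_empty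
    have hD0 : 0 ≤ D := (norm_nonneg _).trans (hD p₀ hp₀)
    have hM0 : 0 ≤ M := (norm_nonneg _).trans (hM _ (hθ p₀ hp₀ 0 (by simp)).1)
    set R := D * Real.exp M + 1
    have hR : 0 < R := by positivity
    -- A bound uniform in the parameter, so that the augmented system again lives on a compact
    -- convex set.
    have hJb : ∀ p ∈ A, ∀ t ∈ Icc (0 : ℝ) 1, ‖J p t‖ ≤ R := by
      intro p hp t ht
      have := norm_le_gronwallBound_of_norm_deriv_right_le (K := M) (ε := 0) (δ := D)
        (fun s hs => (hJ p hp s hs).continuousWithinAt)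
        (fun s hs => (hJ p hp s (Ico_subset_Icc_self hs)).mono_of_mem_nhdsWithin
          (Icc_mem_nhdsGE_of_mem hs)) (by rw [hJ0 p hp]; exact hD p hp) (fun s hs => by
          rw [add_zero]
          exact (ContinuousLinearMap.opNorm_comp_le _ _).trans (mul_le_mul_of_nonneg_right
            (hM _ (hθ p hp s (Ico_subset_Icc_self hs)).1) (norm_nonneg _))) t ht
      rw [gronwallBound_ε0] at this
      have h2 : Real.exp (M * (t - 0)) ≤ Real.exp M := Real.exp_le_exp.2 (by nlinarith [ht.2])
      have := mul_le_mul_of_nonneg_left h2 hD0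
      simp only [R]; linarith
    have hJk : ContDiffOn ℝ k (fun p => J p t) A := by
      have hball : UniqueDiffOn ℝ (closedBall (0 : P →L[ℝ] E) R) :=
        uniqueDiffOn_convex (convex_closedBall _ _)
          ⟨0, ball_subset_interior_closedBall (mem_ball_self hR)⟩
      -- The pair (θ, J) solves the system formed by the equation and its variational equation,
      -- which is again autonomous and smooth. Its C^k dependence gives C^(k+1) dependence of θ.
      have := ih (E := E × (P →L[ℝ] E)) (K := K ×ˢ closedBall 0 R)
        (hK.prod (isCompact_closedBall _ _)) (hKc.prod (convex_closedBall _ _))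
        (hKu.prod hball) (V := fun z => (V z.1, (fderivWithin ℝ V K z.1).comp z.2))
        (((hV.comp contDiffOn_fst fun z hz => hz.1)).prodMk
          ((hW.comp contDiffOn_fst fun z hz => hz.1).clm_comp contDiffOn_snd))
        (c := fun p => (c p, fderivWithin ℝ c A p)) (hc.prodMk hDc)
        (θ := fun p t => (θ p t, J p t)) (fun p hp => by rw [h0 p hp, hJ0 p hp])
        (fun p hp t ht => ⟨⟨(hθ p hp t ht).1, by
          rw [mem_closedBall_zero_iff]; exact hJb p hp t ht⟩,
          (hθ p hp t ht).2.prodMk (hJ p hp t ht)⟩) ht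
      exact contDiff_snd.comp_contDiffOn this
    have hder : ∀ p ∈ A, HasFDerivWithinAt (fun q => θ q t) (J p t) A p := fun p hp =>
      hasFDerivWithinAt_flow hK hKc hKu hV h0 hθ hp
        ((hc.differentiableOn (by simp)) p hp).hasFDerivWithinAt (hJ0 p hp) (hJ p hp) ht
    rw [Nat.cast_succ]
    refine contDiffOn_succ_of_fderivWithin (fun p hp => (hder p hp).differentiableWithinAt)
      (by simp) (hJk.congr fun p hp => (hder p hp).fderivWithin (hAu p hp))

/-! ### Flows on a half-space, smooth up to the boundary -/

/-- A function that is stationary wherever it is nonpositive remains nonnegative. -/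
theorem nonneg_of_deriv_eq_zero_of_nonpos {γ : ℝ → ℝ} {a b t₀ : ℝ} (ht₀ : t₀ ∈ Ioo a b)
    (h0 : 0 ≤ γ t₀) (hγ : ∀ t ∈ Ioo a b, ∃ d, HasDerivAt γ d t ∧ (γ t ≤ 0 → d = 0))
    {t : ℝ} (ht : t ∈ Ioo a b) : 0 ≤ γ t := by
  -- The truncation min(γ, 0) is stationary everywhere, hence constant. The delicate case is γ(s) =
  -- 0, where |min(γ, 0)| ≤ |γ| and γ has zero derivative.
  have hd : ∀ s ∈ Ioo a b, HasDerivAt (fun s => min (γ s) 0) 0 s := by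
    intro s hs
    obtain ⟨d, hd, hd0⟩ := hγ s hs
    rcases lt_trichotomy (γ s) 0 with h | h | h
    · have : d = 0 := hd0 h.le
      rw [this] at hd
      refine hd.congr_of_eventuallyEq ?_
      filter_upwards [hd.continuousAt.eventually (gt_mem_nhds h)] with x hx
      exact min_eq_left hx.le
    · have : d = 0 := hd0 h.le
      rw [this] at hd
      rw [hasDerivAt_iff_isLittleO] at hd ⊢
      refine Asymptotics.IsBigO.trans_isLittleO (Asymptotics.isBigO_of_le _ fun x => ?_) hd
      simp only [h, min_self, sub_zero, smul_zero, Real.norm_eq_abs]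
      rcases le_total (γ x) 0 with h' | h'
      · rw [min_eq_left h']
      · rw [min_eq_right h']; simp
    · refine (hasDerivAt_const s (0 : ℝ)).congr_of_eventuallyEq ?_
      filter_upwards [hd.continuousAt.eventually (lt_mem_nhds h)] with x hx
      exact min_eq_right hx.le
  have := isOpen_Ioo.is_const_of_deriv_eq_zero isPreconnected_Ioo
    (fun s hs => (hd s hs).differentiableAt.differentiableWithinAt)
    (fun s hs => (hd s hs).deriv) ht ht₀
  rw [min_eq_right h0] at this
  exact min_eq_right_iff.1 this

/-- The Picard-Lindelöf solution stays in the ball on which the vector field is controlled. -/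
theorem exists_solution_mem_closedBall {E : Type*} [NormedAddCommGroup E] [NormedSpace ℝ E]
    [CompleteSpace E] {f : ℝ → E → E} {tmin tmax : ℝ} {t₀ : Icc tmin tmax} {x₀ x : E}
    {a r L K : ℝ≥0} (hf : IsPicardLindelof f t₀ x₀ a r L K) (hx : x ∈ closedBall x₀ r) :
    ∃ α : ℝ → E, α t₀ = x ∧ ∀ t ∈ Icc tmin tmax, α t ∈ closedBall x₀ a ∧
      HasDerivWithinAt α (f t (α t)) (Icc tmin tmax) t := by
  obtain ⟨α, hα⟩ := ODE.FunSpace.exists_isFixedPt_next hf hx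
  refine ⟨α.compProj, by rw [ODE.FunSpace.compProj_val, ← hα, ODE.FunSpace.next_apply₀],
    fun t ht => ⟨α.compProj_mem_closedBall hf.mul_max_le, ?_⟩⟩
  apply ODE.hasDerivWithinAt_picard_Icc t₀.2 hf.continuousOn_uncurry
    α.continuous_compProj.continuousOn (fun _ ht' => α.compProj_mem_closedBall hf.mul_max_le)
    x ht |>.congr_of_mem _ ht
  intro t' ht'
  nth_rw 1 [← hα]
  rw [ODE.FunSpace.compProj_of_mem ht', ODE.FunSpace.next_apply]

section HalfSpace

variable {m : ℕ} [NeZero m]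

variable (m) in
/-- The closed half-space `{y | 0 ≤ y 0}` on which manifolds with boundary are modelled. -/
def halfSpace : Set (EuclideanSpace ℝ (Fin m)) := {y | 0 ≤ y 0}

theorem mem_halfSpace {y : EuclideanSpace ℝ (Fin m)} : y ∈ halfSpace m ↔ 0 ≤ y 0 := Iff.rfl

theorem range_model : range (𝓡∂ m) = halfSpace m :=
  range_modelWithCornersEuclideanHalfSpace m

theorem isClosed_halfSpace : IsClosed (halfSpace m) :=
  isClosed_le continuous_const (by fun_prop)

theorem convex_halfSpace : Convex ℝ (halfSpace m) := by
  intro x hx y hy a b ha hb _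
  rw [mem_halfSpace] at *
  simp only [PiLp.add_apply, PiLp.smul_apply, smul_eq_mul]
  positivity

theorem halfSpace_mem_nhds {y : EuclideanSpace ℝ (Fin m)} (hy : 0 < y 0) :
    halfSpace m ∈ 𝓝 y := by
  have : Continuous fun z : EuclideanSpace ℝ (Fin m) => z 0 := by fun_prop
  filter_upwards [this.continuousAt.eventually (lt_mem_nhds hy)] with z hz
  exact hz.le

theorem uniqueDiffOn_halfSpace_inter_closedBall {y : EuclideanSpace ℝ (Fin m)}
    (hy : y ∈ halfSpace m) {R : ℝ} (hR : 0 < R) :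
    UniqueDiffOn ℝ (halfSpace m ∩ closedBall y R) := by
  refine uniqueDiffOn_convex (convex_halfSpace.inter (convex_closedBall _ _)) ?_
  refine ⟨y + EuclideanSpace.single 0 (R / 2), ?_⟩
  rw [mem_interior_iff_mem_nhds]
  refine inter_mem (halfSpace_mem_nhds ?_) (closedBall_mem_nhds_of_mem ?_)
  · rw [mem_halfSpace] at hy
    simp; linarith
  · simp [abs_of_pos hR, hR]

/-- The nearest point retraction to the half-space. -/
def clamp (y : EuclideanSpace ℝ (Fin m)) : EuclideanSpace ℝ (Fin m) :=
  WithLp.toLp 2 (Function.update y 0 (max (y 0) 0))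

theorem clamp_mem (y : EuclideanSpace ℝ (Fin m)) : clamp y ∈ halfSpace m := by
  simp [clamp, halfSpace]

theorem clamp_apply_zero (y : EuclideanSpace ℝ (Fin m)) : clamp y 0 = max (y 0) 0 := by
  simp [clamp]

theorem clamp_of_mem {y : EuclideanSpace ℝ (Fin m)} (hy : y ∈ halfSpace m) : clamp y = y := by
  ext i
  by_cases h : i = 0
  · subst h; rw [clamp_apply_zero]; exact max_eq_left hy
  · simp [clamp, h]

theorem lipschitzWith_clamp : LipschitzWith 1 (clamp (m := m)) := by
  refine LipschitzWith.of_dist_le_mul fun x y => ?_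
  rw [NNReal.coe_one, one_mul, EuclideanSpace.dist_eq, EuclideanSpace.dist_eq]
  refine Real.sqrt_le_sqrt (Finset.sum_le_sum fun i _ => ?_)
  have : dist (clamp x i) (clamp y i) ≤ dist (x i) (y i) := by
    by_cases h : i = 0
    · subst h
      rw [clamp_apply_zero, clamp_apply_zero, Real.dist_eq, Real.dist_eq]
      exact abs_max_sub_max_le_abs _ _ _
    · simp [clamp, h]
  gcongr

/-- The local flow of a smooth vector field on a half-space that is tangent to the bounding
hyperplane. -/
theorem exists_localFlow_halfSpace {O : Set (EuclideanSpace ℝ (Fin m))} (hO : IsOpen O)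
    {V : EuclideanSpace ℝ (Fin m) → EuclideanSpace ℝ (Fin m)}
    (hV : ContDiffOn ℝ ∞ V (halfSpace m ∩ O))
    (htan : ∀ y ∈ halfSpace m ∩ O, y 0 = 0 → V y 0 = 0)
    {y₀ : EuclideanSpace ℝ (Fin m)} (hy₀ : y₀ ∈ halfSpace m ∩ O) :
    ∃ ε > 0, ∃ r > 0, ∃ θ : EuclideanSpace ℝ (Fin m) → ℝ → EuclideanSpace ℝ (Fin m),
      (∀ y ∈ halfSpace m ∩ ball y₀ r, θ y 0 = y ∧ ∀ t ∈ Ioo (-ε) ε,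
        θ y t ∈ halfSpace m ∩ O ∧ HasDerivAt (θ y) (V (θ y t)) t) ∧
      ContDiffOn ℝ ∞ (fun z : EuclideanSpace ℝ (Fin m) × ℝ => θ z.1 z.2)
        ((halfSpace m ∩ ball y₀ r) ×ˢ Ioo (-ε) ε) := by
  obtain ⟨R, hR, hRO⟩ := Metric.nhds_basis_closedBall.mem_iff.1 (hO.mem_nhds hy₀.2)
  set K := halfSpace m ∩ closedBall y₀ R
  have hKO : K ⊆ halfSpace m ∩ O := inter_subset_inter_right _ hRO
  have hK : IsCompact K := (isCompact_closedBall _ _).inter_left isClosed_halfSpace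
  have hKc : Convex ℝ K := convex_halfSpace.inter (convex_closedBall _ _)
  have hKu : UniqueDiffOn ℝ K := uniqueDiffOn_halfSpace_inter_closedBall hy₀.1 hR
  have hVK : ContDiffOn ℝ ∞ V K := hV.mono hKO
  obtain ⟨C, hC⟩ := exists_lipschitzOnWith_of_contDiffOn hK hKc hKu hVK
  obtain ⟨L, hL⟩ := hK.exists_bound_of_continuousOn hVK.continuousOn
  have hcl : MapsTo clamp (closedBall y₀ R) K := fun y hy => by
    refine ⟨clamp_mem y, ?_⟩
    have := lipschitzWith_clamp.dist_le_mul y y₀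
    rw [clamp_of_mem hy₀.1, NNReal.coe_one, one_mul] at this
    exact this.trans hy
  have hL0 : 0 ≤ L := (norm_nonneg _).trans (hL _ (hcl (mem_closedBall_self hR.le)))
  -- At speed at most `L`, a solution starting within R/2 of `y₀` stays within R during this time.
  set ε₁ := R / 2 / (L + 1)
  have hε₁ : 0 < ε₁ := by positivity
  let a : ℝ≥0 := .mk R hR.le
  let r : ℝ≥0 := .mk (R / 2) (by positivity)
  -- Composition with `clamp` extends the field to a full ball while preserving its Lipschitz and
  -- sup bounds.
  have hPL : IsPicardLindelof (fun _ y => V (clamp y)) (tmin := -ε₁) (tmax := ε₁)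
      ⟨0, by simp [hε₁.le]⟩ y₀ a r (.mk L hL0) (C * 1) := by
    refine .of_time_independent (fun x hx => hL _ (hcl hx))
      (hC.comp lipschitzWith_clamp.lipschitzOnWith hcl) ?_
    change L * max (ε₁ - 0) (0 - (-ε₁)) ≤ R - R / 2
    rw [sub_zero, zero_sub, neg_neg, max_self]
    have : ε₁ * (L + 1) = R / 2 := by simp only [ε₁]; field_simp
    nlinarith
  have hex : ∀ y ∈ closedBall y₀ (R / 2), ∃ α : ℝ → EuclideanSpace ℝ (Fin m), α 0 = y ∧
      ∀ t ∈ Ioo (-ε₁) ε₁, α t ∈ closedBall y₀ R ∧ HasDerivAt α (V (clamp (α t))) t := by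
    intro y hy
    obtain ⟨α, hα0, hα⟩ := exists_solution_mem_closedBall hPL (x := y) hy
    exact ⟨α, hα0, fun t ht => ⟨(hα t (Ioo_subset_Icc_self ht)).1,
      (hα t (Ioo_subset_Icc_self ht)).2.hasDerivAt (Icc_mem_nhds ht.1 ht.2)⟩⟩
  choose! θ hθ0 hθ using hex
  have hstay : ∀ y ∈ halfSpace m ∩ closedBall y₀ (R / 2), ∀ t ∈ Ioo (-ε₁) ε₁,
      θ y t ∈ K ∧ HasDerivAt (θ y) (V (θ y t)) t := by
    intro y hy
    -- Where the first coordinate is nonpositive, `clamp` lands on the hyperplane, where the field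
    -- has zero first component. So this coordinate is stationary there and cannot become negative.
    have hpos : ∀ t ∈ Ioo (-ε₁) ε₁, 0 ≤ θ y t 0 := by
      intro t ht
      refine nonneg_of_deriv_eq_zero_of_nonpos (γ := fun s => θ y s 0) (t₀ := 0) (by simp [hε₁]) ?_ (fun s hs => ?_) ht
      · rw [hθ0 y hy.2]; exact hy.1
      · refine ⟨V (clamp (θ y s)) 0, ?_, fun h => ?_⟩
        · exact (EuclideanSpace.proj (𝕜 := ℝ) (0 : Fin m)).hasFDerivAt.comp_hasDerivAt s
            (hθ y hy.2 s hs).2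
        · exact htan _ (hKO (hcl (hθ y hy.2 s hs).1)) (by rw [clamp_apply_zero, max_eq_right h])
    intro t ht
    have := (hθ y hy.2 t ht).2
    rw [clamp_of_mem (hpos t ht)] at this
    exact ⟨⟨hpos t ht, (hθ y hy.2 t ht).1⟩, this⟩
  -- Halved to have a closed time interval: smooth dependence is available on compact parameter
  -- sets.
  set ε := ε₁ / 2
  have hε : 0 < ε := by positivity
  have hεε : Icc (-ε) ε ⊆ Ioo (-ε₁) ε₁ := fun t ht =>
    ⟨by have := ht.1; simp only [ε] at this; linarith,
      by have := ht.2; simp only [ε] at this; linarith⟩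
  refine ⟨ε, hε, R / 2, by positivity, θ, fun y hy => ?_, ?_⟩
  · have hy' : y ∈ halfSpace m ∩ closedBall y₀ (R / 2) := ⟨hy.1, ball_subset_closedBall hy.2⟩
    refine ⟨hθ0 y hy'.2, fun t ht => ?_⟩
    have := hstay y hy' t (hεε (Ioo_subset_Icc_self ht))
    exact ⟨hKO this.1, this.2⟩
  · set A := (halfSpace m ∩ closedBall y₀ (R / 2)) ×ˢ Icc (-ε) ε
    have hI : UniqueDiffOn ℝ (Icc (-ε) ε) := uniqueDiffOn_Icc (by linarith)
    -- Joint smoothness in (y, s) is reduced to smoothness in a parameter: the flow of V for time s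
    -- is the flow of s • V for time 1, with s carried along as a constant component of the state.
    have hflow : ContDiffOn ℝ ∞
        (fun z : EuclideanSpace ℝ (Fin m) × ℝ => (θ z.1 (z.2 * 1), z.2)) A := by
      rw [contDiffOn_infty]
      intro k
      refine contDiffOn_flow_nat k (K := K ×ˢ Icc (-ε) ε)
        (V := fun z => (z.2 • V z.1, 0)) (c := fun z => z) (t := 1)
        (θ := fun z t => (θ z.1 (z.2 * t), z.2)) ?_ ?_ (hK.prod isCompact_Icc)
        (hKc.prod (convex_Icc _ _)) (hKu.prod hI) ?_ contDiffOn_id ?_ ?_ (by simp)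
      · exact ((isCompact_closedBall _ _).inter_left isClosed_halfSpace).prod isCompact_Icc
      · exact (uniqueDiffOn_halfSpace_inter_closedBall hy₀.1 (by positivity)).prod hI
      · exact (contDiffOn_snd.smul (hVK.comp contDiffOn_fst fun z hz => hz.1)).prodMk
          contDiffOn_const
      · rintro ⟨y, s⟩ ⟨hy, hs⟩
        simp [hθ0 y hy.2]
      · rintro ⟨y, s⟩ ⟨hy, hs⟩ t ht
        have hst : s * t ∈ Icc (-ε) ε := by
          constructor
          · have h1 := hs.1
            have h2 := ht.2
            have h3 := ht.1
            simp only at h1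
            nlinarith
          · have h1 := hs.2
            have h2 := ht.2
            have h3 := ht.1
            simp only at h1
            nlinarith
        have := hstay y hy _ (hεε hst)
        refine ⟨⟨this.1, hs⟩, ?_⟩
        refine (HasDerivAt.prodMk ?_ (hasDerivAt_const _ _)).hasDerivWithinAt
        have h2 : HasDerivAt (fun t : ℝ => s * t) s t := by
          simpa using (hasDerivAt_id t).const_mul s
        exact HasDerivAt.scomp t this.2 h2
    have := contDiff_fst.comp_contDiffOn hflow
    simp only [mul_one] at this
    exact this.mono (prod_mono (inter_subset_inter_right _ ball_subset_closedBall)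
      Ioo_subset_Icc_self)

end HalfSpace

/-! ### Calculus in charts of a manifold with boundary -/

/-- Euclidean space of dimension `m`. -/
abbrev Euc (m : ℕ) : Type := EuclideanSpace ℝ (Fin m)

section Chart

variable {m : ℕ} [NeZero m] {M : Type*} [TopologicalSpace M]
  [ChartedSpace (EuclideanHalfSpace m) M]

/-- The coordinates given by a chart, as a map to Euclidean space. -/
abbrev coord (e : OpenPartialHomeomorph M (EuclideanHalfSpace m)) : M → Euc m :=
  e.extend (𝓡∂ m)

/-- The parametrization inverse to the coordinates given by a chart. -/
abbrev coordSymm (e : OpenPartialHomeomorph M (EuclideanHalfSpace m)) : Euc m → M :=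
  (e.extend (𝓡∂ m)).symm

/-- The image of the coordinates given by a chart. -/
abbrev coordTarget (e : OpenPartialHomeomorph M (EuclideanHalfSpace m)) : Set (Euc m) :=
  (e.extend (𝓡∂ m)).target

/-- The differential of a function on a manifold, as a linear form on the model space. -/
def diffAt (f : M → ℝ) (p : M) : Euc m →L[ℝ] ℝ :=
  mfderiv (𝓡∂ m) 𝓘(ℝ, ℝ) f p

/-- The differential of the coordinates given by a chart. -/
def coordDeriv (e : OpenPartialHomeomorph M (EuclideanHalfSpace m)) (p : M) : Euc m →L[ℝ] Euc m :=
  mfderiv (𝓡∂ m) 𝓘(ℝ, Euc m) (coord e) p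

/-- The differential of the parametrization given by a chart. -/
def coordSymmDeriv (e : OpenPartialHomeomorph M (EuclideanHalfSpace m)) (y : Euc m) :
    Euc m →L[ℝ] Euc m :=
  mfderivWithin 𝓘(ℝ, Euc m) (𝓡∂ m) (coordSymm e) (coordTarget e) y

variable {e : OpenPartialHomeomorph M (EuclideanHalfSpace m)}

theorem coordTarget_eq (e : OpenPartialHomeomorph M (EuclideanHalfSpace m)) :
    coordTarget e = halfSpace m ∩ ((𝓡∂ m).symm ⁻¹' e.target) := by
  rw [coordTarget, OpenPartialHomeomorph.extend_target, range_model, inter_comm]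

theorem isOpen_preimage_target (e : OpenPartialHomeomorph M (EuclideanHalfSpace m)) :
    IsOpen ((𝓡∂ m).symm ⁻¹' e.target) :=
  e.open_target.preimage (𝓡∂ m).continuous_symm

theorem coordTarget_subset : coordTarget e ⊆ halfSpace m := by
  rw [coordTarget_eq]; exact inter_subset_left

theorem uniqueDiffOn_coordTarget : UniqueDiffOn ℝ (coordTarget e) := by
  rw [coordTarget_eq, ← range_model]
  exact (𝓡∂ m).uniqueDiffOn.inter (isOpen_preimage_target e)

theorem coord_mem {p : M} (hp : p ∈ e.source) : coord e p ∈ coordTarget e :=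
  (e.extend (𝓡∂ m)).map_source (by rwa [e.extend_source])

theorem coordSymm_mem {y : Euc m} (hy : y ∈ coordTarget e) : coordSymm e y ∈ e.source := by
  have := (e.extend (𝓡∂ m)).map_target hy
  rwa [e.extend_source] at this

theorem coordSymm_coord {p : M} (hp : p ∈ e.source) : coordSymm e (coord e p) = p :=
  (e.extend (𝓡∂ m)).left_inv (by rwa [e.extend_source])

theorem coord_coordSymm {y : Euc m} (hy : y ∈ coordTarget e) : coord e (coordSymm e y) = y :=
  (e.extend (𝓡∂ m)).right_inv hy

theorem coordTarget_mem_nhdsWithin {y : Euc m} (hy : y ∈ coordTarget e) :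
    coordTarget e ∈ 𝓝[halfSpace m] y := by
  rw [coordTarget_eq] at hy ⊢
  exact inter_mem self_mem_nhdsWithin
    (mem_nhdsWithin_of_mem_nhds ((isOpen_preimage_target e).mem_nhds hy.2))

theorem continuousAt_coord {p : M} (hp : p ∈ e.source) : ContinuousAt (coord e) p :=
  e.continuousAt_extend hp

theorem continuousOn_coordSymm : ContinuousOn (coordSymm e) (coordTarget e) :=
  e.continuousOn_extend_symm

/-- Neighbourhoods of a point, read in coordinates. -/
theorem eventually_coordSymm {y : Euc m} (hy : y ∈ coordTarget e) {P : M → Prop}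
    (hP : ∀ᶠ p in 𝓝 (coordSymm e y), P p) : ∀ᶠ z in 𝓝[halfSpace m] y, P (coordSymm e z) := by
  have h1 : 𝓝[halfSpace m] y = 𝓝[coordTarget e] y :=
    le_antisymm (nhdsWithin_le_iff.2 (coordTarget_mem_nhdsWithin hy))
      (nhdsWithin_mono _ coordTarget_subset)
  rw [h1]
  exact (continuousOn_coordSymm y hy).eventually hP

variable [IsManifold (𝓡∂ m) ∞ M]

theorem contMDiffOn_coordSymm (he : e ∈ IsManifold.maximalAtlas (𝓡∂ m) ∞ M) :
    ContMDiffOn 𝓘(ℝ, Euc m) (𝓡∂ m) ∞ (coordSymm e) (coordTarget e) := by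
  have := contMDiffOn_extend_symm he
  rwa [(𝓡∂ m).image_eq, ← e.extend_target] at this

theorem contMDiffOn_coord (he : e ∈ IsManifold.maximalAtlas (𝓡∂ m) ∞ M) :
    ContMDiffOn (𝓡∂ m) 𝓘(ℝ, Euc m) ∞ (coord e) e.source :=
  e.contMDiffOn_extend he

theorem hasMFDerivAt_coord (he : e ∈ IsManifold.maximalAtlas (𝓡∂ m) ∞ M) {p : M}
    (hp : p ∈ e.source) : HasMFDerivAt (𝓡∂ m) 𝓘(ℝ, Euc m) (coord e) p (coordDeriv e p) :=
  ((e.contMDiffAt_extend he hp).mdifferentiableAt (by simp)).hasMFDerivAt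

theorem hasMFDerivWithinAt_coordSymm (he : e ∈ IsManifold.maximalAtlas (𝓡∂ m) ∞ M) {y : Euc m}
    (hy : y ∈ coordTarget e) :
    HasMFDerivWithinAt 𝓘(ℝ, Euc m) (𝓡∂ m) (coordSymm e) (coordTarget e) y (coordSymmDeriv e y) :=
  ((contMDiffOn_coordSymm he y hy).mdifferentiableWithinAt (by simp)).hasMFDerivWithinAt

/-- The derivative of the parametrization is taken within the target, which need not be open. Unique
differentiability there still allows the identity map to be differentiated. -/
theorem coordDeriv_coordSymmDeriv (he : e ∈ IsManifold.maximalAtlas (𝓡∂ m) ∞ M) {y : Euc m}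
    (hy : y ∈ coordTarget e) (v : Euc m) :
    coordDeriv e (coordSymm e y) (coordSymmDeriv e y v) = v := by
  have h1 := (hasMFDerivAt_coord he (coordSymm_mem hy)).comp_hasMFDerivWithinAt y
    (hasMFDerivWithinAt_coordSymm he hy)
  have h2 : HasFDerivWithinAt (coord e ∘ coordSymm e) (ContinuousLinearMap.id ℝ (Euc m))
      (coordTarget e) y :=
    (hasFDerivWithinAt_id _ _).congr (fun z hz => coord_coordSymm hz) (coord_coordSymm hy)
  have h3 : HasFDerivWithinAt (coord e ∘ coordSymm e)
      ((coordDeriv e (coordSymm e y)).comp (coordSymmDeriv e y)) (coordTarget e) y :=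
    hasMFDerivWithinAt_iff_hasFDerivWithinAt.1 h1
  exact DFunLike.congr_fun ((uniqueDiffOn_coordTarget y hy).eq h3 h2) v

/-- Both maps act on the same finite-dimensional space, so a one-sided inverse is two-sided. -/
theorem coordSymmDeriv_coordDeriv (he : e ∈ IsManifold.maximalAtlas (𝓡∂ m) ∞ M) {p : M}
    (hp : p ∈ e.source) (v : Euc m) :
    coordSymmDeriv e (coord e p) (coordDeriv e p v) = v := by
  have hs : Function.Surjective (coordSymmDeriv e (coord e p)) := by
    have hinj : Function.Injective (coordSymmDeriv e (coord e p)).toLinearMap := fun a b hab => by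
      have ha := coordDeriv_coordSymmDeriv he (coord_mem hp) a
      have hb := coordDeriv_coordSymmDeriv he (coord_mem hp) b
      rw [← ha, ← hb]
      exact congrArg _ hab
    exact LinearMap.surjective_of_injective hinj
  obtain ⟨w, rfl⟩ := hs v
  have := coordDeriv_coordSymmDeriv he (coord_mem hp) w
  rw [coordSymm_coord hp] at this
  rw [this]

theorem contDiffOn_comp_coordSymm (he : e ∈ IsManifold.maximalAtlas (𝓡∂ m) ∞ M) {f : M → ℝ}
    (hf : ContMDiffOn (𝓡∂ m) 𝓘(ℝ, ℝ) ∞ f e.source) :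
    ContDiffOn ℝ ∞ (f ∘ coordSymm e) (coordTarget e) :=
  (hf.comp (contMDiffOn_coordSymm he) fun _ hy => coordSymm_mem hy).contDiffOn

theorem hasFDerivWithinAt_comp_coordSymm (he : e ∈ IsManifold.maximalAtlas (𝓡∂ m) ∞ M)
    {f : M → ℝ} {y : Euc m} (hy : y ∈ coordTarget e)
    (hf : MDifferentiableAt (𝓡∂ m) 𝓘(ℝ, ℝ) f (coordSymm e y)) :
    HasFDerivWithinAt (f ∘ coordSymm e) ((diffAt f (coordSymm e y)).comp (coordSymmDeriv e y))
      (coordTarget e) y := by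
  have := hf.hasMFDerivAt.comp_hasMFDerivWithinAt y (hasMFDerivWithinAt_coordSymm he hy)
  rw [hasMFDerivWithinAt_iff_hasFDerivWithinAt] at this
  exact this

theorem diffAt_comp_coord (he : e ∈ IsManifold.maximalAtlas (𝓡∂ m) ∞ M) {p : M}
    (hp : p ∈ e.source) {F : Euc m → ℝ} {F' : Euc m →L[ℝ] ℝ} {f : M → ℝ}
    (hf : f =ᶠ[𝓝 p] F ∘ coord e)
    (hF : HasFDerivWithinAt F F' (coordTarget e) (coord e p)) :
    diffAt f p = F'.comp (coordDeriv e p) := by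
  have h1 : HasMFDerivWithinAt (𝓡∂ m) 𝓘(ℝ, ℝ) (F ∘ coord e) e.source p
      (F'.comp (coordDeriv e p)) :=
    HasMFDerivWithinAt.comp p (hasMFDerivWithinAt_iff_hasFDerivWithinAt.2 hF)
      (hasMFDerivAt_coord he hp).hasMFDerivWithinAt fun q hq => coord_mem hq
  exact ((h1.hasMFDerivAt (e.open_source.mem_nhds hp)).congr_of_eventuallyEq hf).mfderiv

/-- A curve is tangent at time `t` to the vector field `V`. -/
def IsFlowLineAt (V : M → Euc m) (γ : ℝ → M) (t : ℝ) : Prop :=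
  HasMFDerivAt 𝓘(ℝ, ℝ) (𝓡∂ m) γ t (ContinuousLinearMap.toSpanSingleton ℝ (V (γ t)))

/-- A vector field read in a chart. -/
def coordField (V : M → Euc m) (e : OpenPartialHomeomorph M (EuclideanHalfSpace m)) (y : Euc m) :
    Euc m :=
  coordDeriv e (coordSymm e y) (V (coordSymm e y))

theorem IsFlowLineAt.continuousAt {V : M → Euc m} {γ : ℝ → M} {t : ℝ} (h : IsFlowLineAt V γ t) :
    ContinuousAt γ t :=
  HasMFDerivAt.continuousAt h

theorem IsFlowLineAt.hasDerivAt_coord (he : e ∈ IsManifold.maximalAtlas (𝓡∂ m) ∞ M)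
    {V : M → Euc m} {γ : ℝ → M} {t : ℝ} (h : IsFlowLineAt V γ t) (ht : γ t ∈ e.source) :
    HasDerivAt (coord e ∘ γ) (coordField V e (coord e (γ t))) t := by
  have h1 := (hasMFDerivAt_coord he ht).comp t h
  have h2 : HasFDerivAt (coord e ∘ γ) ((coordDeriv e (γ t)).comp
      (ContinuousLinearMap.toSpanSingleton ℝ (V (γ t)))) t := hasMFDerivAt_iff_hasFDerivAt.1 h1
  refine h2.hasDerivAt.congr_deriv ?_
  rw [coordField, coordSymm_coord ht]
  simp

theorem IsFlowLineAt.hasDerivAt_comp {V : M → Euc m} {γ : ℝ → M} {t : ℝ} (h : IsFlowLineAt V γ t)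
    {f : M → ℝ} (hf : MDifferentiableAt (𝓡∂ m) 𝓘(ℝ, ℝ) f (γ t)) :
    HasDerivAt (f ∘ γ) (diffAt f (γ t) (V (γ t))) t := by
  have h1 := hf.hasMFDerivAt.comp t h
  have h2 : HasFDerivAt (f ∘ γ) ((diffAt f (γ t)).comp
      (ContinuousLinearMap.toSpanSingleton ℝ (V (γ t)))) t := hasMFDerivAt_iff_hasFDerivAt.1 h1
  refine h2.hasDerivAt.congr_deriv ?_
  simp

/-- The parametrization is differentiable only within the target, so the chain rule needs the curve
to remain in it for all times near `t`. This is why tangency of the field to the boundary matters.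
-/
theorem isFlowLineAt_coordSymm_comp (he : e ∈ IsManifold.maximalAtlas (𝓡∂ m) ∞ M)
    {V : M → Euc m} {y : ℝ → Euc m} {t : ℝ} (hyT : ∀ᶠ s in 𝓝 t, y s ∈ coordTarget e)
    (hy : HasDerivAt y (coordField V e (y t)) t) : IsFlowLineAt V (coordSymm e ∘ y) t := by
  have h1 : HasMFDerivAt 𝓘(ℝ, ℝ) 𝓘(ℝ, Euc m) y t
      (ContinuousLinearMap.toSpanSingleton ℝ (coordField V e (y t))) :=
    hasMFDerivAt_iff_hasFDerivAt.2 hy.hasFDerivAt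
  have h2 := (HasMFDerivWithinAt.comp t (hasMFDerivWithinAt_coordSymm he hyT.self_of_nhds)
    (h1.hasMFDerivWithinAt (s := {s | y s ∈ coordTarget e})) fun s hs => hs).hasMFDerivAt hyT
  refine h2.congr_mfderiv ?_
  refine ContinuousLinearMap.ext fun c : ℝ => ?_
  change coordSymmDeriv e (y t) (c • coordField V e (y t)) = c • V (coordSymm e (y t))
  rw [map_smul, coordField]
  have := coordSymmDeriv_coordDeriv he (coordSymm_mem hyT.self_of_nhds) (V (coordSymm e (y t)))
  rw [coord_coordSymm hyT.self_of_nhds] at this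
  rw [this]

end Chart

/-! ### Positive forms, Riemannian metrics and gradients -/

section Dual

variable {E : Type*} [NormedAddCommGroup E] [NormedSpace ℝ E] [FiniteDimensional ℝ E]

/-- A positive definite bilinear form on a finite-dimensional space is nondegenerate. -/
theorem isInvertible_of_pos {G : E →L[ℝ] E →L[ℝ] ℝ} (hG : ∀ v, v ≠ 0 → 0 < G v v) :
    G.IsInvertible := by
  have hinj : Function.Injective G.toLinearMap := by
    rw [← LinearMap.ker_eq_bot, LinearMap.ker_eq_bot']
    intro v hv
    by_contra h
    have := hG v h
    have h2 : G v = 0 := hv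
    rw [h2] at this
    simp at this
  have hdim : Module.finrank ℝ E = Module.finrank ℝ (E →L[ℝ] ℝ) := by
    rw [← (LinearMap.toContinuousLinearMap (𝕜 := ℝ) (E := E) (F' := ℝ)).finrank_eq,
      Subspace.dual_finrank_eq]
  refine ⟨(LinearMap.linearEquivOfInjective G.toLinearMap hinj hdim).toContinuousLinearEquiv, ?_⟩
  ext v w
  rfl

theorem apply_inverse_of_pos {G : E →L[ℝ] E →L[ℝ] ℝ} (hG : ∀ v, v ≠ 0 → 0 < G v v)
    (α : E →L[ℝ] ℝ) : G (G.inverse α) = α := by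
  obtain ⟨G', rfl⟩ := isInvertible_of_pos hG
  simp

theorem inverse_eq_of_apply_eq {G : E →L[ℝ] E →L[ℝ] ℝ} (hG : ∀ v, v ≠ 0 → 0 < G v v)
    {α : E →L[ℝ] ℝ} {v : E} (hv : G v = α) : G.inverse α = v := by
  obtain ⟨G', rfl⟩ := isInvertible_of_pos hG
  rw [← hv]
  simp

theorem apply_inverse_self_pos {G : E →L[ℝ] E →L[ℝ] ℝ} (hG : ∀ v, v ≠ 0 → 0 < G v v)
    {α : E →L[ℝ] ℝ} (hα : α ≠ 0) : 0 < α (G.inverse α) := by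
  have h1 := apply_inverse_of_pos hG α
  have : G.inverse α ≠ 0 := fun h => hα (by rw [← h1, h, map_zero])
  have := hG _ this
  rwa [h1] at this

/-- Inversion of continuous linear maps is smooth at invertible ones, and positivity supplies
invertibility. -/
theorem contDiffOn_inverse_apply {F : Type*} [NormedAddCommGroup F] [NormedSpace ℝ F]
    {G : F → E →L[ℝ] E →L[ℝ] ℝ} {α : F → E →L[ℝ] ℝ} {s : Set F}
    (hG : ContDiffOn ℝ ∞ G s) (hpos : ∀ y ∈ s, ∀ v, v ≠ 0 → 0 < G y v v)
    (hα : ContDiffOn ℝ ∞ α s) : ContDiffOn ℝ ∞ (fun y => (G y).inverse (α y)) s := by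
  have : CompleteSpace E := FiniteDimensional.complete ℝ E
  refine ContDiffOn.clm_apply (fun y hy => ?_) hα
  exact (isInvertible_of_pos (hpos y hy)).contDiffAt_map_inverse.comp_contDiffWithinAt y (hG y hy)

end Dual

section Metric

variable {m : ℕ} [NeZero m] {M : Type*} [TopologicalSpace M]
  [ChartedSpace (EuclideanHalfSpace m) M] [IsManifold (𝓡∂ m) ∞ M]

/-- The scalar product of a Riemannian metric at a point, as a bilinear form on the model space. -/
def metricAt (g : Met m M) (p : M) : Euc m →L[ℝ] Euc m →L[ℝ] ℝ := g.inner p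

theorem metricAt_pos (g : Met m M) (p : M) {v : Euc m} (hv : v ≠ 0) : 0 < metricAt g p v v :=
  g.pos p v hv

theorem metricAt_symm (g : Met m M) (p : M) (v w : Euc m) :
    metricAt g p v w = metricAt g p w v :=
  g.symm p v w

/-- A Riemannian metric is smooth when evaluated on smooth vector fields along a map. -/
theorem contMDiffWithinAt_inner {EN HN N : Type*} [NormedAddCommGroup EN] [NormedSpace ℝ EN]
    [TopologicalSpace HN] {J : ModelWithCorners ℝ EN HN} [TopologicalSpace N] [ChartedSpace HN N]
    (g : Met m M) {b : N → M} {v w : ∀ x, TangentSpace (𝓡∂ m) (b x)} {s : Set N} {x : N}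
    (hv : ContMDiffWithinAt J (𝓡∂ m).tangent ∞
      (fun x => (⟨b x, v x⟩ : TangentBundle (𝓡∂ m) M)) s x)
    (hw : ContMDiffWithinAt J (𝓡∂ m).tangent ∞
      (fun x => (⟨b x, w x⟩ : TangentBundle (𝓡∂ m) M)) s x) :
    ContMDiffWithinAt J 𝓘(ℝ, ℝ) ∞ (fun x => g.inner (b x) (v x) (w x)) s x := by
  have hb : ContMDiffWithinAt J (𝓡∂ m) ∞ b s x := by
    simp only [contMDiffWithinAt_totalSpace] at hv
    exact hv.1
  have : ContMDiffWithinAt J ((𝓡∂ m).prod 𝓘(ℝ)) ∞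
      (fun x ↦ TotalSpace.mk' ℝ (E := Bundle.Trivial M ℝ) (b x) (g.inner (b x) (v x) (w x)))
      s x := by
    apply ContMDiffWithinAt.clm_bundle_apply₂ (F₁ := Euc m) (F₂ := Euc m)
    · exact ContMDiffAt.comp_contMDiffWithinAt x g.contMDiff.contMDiffAt hb
    · exact hv
    · exact hw
  simp only [contMDiffWithinAt_totalSpace] at this
  exact this.2

/-- A Riemannian metric read in a chart. -/
def metricCoord (g : Met m M) (e : OpenPartialHomeomorph M (EuclideanHalfSpace m)) (y : Euc m) :
    Euc m →L[ℝ] Euc m →L[ℝ] ℝ :=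
  (metricAt g (coordSymm e y)).bilinearComp (coordSymmDeriv e y) (coordSymmDeriv e y)

theorem metricCoord_apply (g : Met m M) (e : OpenPartialHomeomorph M (EuclideanHalfSpace m))
    (y v w : Euc m) : metricCoord g e y v w =
      metricAt g (coordSymm e y) (coordSymmDeriv e y v) (coordSymmDeriv e y w) := rfl

variable {e : OpenPartialHomeomorph M (EuclideanHalfSpace m)}

theorem metricCoord_coordDeriv (he : e ∈ IsManifold.maximalAtlas (𝓡∂ m) ∞ M) (g : Met m M)
    {p : M} (hp : p ∈ e.source) (v w : Euc m) :
    metricCoord g e (coord e p) (coordDeriv e p v) (coordDeriv e p w) = metricAt g p v w := by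
  rw [metricCoord_apply, coordSymmDeriv_coordDeriv he hp, coordSymmDeriv_coordDeriv he hp,
    coordSymm_coord hp]

theorem metricCoord_pos (he : e ∈ IsManifold.maximalAtlas (𝓡∂ m) ∞ M) (g : Met m M)
    {y : Euc m} (hy : y ∈ coordTarget e) {v : Euc m} (hv : v ≠ 0) : 0 < metricCoord g e y v v := by
  rw [metricCoord_apply]
  refine metricAt_pos g _ fun h => hv ?_
  rw [← coordDeriv_coordSymmDeriv he hy v, h, map_zero]

/-- In finite dimension it suffices to test on constant vectors, whose images under the
parametrization are smooth sections of the tangent bundle. -/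
theorem contDiffOn_metricCoord (he : e ∈ IsManifold.maximalAtlas (𝓡∂ m) ∞ M) (g : Met m M) :
    ContDiffOn ℝ ∞ (metricCoord g e) (coordTarget e) := by
  have hsec : ∀ v : Euc m, ContMDiffOn 𝓘(ℝ, Euc m) (𝓡∂ m).tangent ∞
      (fun y => (⟨coordSymm e y, coordSymmDeriv e y v⟩ : TangentBundle (𝓡∂ m) M))
      (coordTarget e) := fun v => by
    have h1 := (contMDiffOn_coordSymm he).contMDiffOn_tangentMapWithin (m := ∞) (by simp)
      (uniqueMDiffOn_iff_uniqueDiffOn.2 uniqueDiffOn_coordTarget)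
    have h2 : ContMDiffOn 𝓘(ℝ, Euc m) 𝓘(ℝ, Euc m).tangent ∞
        (fun y => (⟨y, v⟩ : TangentBundle 𝓘(ℝ, Euc m) (Euc m))) (coordTarget e) :=
      contMDiffOn_vectorSpace_iff_contDiffOn.2 contDiffOn_const
    exact h1.comp h2 fun y hy => hy
  rw [contDiffOn_clm_apply]
  intro v
  rw [contDiffOn_clm_apply]
  intro w
  have : ContMDiffOn 𝓘(ℝ, Euc m) 𝓘(ℝ, ℝ) ∞ (fun y => metricCoord g e y v w) (coordTarget e) :=
    fun y hy => contMDiffWithinAt_inner g (hsec v y hy) (hsec w y hy)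
  exact this.contDiffOn

/-- The gradient of a function on a Riemannian manifold. -/
def grad (g : Met m M) (f : M → ℝ) (p : M) : Euc m :=
  (metricAt g p).inverse (diffAt f p)

theorem metricAt_grad (g : Met m M) (f : M → ℝ) (p : M) (v : Euc m) :
    metricAt g p (grad g f p) v = diffAt f p v := by
  rw [grad, apply_inverse_of_pos fun _ => metricAt_pos g p]

/-- The gradient of `f` rescaled so that `f` grows at unit speed along it. -/
def unitRateField (g : Met m M) (f : M → ℝ) (p : M) : Euc m :=
  (diffAt f p (grad g f p))⁻¹ • grad g f p

theorem diffAt_grad_pos (g : Met m M) {f : M → ℝ} {p : M} (h : diffAt (m := m) f p ≠ 0) :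
    0 < diffAt f p (grad g f p) :=
  apply_inverse_self_pos (fun _ => metricAt_pos g p) h

theorem diffAt_unitRateField (g : Met m M) {f : M → ℝ} {p : M} (h : diffAt (m := m) f p ≠ 0) :
    diffAt f p (unitRateField g f p) = 1 := by
  rw [unitRateField, map_smul, smul_eq_mul, inv_mul_cancel₀ (diffAt_grad_pos g h).ne']

/-- The source of the block form: vectors killed by the differential of `f` are orthogonal to the
flow direction. -/
theorem metricAt_unitRateField (g : Met m M) (f : M → ℝ) (p : M) (v : Euc m) :
    metricAt g p (unitRateField g f p) v = (diffAt f p (grad g f p))⁻¹ * diffAt f p v := by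
  rw [unitRateField, map_smul, smul_apply, metricAt_grad, smul_eq_mul]

/-- The gradient is natural under isometries; in coordinates it is the inverse metric applied to the
differential, a formula from which smoothness can be read off. -/
theorem coordDeriv_grad (he : e ∈ IsManifold.maximalAtlas (𝓡∂ m) ∞ M) (g : Met m M) (f : M → ℝ)
    {y : Euc m} (hy : y ∈ coordTarget e) :
    coordDeriv e (coordSymm e y) (grad g f (coordSymm e y)) =
      (metricCoord g e y).inverse ((diffAt f (coordSymm e y)).comp (coordSymmDeriv e y)) := by
  refine (inverse_eq_of_apply_eq (fun _ => metricCoord_pos he g hy) ?_).symm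
  ext v
  have := coordSymmDeriv_coordDeriv he (coordSymm_mem hy) (grad g f (coordSymm e y))
  rw [coord_coordSymm hy] at this
  rw [metricCoord_apply, this, metricAt_grad]
  rfl

/-- The differential of a smooth function is smooth in a chart. -/
theorem contDiffOn_diffAt_coordSymm (he : e ∈ IsManifold.maximalAtlas (𝓡∂ m) ∞ M) {f : M → ℝ}
    (hf : ContMDiffOn (𝓡∂ m) 𝓘(ℝ, ℝ) ∞ f e.source) :
    ContDiffOn ℝ ∞ (fun y => (diffAt f (coordSymm e y)).comp (coordSymmDeriv e y))
      (coordTarget e) := by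
  refine ((contDiffOn_comp_coordSymm he hf).fderivWithin uniqueDiffOn_coordTarget
    (m := ∞) (by simp)).congr fun y hy => ?_
  exact ((hasFDerivWithinAt_comp_coordSymm he hy
    ((hf.contMDiffAt (e.open_source.mem_nhds (coordSymm_mem hy))).mdifferentiableAt
      (by simp))).fderivWithin (uniqueDiffOn_coordTarget y hy)).symm

theorem contDiffOn_coordField_unitRateField (he : e ∈ IsManifold.maximalAtlas (𝓡∂ m) ∞ M)
    (g : Met m M) {f : M → ℝ} (hf : ContMDiffOn (𝓡∂ m) 𝓘(ℝ, ℝ) ∞ f e.source)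
    (hf0 : ∀ p ∈ e.source, diffAt (m := m) f p ≠ 0) :
    ContDiffOn ℝ ∞ (coordField (unitRateField g f) e) (coordTarget e) := by
  have hα := contDiffOn_diffAt_coordSymm he hf
  have hv := contDiffOn_inverse_apply (contDiffOn_metricCoord he g)
    (fun y hy v => metricCoord_pos he g hy) hα
  have key : ∀ y ∈ coordTarget e, ((diffAt f (coordSymm e y)).comp (coordSymmDeriv e y))
      ((metricCoord g e y).inverse ((diffAt f (coordSymm e y)).comp (coordSymmDeriv e y))) =
      diffAt f (coordSymm e y) (grad g f (coordSymm e y)) := fun y hy => by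
    rw [← coordDeriv_grad he g f hy, ContinuousLinearMap.comp_apply]
    have := coordSymmDeriv_coordDeriv he (coordSymm_mem hy) (grad g f (coordSymm e y))
    rw [coord_coordSymm hy] at this
    rw [this]
  refine (((hα.clm_apply hv).inv fun y hy => ?_).smul hv).congr fun y hy => ?_
  · rw [key y hy]
    exact (diffAt_grad_pos g (hf0 _ (coordSymm_mem hy))).ne'
  · rw [coordField, unitRateField, map_smul, coordDeriv_grad he g f hy, ← key y hy]
    rfl

end Metric

/-! ### Flow lines on the manifold and the flow near a compact set -/

section ManifoldFlow

variable {m : ℕ} [NeZero m] {M : Type*} [TopologicalSpace M]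
  [ChartedSpace (EuclideanHalfSpace m) M] [IsManifold (𝓡∂ m) ∞ M]
  {e : OpenPartialHomeomorph M (EuclideanHalfSpace m)}

/-- A chart in which a vector field is smooth and tangent to the boundary. -/
structure IsFlowChart (V : M → Euc m) (e : OpenPartialHomeomorph M (EuclideanHalfSpace m)) :
    Prop where
  mem_maximalAtlas : e ∈ IsManifold.maximalAtlas (𝓡∂ m) ∞ M
  contDiffOn : ContDiffOn ℝ ∞ (coordField V e) (coordTarget e)
  tangent : ∀ y ∈ coordTarget e, y 0 = 0 → coordField V e y 0 = 0

theorem IsFlowChart.exists_localFlow {V : M → Euc m} (h : IsFlowChart V e) {p₀ : M}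
    (hp₀ : p₀ ∈ e.source) :
    ∃ ε > 0, ∃ O : Set M, IsOpen O ∧ p₀ ∈ O ∧ ∃ θ : M → ℝ → M,
      (∀ p ∈ O, θ p 0 = p ∧ ∀ t ∈ Ioo (-ε) ε, θ p t ∈ e.source ∧ IsFlowLineAt V (θ p) t) ∧
      ContMDiffOn ((𝓡∂ m).prod 𝓘(ℝ, ℝ)) (𝓡∂ m) ∞ (fun z : M × ℝ => θ z.1 z.2)
        (O ×ˢ Ioo (-ε) ε) := by
  obtain ⟨he, hV, htan⟩ := h
  have hy₀ := coord_mem hp₀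
  rw [coordTarget_eq] at hV htan hy₀
  obtain ⟨ε, hε, r, hr, θ, hθ, hθs⟩ :=
    exists_localFlow_halfSpace (isOpen_preimage_target e) hV htan hy₀
  rw [← coordTarget_eq] at *
  refine ⟨ε, hε, e.source ∩ coord e ⁻¹' ball (coord e p₀) r, ?_, ⟨hp₀, mem_ball_self hr⟩,
    fun p t => coordSymm e (θ (coord e p) t), fun p hp => ?_, ?_⟩
  · have := (contMDiffOn_coord he).continuousOn.isOpen_inter_preimage e.open_source
      (isOpen_ball (x := coord e p₀) (ε := r))
    exact this
  · have hp' : coord e p ∈ halfSpace m ∩ ball (coord e p₀) r :=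
      ⟨coordTarget_subset (coord_mem hp.1), hp.2⟩
    obtain ⟨h0, ht⟩ := hθ _ hp'
    refine ⟨by show coordSymm e (θ (coord e p) 0) = p; rw [h0, coordSymm_coord hp.1], fun t htm => ⟨coordSymm_mem (ht t htm).1, ?_⟩⟩
    refine isFlowLineAt_coordSymm_comp he (y := θ (coord e p)) ?_ (ht t htm).2
    filter_upwards [Ioo_mem_nhds htm.1 htm.2] with s hs using (ht s hs).1
  · have h1 : ContMDiffOn ((𝓡∂ m).prod 𝓘(ℝ, ℝ)) 𝓘(ℝ, Euc m × ℝ) ∞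
        (fun z : M × ℝ => (coord e z.1, z.2))
        ((e.source ∩ coord e ⁻¹' ball (coord e p₀) r) ×ˢ Ioo (-ε) ε) :=
      ((contMDiffOn_coord he).comp contMDiffOn_fst fun z hz => hz.1.1).prodMk_space contMDiffOn_snd
    have h2 := hθs.contMDiffOn.comp h1 fun z hz =>
      ⟨⟨coordTarget_subset (coord_mem hz.1.1), hz.1.2⟩, hz.2⟩
    exact (contMDiffOn_coordSymm he).comp h2 fun z hz =>
      ((hθ _ ⟨coordTarget_subset (coord_mem hz.1.1), hz.1.2⟩).2 _ hz.2).1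

/-- Read in the chart, this is ODE uniqueness. Both curves lie in the half-space, a convex set on
which the field is locally Lipschitz even at boundary points. -/
theorem IsFlowChart.eventuallyEq {V : M → Euc m} (h : IsFlowChart V e) {γ γ' : ℝ → M} {t₀ : ℝ}
    (hγ : ∀ᶠ t in 𝓝 t₀, IsFlowLineAt V γ t) (hγ' : ∀ᶠ t in 𝓝 t₀, IsFlowLineAt V γ' t)
    (heq : γ t₀ = γ' t₀) (hmem : γ t₀ ∈ e.source) : γ =ᶠ[𝓝 t₀] γ' := by
  obtain ⟨he, hV, -⟩ := h
  obtain ⟨K, s, hs, hK⟩ := (((hV _ (coord_mem hmem)).mono_of_mem_nhdsWithin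
    (coordTarget_mem_nhdsWithin (coord_mem hmem))).of_le (by simp)).exists_lipschitzOnWith
    convex_halfSpace
  have key : ∀ {β : ℝ → M}, (∀ᶠ t in 𝓝 t₀, IsFlowLineAt V β t) → γ t₀ = β t₀ →
      ∀ᶠ t in 𝓝 t₀, β t ∈ e.source ∧
        (HasDerivAt (coord e ∘ β) (coordField V e ((coord e ∘ β) t)) t ∧
          (coord e ∘ β) t ∈ s) := by
    intro β hβ hβ0
    have hc : ContinuousAt β t₀ := hβ.self_of_nhds.continuousAt
    have h1 : ∀ᶠ t in 𝓝 t₀, β t ∈ e.source :=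
      hc.eventually (e.open_source.mem_nhds (hβ0 ▸ hmem))
    have h2 : Tendsto (coord e ∘ β) (𝓝 t₀) (𝓝[halfSpace m] (coord e (γ t₀))) := by
      refine tendsto_nhdsWithin_iff.2 ⟨?_, ?_⟩
      · have := (continuousAt_coord (e := e) (p := β t₀) (hβ0 ▸ hmem)).comp hc
        rw [hβ0]
        exact this
      · filter_upwards [h1] with t ht using coordTarget_subset (coord_mem ht)
    filter_upwards [h1, hβ, h2.eventually hs] with t ht1 ht2 ht3
    exact ⟨ht1, ht2.hasDerivAt_coord he ht1, ht3⟩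
  have h1 := key hγ rfl
  have h2 := key hγ' heq
  have := ODE_solution_unique_of_eventually (v := fun _ => coordField V e) (s := fun _ => s)
    (K := K) (Eventually.of_forall fun _ => hK) (h1.mono fun _ h => h.2) (h2.mono fun _ h => h.2)
    (by simp [heq])
  filter_upwards [this, h1, h2] with t ht ht1 ht2
  rw [← coordSymm_coord ht1.1, ← coordSymm_coord ht2.1]
  exact congrArg _ ht

/-- Flow lines through the same point agree. -/
theorem eqOn_Ioo_of_isFlowLineAt [T2Space M] {V : M → Euc m} {γ γ' : ℝ → M} {a b t₀ : ℝ}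
    (ht₀ : t₀ ∈ Ioo a b)
    (hγ : ∀ t ∈ Ioo a b, IsFlowLineAt V γ t ∧ ∃ e, IsFlowChart V e ∧ γ t ∈ e.source)
    (hγ' : ∀ t ∈ Ioo a b, IsFlowLineAt V γ' t) (heq : γ t₀ = γ' t₀) : EqOn γ γ' (Ioo a b) := by
  -- The set of agreement is open by local uniqueness and closed because `M` is Hausdorff, so
  -- connectedness of the interval applies.
  have hsub : Ioo a b ⊆ {t | γ t = γ' t} ∩ Ioo a b := by
    refine isPreconnected_Ioo.subset_of_closure_inter_subset ?_ ⟨t₀, ht₀, heq, ht₀⟩ ?_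
    · rw [isOpen_iff_mem_nhds]
      rintro t₁ ⟨h1, ht₁⟩
      have hmem := Ioo_mem_nhds ht₁.1 ht₁.2
      obtain ⟨e, he, hemem⟩ := (hγ t₁ ht₁).2
      have := he.eventuallyEq (eventually_of_mem hmem fun t ht => (hγ t ht).1)
        (eventually_of_mem hmem hγ') h1 hemem
      exact inter_mem this hmem
    · rintro t ⟨ht1, ht⟩
      refine ⟨?_, ht⟩
      have hne : (𝓝[{t | γ t = γ' t} ∩ Ioo a b] t).NeBot := mem_closure_iff_nhdsWithin_neBot.1 ht1
      have h1 : Tendsto γ (𝓝[{t | γ t = γ' t} ∩ Ioo a b] t) (𝓝 (γ t)) :=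
        (hγ t ht).1.continuousAt.tendsto.mono_left nhdsWithin_le_nhds
      have h2 : Tendsto γ' (𝓝[{t | γ t = γ' t} ∩ Ioo a b] t) (𝓝 (γ' t)) :=
        (hγ' t ht).continuousAt.tendsto.mono_left nhdsWithin_le_nhds
      refine tendsto_nhds_unique h1 (h2.congr' ?_)
      filter_upwards [self_mem_nhdsWithin] with s hs using hs.1.symm
  exact fun t ht => (hsub ht).1

/-- The flow of a vector field near a compact set. -/
theorem exists_flow_near_compact [T2Space M] {V : M → Euc m} {C W : Set M} (hC : IsCompact C)
    (hV : ∀ p ∈ C, ∃ e, IsFlowChart V e ∧ p ∈ e.source ∧ e.source ⊆ W) :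
    ∃ ε > 0, ∃ O : Set M, IsOpen O ∧ C ⊆ O ∧ ∃ θ : M → ℝ → M,
      (∀ p ∈ O, θ p 0 = p ∧ ∀ t ∈ Ioo (-ε) ε, IsFlowLineAt V (θ p) t ∧
        θ p t ∈ W ∧ ∃ e, IsFlowChart V e ∧ θ p t ∈ e.source) ∧
      ContMDiffOn ((𝓡∂ m).prod 𝓘(ℝ, ℝ)) (𝓡∂ m) ∞ (fun z : M × ℝ => θ z.1 z.2)
        (O ×ˢ Ioo (-ε) ε) := by
  have hloc : ∀ p ∈ C, ∃ ε > 0, ∃ O : Set M, IsOpen O ∧ p ∈ O ∧ ∃ θ : M → ℝ → M,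
      (∀ q ∈ O, θ q 0 = q ∧ ∀ t ∈ Ioo (-ε) ε, IsFlowLineAt V (θ q) t ∧
        θ q t ∈ W ∧ ∃ e, IsFlowChart V e ∧ θ q t ∈ e.source) ∧
      ContMDiffOn ((𝓡∂ m).prod 𝓘(ℝ, ℝ)) (𝓡∂ m) ∞ (fun z : M × ℝ => θ z.1 z.2)
        (O ×ˢ Ioo (-ε) ε) := by
    intro p hp
    obtain ⟨e, he, hpe, heW⟩ := hV p hp
    obtain ⟨ε, hε, O, hO, hpO, θ, hθ, hs⟩ := he.exists_localFlow hpe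
    exact ⟨ε, hε, O, hO, hpO, θ, fun q hq => ⟨(hθ q hq).1, fun t ht =>
      ⟨((hθ q hq).2 t ht).2, heW ((hθ q hq).2 t ht).1, e, he, ((hθ q hq).2 t ht).1⟩⟩, hs⟩
  classical
  choose! ε hε O hO hpO θ hθ hs using hloc
  obtain ⟨T, hTC, hT⟩ := hC.elim_nhds_subcover O fun p hp => (hO p hp).mem_nhds (hpO p hp)
  obtain ⟨δ, hδ, hδT⟩ : ∃ δ > 0, ∀ p ∈ T, δ ≤ ε p := by
    clear hT
    induction T using Finset.induction_on with
    | empty => exact ⟨1, one_pos, by simp⟩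
    | insert a T ha ih =>
      obtain ⟨δ, hδ, h⟩ := ih fun p hp => hTC p (Finset.mem_insert_of_mem hp)
      refine ⟨min δ (ε a), lt_min hδ (hε a (hTC a (Finset.mem_insert_self _ _))), ?_⟩
      intro p hp
      rcases Finset.mem_insert.1 hp with rfl | hp
      · exact min_le_right _ _
      · exact (min_le_left _ _).trans (h p hp)
  have hIoo : ∀ p ∈ T, Ioo (-δ) δ ⊆ Ioo (-(ε p)) (ε p) := fun p hp =>
    Ioo_subset_Ioo (neg_le_neg (hδT p hp)) (hδT p hp)
  have hex : ∀ q ∈ ⋃ p ∈ T, O p, ∃ p ∈ T, q ∈ O p := fun q hq => by simpa using hq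
  have hex' := hex
  choose! i hiT hiO using hex'
  refine ⟨δ, hδ, ⋃ p ∈ T, O p, isOpen_biUnion fun p hp => hO p (hTC p hp), hT,
    fun q => θ (i q) q, fun q hq => ?_, ?_⟩
  · have := hθ _ (hTC _ (hiT q hq)) q (hiO q hq)
    exact ⟨this.1, fun t ht => this.2 t (hIoo _ (hiT q hq) ht)⟩
  · rintro ⟨q, t⟩ ⟨hq, ht⟩
    obtain ⟨p, hpT, hqp⟩ := hex q hq
    have h1 := (hs p (hTC p hpT)).contMDiffAt (x := (q, t))
      (prod_mem_nhds ((hO p (hTC p hpT)).mem_nhds hqp)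
        (Ioo_mem_nhds (hIoo p hpT ht).1 (hIoo p hpT ht).2))
    -- The chosen index `i` may jump with the starting point, but by uniqueness every choice gives
    -- the same curve as the fixed local flow `θ p`.
    refine (h1.congr_of_eventuallyEq ?_).contMDiffWithinAt
    filter_upwards [prod_mem_nhds ((hO p (hTC p hpT)).mem_nhds hqp)
      (Ioo_mem_nhds ht.1 ht.2)] with z hz
    have hzU : z.1 ∈ ⋃ p ∈ T, O p := mem_biUnion hpT hz.1
    have ha := hθ _ (hTC _ (hiT z.1 hzU)) z.1 (hiO z.1 hzU)
    have hb := hθ p (hTC p hpT) z.1 hz.1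
    exact eqOn_Ioo_of_isFlowLineAt (t₀ := 0) (by simp [hδ])
      (fun s hs => ⟨(ha.2 s (hIoo _ (hiT _ hzU) hs)).1,
        (ha.2 s (hIoo _ (hiT _ hzU) hs)).2.2⟩) (fun s hs => (hb.2 s (hIoo p hpT hs)).1)
      (by rw [ha.1, hb.1]) hz.2

end ManifoldFlow

/-! ### Chart independence of the boundary and of its tangent space -/

section Boundary

/-- The first coordinate. -/
abbrev coordZero (m : ℕ) [NeZero m] : Euc m →L[ℝ] ℝ := EuclideanSpace.proj 0

variable {m : ℕ} [NeZero m] {M : Type*} [TopologicalSpace M]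
  [ChartedSpace (EuclideanHalfSpace m) M] [IsManifold (𝓡∂ m) ∞ M]
  {e e' : OpenPartialHomeomorph M (EuclideanHalfSpace m)}

/-- The differential of a nonnegative function at a zero vanishes on tangential directions. -/
theorem diffAt_eq_zero_of_nonneg (he : e ∈ IsManifold.maximalAtlas (𝓡∂ m) ∞ M) {p : M}
    (hp : p ∈ e.source) {f : M → ℝ} (hf : MDifferentiableAt (𝓡∂ m) 𝓘(ℝ, ℝ) f p)
    (hnn : ∀ᶠ q in 𝓝 p, 0 ≤ f q) (h0 : f p = 0) {v : Euc m}
    (hv : coord e p 0 = 0 → coordDeriv e p v 0 = 0) : diffAt f p v = 0 := by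
  set y := coord e p with hy
  set w := coordDeriv e p v with hw
  have hyT : y ∈ coordTarget e := coord_mem hp
  have hl : HasDerivAt (fun t : ℝ => y + t • w) w 0 := by
    simpa using ((hasDerivAt_id (0 : ℝ)).smul_const w).const_add y
  -- The line through `y` in direction `w` stays in the half-space for small times of both signs, so
  -- `f` along it has an interior minimum.
  have hhalf : ∀ᶠ t : ℝ in 𝓝 0, y + t • w ∈ halfSpace m := by
    rcases (mem_halfSpace.1 (coordTarget_subset hyT)).eq_or_lt with h | h
    · refine Eventually.of_forall fun t => ?_
      rw [mem_halfSpace]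
      simp [← h, hv h.symm]
    · have := hl.continuousAt.eventually (p := fun z => z ∈ halfSpace m)
        (by simpa using halfSpace_mem_nhds h)
      exact this
  have hlt : Tendsto (fun t : ℝ => y + t • w) (𝓝 0) (𝓝[halfSpace m] y) := by
    refine tendsto_nhdsWithin_iff.2 ⟨?_, hhalf⟩
    simpa using hl.continuousAt.tendsto
  have hT : ∀ᶠ t : ℝ in 𝓝 0, y + t • w ∈ coordTarget e :=
    hlt.eventually (coordTarget_mem_nhdsWithin hyT)
  have hps : coordSymm e y = p := coordSymm_coord hp
  have hF := hasFDerivWithinAt_comp_coordSymm he hyT (by rwa [hps])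
  rw [hps] at hF
  have hD : HasDerivAt ((f ∘ coordSymm e) ∘ fun t : ℝ => y + t • w)
      ((diffAt f p).comp (coordSymmDeriv e y) w) 0 := by
    refine (HasFDerivWithinAt.comp_hasDerivWithinAt (t := coordTarget e) (0 : ℝ) ?_
      (hl.hasDerivWithinAt (s := {t | y + t • w ∈ coordTarget e})) fun t ht => ht).hasDerivAt hT
    simpa using hF
  have hmin : IsLocalMin ((f ∘ coordSymm e) ∘ fun t : ℝ => y + t • w) 0 := by
    have h1 : ∀ᶠ z in 𝓝[halfSpace m] y, 0 ≤ f (coordSymm e z) :=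
      eventually_coordSymm hyT (by rwa [hps])
    filter_upwards [hlt.eventually h1] with t ht
    simpa [hps, h0] using ht
  have := hmin.hasDerivAt_eq_zero hD
  rwa [ContinuousLinearMap.comp_apply, hw, hy, coordSymmDeriv_coordDeriv he hp] at this

theorem contMDiffOn_coord_zero (he : e ∈ IsManifold.maximalAtlas (𝓡∂ m) ∞ M) :
    ContMDiffOn (𝓡∂ m) 𝓘(ℝ, ℝ) ∞ (fun q => coord e q 0) e.source :=
  (coordZero m).contMDiff.comp_contMDiffOn
    (contMDiffOn_coord he)

theorem diffAt_coord_zero (he : e ∈ IsManifold.maximalAtlas (𝓡∂ m) ∞ M) {p : M}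
    (hp : p ∈ e.source) (v : Euc m) :
    diffAt (fun q => coord e q 0) p v = coordDeriv e p v 0 := by
  have := diffAt_comp_coord he hp (F := coordZero m) (f := fun q => coord e q 0) EventuallyEq.rfl
    (coordZero m).hasFDerivWithinAt
  rw [this]
  rfl

theorem exists_coordDeriv_eq (he : e ∈ IsManifold.maximalAtlas (𝓡∂ m) ∞ M) {p : M}
    (hp : p ∈ e.source) (w : Euc m) : ∃ v, coordDeriv e p v = w := by
  have := coordDeriv_coordSymmDeriv he (coord_mem hp) w
  rw [coordSymm_coord hp] at this
  exact ⟨_, this⟩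

/-- The first coordinate of `e` is a nonnegative function vanishing at `p`, so its differential
kills the directions tangential in `e'`. -/
theorem coordDeriv_zero_eq_zero (he : e ∈ IsManifold.maximalAtlas (𝓡∂ m) ∞ M)
    (he' : e' ∈ IsManifold.maximalAtlas (𝓡∂ m) ∞ M) {p : M} (hp : p ∈ e.source)
    (hp' : p ∈ e'.source) (h0 : coord e p 0 = 0) {v : Euc m}
    (hv : coord e' p 0 = 0 → coordDeriv e' p v 0 = 0) : coordDeriv e p v 0 = 0 := by
  rw [← diffAt_coord_zero he hp]
  refine diffAt_eq_zero_of_nonneg he' hp'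
    (((contMDiffOn_coord_zero he).contMDiffAt (e.open_source.mem_nhds hp)).mdifferentiableAt
      (by simp)) ?_ h0 hv
  filter_upwards [e.open_source.mem_nhds hp] with q hq
  exact coordTarget_subset (coord_mem hq)

/-- If `e'` saw `p` as an interior point, every direction would be admissible, and the first
coordinate of `e` would have zero differential, which is absurd. -/
theorem coord_zero_eq_zero (he : e ∈ IsManifold.maximalAtlas (𝓡∂ m) ∞ M)
    (he' : e' ∈ IsManifold.maximalAtlas (𝓡∂ m) ∞ M) {p : M} (hp : p ∈ e.source)
    (hp' : p ∈ e'.source) (h0 : coord e p 0 = 0) : coord e' p 0 = 0 := by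
  by_contra h
  obtain ⟨v, hv⟩ := exists_coordDeriv_eq he hp (EuclideanSpace.single 0 1)
  have := coordDeriv_zero_eq_zero he he' hp hp' h0 (v := v) fun h' => absurd h' h
  rw [hv] at this
  simp at this

/-- Boundary points are recognized in any chart. -/
theorem mem_boundary_iff (he : e ∈ IsManifold.maximalAtlas (𝓡∂ m) ∞ M) {p : M}
    (hp : p ∈ e.source) : p ∈ (𝓡∂ m).boundary M ↔ coord e p 0 = 0 := by
  have hc : chartAt (EuclideanHalfSpace m) p ∈ IsManifold.maximalAtlas (𝓡∂ m) ∞ M :=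
    IsManifold.chart_mem_maximalAtlas p
  have hpc := mem_chart_source (EuclideanHalfSpace m) p
  have h1 : p ∈ (𝓡∂ m).boundary M ↔ coord (chartAt (EuclideanHalfSpace m) p) p 0 = 0 := by
    change extChartAt (𝓡∂ m) p p ∈ frontier (range (𝓡∂ m)) ↔ _
    rw [frontier_range_modelWithCornersEuclideanHalfSpace]
    exact eq_comm
  rw [h1]
  exact ⟨coord_zero_eq_zero hc he hpc hp, coord_zero_eq_zero he hc hp hpc⟩

/-- Vectors tangent to the boundary are recognized in any chart. -/
theorem mem_boundaryTangentSpace_iff (he : e ∈ IsManifold.maximalAtlas (𝓡∂ m) ∞ M) {p : M}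
    (hp : p ∈ e.source) (h0 : coord e p 0 = 0) {v : Euc m} :
    (show TangentSpace (𝓡∂ m) p from v) ∈ boundaryTangentSpace p ↔ coordDeriv e p v 0 = 0 := by
  have hc : chartAt (EuclideanHalfSpace m) p ∈ IsManifold.maximalAtlas (𝓡∂ m) ∞ M :=
    IsManifold.chart_mem_maximalAtlas p
  have hpc := mem_chart_source (EuclideanHalfSpace m) p
  have hc0 := coord_zero_eq_zero he hc hp hpc h0
  change coordDeriv (chartAt (EuclideanHalfSpace m) p) p v 0 = 0 ↔ _
  exact ⟨fun h => coordDeriv_zero_eq_zero he hc hp hpc h0 fun _ => h,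
    fun h => coordDeriv_zero_eq_zero hc he hpc hp hc0 fun _ => h⟩

end Boundary

/-! ### Slice charts of a properly embedded hypersurface -/

section Slice

variable {n : ℕ} [NeZero n]
  {X : Type*} [TopologicalSpace X] [ChartedSpace (EuclideanHalfSpace n) X]
  [IsManifold (𝓡∂ n) ∞ X]
  {M : Type*} [TopologicalSpace M] [ChartedSpace (EuclideanHalfSpace (n + 1)) M]
  [IsManifold (𝓡∂ (n + 1)) ∞ M]

/-- A chart in which a hypersurface becomes the kernel of a linear form. -/
structure IsSliceChart (ι : X → M) (e : OpenPartialHomeomorph M (EuclideanHalfSpace (n + 1)))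
    (d : OpenPartialHomeomorph X (EuclideanHalfSpace n)) (L : Euc n →L[ℝ] Euc (n + 1))
    (ℓ : Euc (n + 1) →L[ℝ] ℝ) : Prop where
  mem_maximalAtlas : e ∈ IsManifold.maximalAtlas (𝓡∂ (n + 1)) ∞ M
  mem_maximalAtlas' : d ∈ IsManifold.maximalAtlas (𝓡∂ n) ∞ X
  injective : Injective L
  ker_eq : ∀ v, ℓ v = 0 ↔ v ∈ range L
  mem_iff : ∀ x, ι x ∈ e.source ↔ x ∈ d.source
  coord_eq : ∀ x ∈ d.source, coord e (ι x) = L (coord d x)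
  mem_range : ∀ p ∈ e.source, ℓ (coord e p) = 0 → p ∈ range ι

theorem exists_linearForm_of_injective {L : Euc n →L[ℝ] Euc (n + 1)} (hL : Injective L) :
    ∃ ℓ : Euc (n + 1) →L[ℝ] ℝ, ∀ v, ℓ v = 0 ↔ v ∈ range L := by
  have hdim : Module.finrank ℝ (LinearMap.range L.toLinearMap) = n := by
    rw [LinearMap.finrank_range_of_inj hL, finrank_euclideanSpace, Fintype.card_fin]
  have hlt : LinearMap.range L.toLinearMap < ⊤ := by
    rw [lt_top_iff_ne_top]
    intro h
    rw [h, finrank_top, finrank_euclideanSpace, Fintype.card_fin] at hdim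
    omega
  obtain ⟨f, hf, hle⟩ := Submodule.exists_le_ker_of_lt_top _ hlt
  have heq : LinearMap.range L.toLinearMap = LinearMap.ker f := by
    refine Submodule.eq_of_le_of_finrank_eq hle ?_
    have := Module.Dual.finrank_ker_add_one_of_ne_zero hf
    rw [finrank_euclideanSpace, Fintype.card_fin] at this
    omega
  refine ⟨LinearMap.toContinuousLinearMap f, fun v => ?_⟩
  have := SetLike.ext_iff.1 heq v
  exact this.symm

/-- A linear map which maps the half-space near a boundary point to the half-space, mapping
boundary points to boundary points, rescales the first coordinate. -/
theorem apply_zero_eq_of_mapsTo_halfSpace {L : Euc n →L[ℝ] Euc (n + 1)} {v : Euc n}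
    (hv : v 0 = 0) (hLv : L v 0 = 0)
    (h : ∀ᶠ z in 𝓝[halfSpace n] v, (L z : Euc (n + 1)) ∈ halfSpace (n + 1)) (w : Euc n) :
    L w 0 = w 0 * L (EuclideanSpace.single 0 1) 0 := by
  have key : ∀ w : Euc n, 0 ≤ w 0 → 0 ≤ L w 0 := fun w hw => by
    have hl : Tendsto (fun t : ℝ => v + t • w) (𝓝[>] 0) (𝓝[halfSpace n] v) := by
      refine tendsto_nhdsWithin_iff.2 ⟨?_, ?_⟩
      · have : Continuous fun t : ℝ => v + t • w := by fun_prop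
        simpa using (this.tendsto 0).mono_left nhdsWithin_le_nhds
      · filter_upwards [self_mem_nhdsWithin] with t ht
        rw [mem_halfSpace]
        have : 0 ≤ t * w 0 := mul_nonneg (le_of_lt ht) hw
        simpa [hv] using this
    obtain ⟨t, ht1, ht⟩ := ((hl.eventually h).and self_mem_nhdsWithin).exists
    rw [mem_halfSpace] at ht1
    have ht2 : 0 ≤ t * L w 0 := by simpa [hLv] using ht1
    exact nonneg_of_mul_nonneg_right ht2 ht
  have h0 : ∀ w : Euc n, w 0 = 0 → L w 0 = 0 := fun w hw => by
    have h1 := key w hw.ge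
    have h2 := key (-w) (by simp [hw])
    have h3 : L (-w) 0 = - L w 0 := by simp
    linarith
  have := h0 (w - w 0 • EuclideanSpace.single 0 1) (by simp)
  simp only [map_sub, map_smul, PiLp.sub_apply, PiLp.smul_apply, smul_eq_mul] at this
  linarith

/-- A properly embedded hypersurface has slice charts; at boundary points, it is transverse to the
boundary. -/
theorem IsProperlyEmbedded.exists_isSliceChart {ι : X → M}
    (hι : IsProperlyEmbedded (n := n) ι) (x₀ : X) {W : Set M} (hW : IsOpen W) (hx₀ : ι x₀ ∈ W) :
    ∃ e d L ℓ, IsSliceChart ι e d L ℓ ∧ e.source ⊆ W ∧ ι x₀ ∈ e.source ∧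
      (x₀ ∈ (𝓡∂ n).boundary X → ∃ ζ : Euc (n + 1), ζ 0 = 1 ∧ ℓ ζ = 0) := by
  have him := hι.isSmoothEmbedding.1.isImmersionAt x₀
  have hemb := hι.isSmoothEmbedding.2
  set e := him.codChart
  set d := him.domChart
  have he : e ∈ IsManifold.maximalAtlas (𝓡∂ (n + 1)) ∞ M := him.codChart_mem_maximalAtlas
  have hd : d ∈ IsManifold.maximalAtlas (𝓡∂ n) ∞ X := him.domChart_mem_maximalAtlas
  have hxe : ι x₀ ∈ e.source := him.mem_codChart_source
  have hxd : x₀ ∈ d.source := him.mem_domChart_source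
  have hsrc : ∀ x ∈ d.source, ι x ∈ e.source := him.source_subset_preimage_source
  set L : Euc n →L[ℝ] Euc (n + 1) :=
    (him.equiv : (Euc n × him.complement) →L[ℝ] Euc (n + 1)).comp (ContinuousLinearMap.inl ℝ _ _) with hLdef
  set R : Euc (n + 1) →L[ℝ] Euc n :=
    (ContinuousLinearMap.fst ℝ _ _).comp (him.equiv.symm : Euc (n + 1) →L[ℝ] (Euc n × him.complement)) with hRdef
  have hRL : ∀ v, R (L v) = v := fun v => by simp [hLdef, hRdef]
  have hL : Injective L := LeftInverse.injective hRL
  have hcoord : ∀ x ∈ d.source, coord e (ι x) = L (coord d x) := fun x hx => by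
    have := him.writtenInCharts (coord_mem hx)
    simp only [comp_apply] at this
    rw [show (him.domChart.extend (𝓡∂ n)).symm (coord d x) = x from coordSymm_coord hx] at this
    exact this
  obtain ⟨ℓ, hℓ⟩ := exists_linearForm_of_injective hL
  -- Transversality to the boundary. `L` respects half-spaces, which gives a factor c ≥ 0; it is
  -- nonzero since nearby interior points of X are mapped to interior points of M.
  have hbd : x₀ ∈ (𝓡∂ n).boundary X → ∃ c > 0, ∀ w, L w 0 = w 0 * c := fun hb => by
    have hv0 := (mem_boundary_iff hd hxd).1 hb
    have hbM : ι x₀ ∈ (𝓡∂ (n + 1)).boundary M := by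
      rw [← mem_preimage, hι.preimage_boundary]; exact hb
    have hLv0 := (mem_boundary_iff he hxe).1 hbM
    rw [hcoord _ hxd] at hLv0
    have hmaps : ∀ z ∈ coordTarget d, (L z : Euc (n + 1)) ∈ halfSpace (n + 1) := fun z hz => by
      have h1 := hcoord _ (coordSymm_mem hz)
      rw [coord_coordSymm hz] at h1
      rw [← h1]
      exact coordTarget_subset (coord_mem (hsrc _ (coordSymm_mem hz)))
    have hlin := apply_zero_eq_of_mapsTo_halfSpace hv0 hLv0
      (eventually_of_mem (coordTarget_mem_nhdsWithin (coord_mem hxd)) hmaps)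
    have hl : Tendsto (fun t : ℝ => coord d x₀ + t • EuclideanSpace.single (0 : Fin n) (1 : ℝ))
        (𝓝[>] 0) (𝓝[halfSpace n] (coord d x₀)) := by
      refine tendsto_nhdsWithin_iff.2 ⟨?_, ?_⟩
      · have : Continuous fun t : ℝ =>
          coord d x₀ + t • EuclideanSpace.single (0 : Fin n) (1 : ℝ) := by fun_prop
        simpa using (this.tendsto 0).mono_left nhdsWithin_le_nhds
      · filter_upwards [self_mem_nhdsWithin] with t ht
        rw [mem_halfSpace]
        simpa [hv0] using le_of_lt ht
    obtain ⟨t, htT, ht⟩ := ((hl.eventually (coordTarget_mem_nhdsWithin (coord_mem hxd))).and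
      self_mem_nhdsWithin).exists
    set z := coord d x₀ + t • EuclideanSpace.single (0 : Fin n) (1 : ℝ) with hz
    have hz0 : z 0 = t := by simp [hz, hv0]
    have hxs := coordSymm_mem htT
    have hnb : coordSymm d z ∉ (𝓡∂ n).boundary X := by
      rw [mem_boundary_iff hd hxs, coord_coordSymm htT, hz0]
      exact ht.ne'
    have hnb' : ι (coordSymm d z) ∉ (𝓡∂ (n + 1)).boundary M := by
      rw [← mem_preimage, hι.preimage_boundary]; exact hnb
    rw [mem_boundary_iff he (hsrc _ hxs), hcoord _ hxs, coord_coordSymm htT, hlin, hz0] at hnb'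
    have hge := hmaps z htT
    rw [mem_halfSpace, hlin, hz0] at hge
    refine ⟨_, lt_of_le_of_ne (nonneg_of_mul_nonneg_right hge ht) fun h => hnb' ?_, hlin⟩
    rw [← h, mul_zero]
  -- This ensures that points of the slice lying in M come from points of X: at the boundary,
  -- positivity of c turns L v 0 ≥ 0 into v 0 ≥ 0.
  obtain ⟨N, hN, hvN, hNT⟩ : ∃ N : Set (Euc n), IsOpen N ∧ coord d x₀ ∈ N ∧
      ∀ v ∈ N, 0 ≤ L v 0 → v ∈ coordTarget d := by
    by_cases hb : x₀ ∈ (𝓡∂ n).boundary X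
    · obtain ⟨c, hc, hLc⟩ := hbd hb
      have hm := coord_mem hxd
      rw [coordTarget_eq] at hm ⊢
      refine ⟨_, isOpen_preimage_target d, hm.2, fun v hv hLv => ⟨?_, hv⟩⟩
      rw [hLc] at hLv
      exact mem_halfSpace.2 (nonneg_of_mul_nonneg_left hLv hc)
    · have hpos : 0 < coord d x₀ 0 := lt_of_le_of_ne
        (mem_halfSpace.1 (coordTarget_subset (coord_mem hxd)))
        fun h => hb ((mem_boundary_iff hd hxd).2 h.symm)
      have h1 := coordTarget_mem_nhdsWithin (coord_mem hxd)
      rw [nhdsWithin_eq_nhds.2 (halfSpace_mem_nhds hpos)] at h1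
      obtain ⟨N, hNs, hN, hvN⟩ := _root_.mem_nhds_iff.1 h1
      exact ⟨N, hN, hvN, fun v hv _ => hNs hv⟩
  -- Here the embedding is used topologically: shrinking to `A` excludes other parts of X that
  -- return close to ι x₀.
  obtain ⟨A, hA, hAd⟩ := hemb.isInducing.isOpen_iff.1 d.open_source
  have hB : IsOpen (e.source ∩ coord e ⁻¹' (R ⁻¹' N)) :=
    (contMDiffOn_coord he).continuousOn.isOpen_inter_preimage e.open_source
      (hN.preimage R.continuous)
  set W' : Set M := W ∩ A ∩ (e.source ∩ coord e ⁻¹' (R ⁻¹' N)) with hW'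
  have hW'o : IsOpen W' := (hW.inter hA).inter hB
  have hpre : IsOpen (ι ⁻¹' W') := hW'o.preimage hemb.continuous
  have hses : (e.restr W').source = W' := by
    rw [e.restr_source' _ hW'o]
    exact inter_eq_right.2 fun p hp => hp.2.1
  have hsds : (d.restr (ι ⁻¹' W')).source = ι ⁻¹' W' := by
    rw [d.restr_source' _ hpre]
    refine inter_eq_right.2 fun x hx => ?_
    rw [← hAd]
    exact hx.1.2
  refine ⟨e.restr W', d.restr (ι ⁻¹' W'), L, ℓ, ⟨restr_mem_maximalAtlas _ he hW'o,
    restr_mem_maximalAtlas _ hd hpre, hL, hℓ, fun x => by rw [hses, hsds]; rfl, fun x hx => ?_,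
    fun p hp h => ?_⟩, ?_, ?_, fun hb => ?_⟩
  · rw [hsds] at hx
    refine hcoord x ?_
    rw [← hAd]
    exact hx.1.2
  · rw [hses] at hp
    obtain ⟨v, hv⟩ := (hℓ _).1 h
    change L v = coord e p at hv
    have hvT : v ∈ coordTarget d := by
      refine hNT v ?_ ?_
      · have := hp.2.2
        rwa [mem_preimage, mem_preimage, ← hv, hRL] at this
      · rw [hv]
        exact coordTarget_subset (coord_mem hp.2.1)
    refine ⟨coordSymm d v, ?_⟩
    have h1 := hcoord _ (coordSymm_mem hvT)
    rw [coord_coordSymm hvT, hv] at h1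
    rw [← coordSymm_coord hp.2.1, ← h1, coordSymm_coord (hsrc _ (coordSymm_mem hvT))]
  · rw [hses]
    exact fun p hp => hp.1.1
  · rw [hses]
    refine ⟨⟨hx₀, ?_⟩, hxe, ?_⟩
    · change x₀ ∈ ι ⁻¹' A
      rw [hAd]; exact hxd
    · rw [mem_preimage, mem_preimage, hcoord _ hxd, hRL]
      exact hvN
  · obtain ⟨c, hc, hLc⟩ := hbd hb
    -- The inward coordinate direction of X, normalized: a vector tangent to the slice and
    -- transverse to the boundary hyperplane.
    refine ⟨c⁻¹ • L (EuclideanSpace.single 0 1), ?_, ?_⟩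
    · simp [hLc, hc.ne']
    · rw [map_smul, (hℓ _).2 ⟨_, rfl⟩, smul_zero]

end Slice

/-! ### Differentials of functions and patching by partitions of unity -/

section Differential

variable {m : ℕ} [NeZero m] {M : Type*} [TopologicalSpace M]
  [ChartedSpace (EuclideanHalfSpace m) M]

theorem hasMFDerivAt_diffAt {f : M → ℝ} {p : M} (hf : MDifferentiableAt (𝓡∂ m) 𝓘(ℝ, ℝ) f p) :
    HasMFDerivAt (𝓡∂ m) 𝓘(ℝ, ℝ) f p (diffAt (m := m) f p) :=
  hf.hasMFDerivAt

theorem diffAt_eq_of_hasMFDerivAt {f : M → ℝ} {p : M} {f' : Euc m →L[ℝ] ℝ}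
    (hf : HasMFDerivAt (𝓡∂ m) 𝓘(ℝ, ℝ) f p f') : diffAt f p = f' :=
  hf.mfderiv

theorem diffAt_congr {f f' : M → ℝ} {p : M} (h : f =ᶠ[𝓝 p] f') :
    diffAt (m := m) f p = diffAt f' p :=
  h.mfderiv_eq

theorem diffAt_const (c : ℝ) (p : M) : diffAt (m := m) (fun _ => c) p = 0 :=
  mfderiv_const

theorem diffAt_mul {f f' : M → ℝ} {p : M} (hf : MDifferentiableAt (𝓡∂ m) 𝓘(ℝ, ℝ) f p)
    (hf' : MDifferentiableAt (𝓡∂ m) 𝓘(ℝ, ℝ) f' p) :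
    diffAt (m := m) (fun q => f q * f' q) p = f p • diffAt f' p + f' p • diffAt f p :=
  diffAt_eq_of_hasMFDerivAt ((hasMFDerivAt_diffAt hf).mul (hasMFDerivAt_diffAt hf'))

theorem diffAt_sub {f f' : M → ℝ} {p : M} (hf : MDifferentiableAt (𝓡∂ m) 𝓘(ℝ, ℝ) f p)
    (hf' : MDifferentiableAt (𝓡∂ m) 𝓘(ℝ, ℝ) f' p) :
    diffAt (m := m) (fun q => f q - f' q) p = diffAt f p - diffAt f' p :=
  diffAt_eq_of_hasMFDerivAt ((hasMFDerivAt_diffAt hf).sub (hasMFDerivAt_diffAt hf'))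

theorem diffAt_add {f f' : M → ℝ} {p : M} (hf : MDifferentiableAt (𝓡∂ m) 𝓘(ℝ, ℝ) f p)
    (hf' : MDifferentiableAt (𝓡∂ m) 𝓘(ℝ, ℝ) f' p) :
    diffAt (m := m) (fun q => f q + f' q) p = diffAt f p + diffAt f' p :=
  diffAt_eq_of_hasMFDerivAt ((hasMFDerivAt_diffAt hf).add (hasMFDerivAt_diffAt hf'))

theorem diffAt_sum {ι : Type*} {s : Finset ι} {f : ι → M → ℝ} {p : M}
    (hf : ∀ i ∈ s, MDifferentiableAt (𝓡∂ m) 𝓘(ℝ, ℝ) (f i) p) :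
    diffAt (m := m) (fun q => ∑ i ∈ s, f i q) p = ∑ i ∈ s, diffAt (f i) p := by
  classical
  suffices h : MDifferentiableAt (𝓡∂ m) 𝓘(ℝ, ℝ) (fun q => ∑ i ∈ s, f i q) p ∧
      diffAt (m := m) (fun q => ∑ i ∈ s, f i q) p = ∑ i ∈ s, diffAt (f i) p from h.2
  induction s using Finset.induction_on with
  | empty => exact ⟨mdifferentiableAt_const, diffAt_const 0 p⟩
  | insert a s ha ih =>
    obtain ⟨h1, h2⟩ := ih fun i hi => hf i (Finset.mem_insert_of_mem hi)
    have ha' := hf a (Finset.mem_insert_self _ _)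
    simp only [Finset.sum_insert ha]
    exact ⟨ha'.add h1, by rw [diffAt_add ha' h1, h2]⟩

end Differential

section Patch

variable {m : ℕ} [NeZero m] {M : Type*} [TopologicalSpace M]
  [ChartedSpace (EuclideanHalfSpace m) M] [IsManifold (𝓡∂ m) ∞ M]

/-- The partition is taken over a compact neighbourhood of `C`, so the sum is 1 on an open set and
its differential vanishes there. -/
theorem exists_finite_partition [T2Space M] [SecondCountableTopology M] {C : Set M}
    (hC : IsCompact C) {O : M → Set M} (hO : ∀ p ∈ C, IsOpen (O p)) (hpO : ∀ p ∈ C, p ∈ O p) :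
    ∃ (T : Finset M) (ψ : T → M → ℝ) (W : Set M), IsOpen W ∧ C ⊆ W ∧ (∀ p ∈ T, p ∈ C) ∧
      (∀ i, ContMDiff (𝓡∂ m) 𝓘(ℝ, ℝ) ∞ (ψ i)) ∧ (∀ i p, 0 ≤ ψ i p) ∧
      (∀ i, tsupport (ψ i) ⊆ O i) ∧ ∀ p ∈ W, ∑ i, ψ i p = 1 := by
  have : LocallyCompactSpace M := Manifold.locallyCompact_of_finiteDimensional (𝓡∂ m)
  obtain ⟨T, hTC, hT⟩ := hC.elim_nhds_subcover O fun p hp => (hO p hp).mem_nhds (hpO p hp)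
  obtain ⟨K, hK, hCK, hKO⟩ := exists_compact_between hC
    (isOpen_biUnion fun p (hp : p ∈ T) => hO p (hTC p hp)) hT
  obtain ⟨ψ, hψ⟩ := SmoothPartitionOfUnity.exists_isSubordinate (𝓡∂ m) hK.isClosed
    (fun i : T => O i) (fun i => hO i (hTC i i.2))
    (hKO.trans fun p hp => by
      obtain ⟨i, hi, hpi⟩ := mem_iUnion₂.1 hp
      exact mem_iUnion.2 ⟨⟨i, hi⟩, hpi⟩)
  refine ⟨T, fun i => ψ i, interior K, isOpen_interior, hCK, hTC, fun i => (ψ i).contMDiff,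
    fun i p => ψ.nonneg i p, hψ, fun p hp => ?_⟩
  rw [← finsum_eq_sum_of_fintype]
  exact ψ.sum_eq_one (interior_subset hp)

variable {ι : Type*} [Fintype ι] {ψ F : ι → M → ℝ} {O : ι → Set M}

theorem contMDiff_mul_of_tsupport_subset {ψ F : M → ℝ} {O : Set M}
    (hψ : ContMDiff (𝓡∂ m) 𝓘(ℝ, ℝ) ∞ ψ) (hsupp : tsupport ψ ⊆ O) (hO : IsOpen O)
    (hF : ContMDiffOn (𝓡∂ m) 𝓘(ℝ, ℝ) ∞ F O) :
    ContMDiff (𝓡∂ m) 𝓘(ℝ, ℝ) ∞ fun p => ψ p * F p :=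
  contMDiff_of_tsupport fun _ hp => hψ.contMDiffAt.mul (hF.contMDiffAt (hO.mem_nhds
    (hsupp (closure_mono (support_mul_subset_left _ _) hp))))

theorem diffAt_mul_of_tsupport_subset {ψ F : M → ℝ} {O : Set M}
    (hψ : ContMDiff (𝓡∂ m) 𝓘(ℝ, ℝ) ∞ ψ) (hsupp : tsupport ψ ⊆ O) (hO : IsOpen O)
    (hF : ContMDiffOn (𝓡∂ m) 𝓘(ℝ, ℝ) ∞ F O) (p : M) :
    diffAt (m := m) (fun q => ψ q * F q) p = ψ p • diffAt F p + F p • diffAt ψ p := by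
  by_cases hp : p ∈ tsupport ψ
  · exact diffAt_mul (hψ.contMDiffAt.mdifferentiableAt (by simp))
      ((hF.contMDiffAt (hO.mem_nhds (hsupp hp))).mdifferentiableAt (by simp))
  · have h0 : ψ =ᶠ[𝓝 p] fun _ => 0 := notMem_tsupport_iff_eventuallyEq.1 hp
    have h1 : (fun q => ψ q * F q) =ᶠ[𝓝 p] fun _ => 0 := by
      filter_upwards [h0] with q hq
      rw [hq, zero_mul]
    rw [diffAt_congr h1, diffAt_congr h0, diffAt_const, h0.self_of_nhds]
    simp

/-- The differential of a function which is patched together using a partition of unity. -/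
theorem diffAt_patch (hψ : ∀ i, ContMDiff (𝓡∂ m) 𝓘(ℝ, ℝ) ∞ (ψ i))
    (hsupp : ∀ i, tsupport (ψ i) ⊆ O i) (hO : ∀ i, IsOpen (O i))
    (hF : ∀ i, ContMDiffOn (𝓡∂ m) 𝓘(ℝ, ℝ) ∞ (F i) (O i)) (p : M) :
    diffAt (m := m) (fun q => ∑ i, ψ i q * F i q) p =
      ∑ i, (ψ i p • diffAt (F i) p + F i p • diffAt (ψ i) p) := by
  rw [diffAt_sum fun i _ => (contMDiff_mul_of_tsupport_subset (hψ i) (hsupp i) (hO i)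
    (hF i)).contMDiffAt.mdifferentiableAt (by simp)]
  exact Finset.sum_congr rfl fun i _ =>
    diffAt_mul_of_tsupport_subset (hψ i) (hsupp i) (hO i) (hF i) p

/-- A local defining function of the hypersurface `range ι`, increasing in the direction of `ν`. -/
structure IsDefiningOn {X : Type*} (ι : X → M) (ν : X → Euc m) (O : Set M) (F : M → ℝ) : Prop where
  isOpen : IsOpen O
  contMDiffOn : ContMDiffOn (𝓡∂ m) 𝓘(ℝ, ℝ) ∞ F O
  eq_zero : ∀ x, ι x ∈ O → F (ι x) = 0
  pos : ∀ x, ι x ∈ O → 0 < diffAt F (ι x) (ν x)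

/-- Local defining functions with prescribed values and prescribed critical directions on some set
can be patched together. -/
theorem exists_isDefiningOn_of_local [T2Space M] [SecondCountableTopology M] {X : Type*}
    {ι : X → M} {ν : X → Euc m} (hC : IsCompact (range ι)) {B : Set M} {N : M → Set (Euc m)}
    {f₀ : M → ℝ}
    (h : ∀ x, ∃ O F, ι x ∈ O ∧ IsDefiningOn ι ν O F ∧
      ∀ p ∈ B ∩ O, F p = f₀ p ∧ ∀ η ∈ N p, diffAt F p η = 0) :
    ∃ O F, range ι ⊆ O ∧ IsDefiningOn ι ν O F ∧ ∀ p ∈ B ∩ O, ∀ η ∈ N p, diffAt F p η = 0 := by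
  have h' : ∀ p ∈ range ι, ∃ O F, p ∈ O ∧ IsDefiningOn ι ν O F ∧
      ∀ p ∈ B ∩ O, F p = f₀ p ∧ ∀ η ∈ N p, diffAt F p η = 0 := by
    rintro _ ⟨x, rfl⟩
    exact h x
  choose! O F hpO hF hB using h'
  obtain ⟨T, ψ, W, hW, hCW, hTC, hψ, hψ0, hsupp, hsum⟩ :=
    exists_finite_partition (m := m) hC (fun p hp => (hF p hp).isOpen) hpO
  have hT : ∀ i : T, IsDefiningOn ι ν (O i) (F i) := fun i => hF i (hTC i i.2)
  have hd := diffAt_patch hψ hsupp (fun i => (hT i).isOpen) fun i => (hT i).contMDiffOn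
  have hz : ∀ (i : T) p, p ∉ O i → ψ i p = 0 ∧ diffAt (m := m) (ψ i) p = 0 := fun i p hp => by
    have h0 : ψ i =ᶠ[𝓝 p] fun _ => 0 :=
      notMem_tsupport_iff_eventuallyEq.1 fun h => hp (hsupp i h)
    exact ⟨h0.self_of_nhds, by rw [diffAt_congr h0, diffAt_const]⟩
  refine ⟨W, fun p => ∑ i, ψ i p * F i p, hCW, ⟨hW, ?_, fun x hx => ?_, fun x hx => ?_⟩,
    fun p hp η hη => ?_⟩
  · exact (contMDiff_finsetSum fun i _ => contMDiff_mul_of_tsupport_subset (hψ i) (hsupp i)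
      (hT i).isOpen (hT i).contMDiffOn).contMDiffOn
  · refine Finset.sum_eq_zero fun i _ => ?_
    by_cases hi : ι x ∈ O i
    · rw [(hT i).eq_zero x hi, mul_zero]
    · rw [(hz i _ hi).1, zero_mul]
  · rw [hd, sum_apply]
    -- Every `F i` vanishes on the hypersurface, so the differentials of the cutoffs do not
    -- contribute, and positivity passes to the convex combination.
    have hterm : ∀ i : T, (ψ i (ι x) • diffAt (F i) (ι x) +
        F i (ι x) • diffAt (ψ i) (ι x) : Euc m →L[ℝ] ℝ) (ν x) = ψ i (ι x) * diffAt (m := m) (F i) (ι x) (ν x) := by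
      intro i
      by_cases hi : ι x ∈ O i
      · simp [(hT i).eq_zero x hi]
      · simp [(hz i _ hi).1, (hz i _ hi).2]
    have hnn : ∀ i : T, 0 ≤ ψ i (ι x) * diffAt (m := m) (F i) (ι x) (ν x) := fun i => by
      by_cases hi : ι x ∈ O i
      · exact mul_nonneg (hψ0 i _) ((hT i).pos x hi).le
      · simp [(hz i _ hi).1]
    rw [Finset.sum_congr rfl fun i _ => hterm i]
    obtain ⟨i, -, hi⟩ : ∃ i ∈ Finset.univ, ψ i (ι x) ≠ 0 := by
      refine Finset.exists_ne_zero_of_sum_ne_zero ?_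
      rw [hsum _ hx]
      exact one_ne_zero
    refine Finset.sum_pos' (fun i _ => hnn i) ⟨i, Finset.mem_univ _, ?_⟩
    refine mul_pos (lt_of_le_of_ne (hψ0 i _) hi.symm) ((hT i).pos x ?_)
    by_contra h
    exact hi (hz i _ h).1
  · rw [hd, sum_apply]
    -- Here the common value `f₀ p` is needed: it factors out, leaving the differential of the
    -- locally constant sum of the cutoffs.
    have hterm : ∀ i : T, (ψ i p • diffAt (F i) p + F i p • diffAt (ψ i) p : Euc m →L[ℝ] ℝ) η =
        f₀ p * diffAt (m := m) (ψ i) p η := by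
      intro i
      by_cases hi : p ∈ O i
      · obtain ⟨h1, h2⟩ := hB i (hTC i i.2) p ⟨hp.1, hi⟩
        simp [h1, h2 η hη]
      · simp [(hz i _ hi).1, (hz i _ hi).2]
    rw [Finset.sum_congr rfl fun i _ => hterm i, ← Finset.mul_sum]
    have h1 : diffAt (m := m) (fun q => ∑ i, ψ i q) p = 0 := by
      rw [diffAt_congr (f' := fun _ => 1) (eventually_of_mem (hW.mem_nhds hp.2) hsum), diffAt_const]
    rw [diffAt_sum fun i _ => (hψ i).contMDiffAt.mdifferentiableAt (by simp)] at h1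
    rw [← sum_apply, h1]
    simp

end Patch

/-! ### Unit normals and defining functions of the hypersurface -/

section Along

variable {m : ℕ} [NeZero m] {M : Type*} [TopologicalSpace M]
  [ChartedSpace (EuclideanHalfSpace m) M] [IsManifold (𝓡∂ m) ∞ M]

theorem continuousOn_diffAt_along {X : Type*} [TopologicalSpace X] {ι : X → M}
    {ν : (x : X) → TangentSpace (𝓡∂ m) (ι x)}
    (hν : Continuous fun x => (⟨ι x, ν x⟩ : TangentBundle (𝓡∂ m) M)) {F : M → ℝ} {O : Set M}
    (hO : IsOpen O) (hF : ContMDiffOn (𝓡∂ m) 𝓘(ℝ, ℝ) ∞ F O) :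
    ContinuousOn (fun x => diffAt F (ι x) (ν x)) (ι ⁻¹' O) := by
  have h1 := (hF.contMDiffOn_tangentMapWithin (m := ∞) (by simp) hO.uniqueMDiffOn).continuousOn
  have h2 := h1.comp (hν.continuousOn (s := ι ⁻¹' O)) fun x hx => hx
  have h3 := (contMDiff_snd_tangentBundle_modelSpace ℝ 𝓘(ℝ, ℝ) (n := ∞)).continuous.comp_continuousOn h2
  refine h3.congr fun x hx => ?_
  change diffAt F (ι x) (ν x) = mfderivWithin (𝓡∂ m) 𝓘(ℝ, ℝ) F O (ι x) (ν x)
  rw [mfderivWithin_of_isOpen hO hx]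
  rfl

end Along

section DefiningFunction

variable {n : ℕ} [NeZero n]
  {X : Type*} [TopologicalSpace X] [ChartedSpace (EuclideanHalfSpace n) X]
  [IsManifold (𝓡∂ n) ∞ X]
  {M : Type*} [TopologicalSpace M] [ChartedSpace (EuclideanHalfSpace (n + 1)) M]
  [IsManifold (𝓡∂ (n + 1)) ∞ M]

/-- The differential of a map, as a linear map of the model spaces. -/
def mapDeriv (ι : X → M) (x : X) : Euc n →L[ℝ] Euc (n + 1) :=
  mfderiv (𝓡∂ n) (𝓡∂ (n + 1)) ι x

theorem diffAt_comp {ι : X → M} {x : X}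
    (hι : MDifferentiableAt (𝓡∂ n) (𝓡∂ (n + 1)) ι x) {F : M → ℝ}
    (hF : MDifferentiableAt (𝓡∂ (n + 1)) 𝓘(ℝ, ℝ) F (ι x)) (w : Euc n) :
    diffAt (F ∘ ι) x w = diffAt F (ι x) (mapDeriv ι x w) := by
  have h : HasMFDerivAt (𝓡∂ n) (𝓡∂ (n + 1)) ι x (mapDeriv ι x) := hι.hasMFDerivAt
  rw [diffAt_eq_of_hasMFDerivAt ((hasMFDerivAt_diffAt hF).comp x h)]
  rfl

theorem IsProperlyEmbedded.mdifferentiableAt {ι : X → M} (hι : IsProperlyEmbedded (n := n) ι)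
    (x : X) : MDifferentiableAt (𝓡∂ n) (𝓡∂ (n + 1)) ι x :=
  hι.isSmoothEmbedding.contMDiff.mdifferentiableAt (by simp)

theorem IsSliceChart.coordDeriv_mapDeriv {ι : X → M}
    {e : OpenPartialHomeomorph M (EuclideanHalfSpace (n + 1))}
    {d : OpenPartialHomeomorph X (EuclideanHalfSpace n)} {L : Euc n →L[ℝ] Euc (n + 1)}
    {ℓ : Euc (n + 1) →L[ℝ] ℝ} (h : IsSliceChart ι e d L ℓ) {x : X} (hx : x ∈ d.source)
    (hι : MDifferentiableAt (𝓡∂ n) (𝓡∂ (n + 1)) ι x) (w : Euc n) :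
    coordDeriv e (ι x) (mapDeriv ι x w) = L (coordDeriv d x w) := by
  have h0 : HasMFDerivAt (𝓡∂ n) (𝓡∂ (n + 1)) ι x (mapDeriv ι x) := hι.hasMFDerivAt
  have h1 : HasMFDerivAt (𝓡∂ n) 𝓘(ℝ, Euc (n + 1)) (coord e ∘ ι) x
      ((coordDeriv e (ι x)).comp (mapDeriv ι x)) :=
    (hasMFDerivAt_coord h.mem_maximalAtlas ((h.mem_iff x).2 hx)).comp x h0
  have h2 : HasMFDerivAt (𝓡∂ n) 𝓘(ℝ, Euc (n + 1)) (L ∘ coord d) x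
      (L.comp (coordDeriv d x)) :=
    L.hasMFDerivAt.comp x (hasMFDerivAt_coord h.mem_maximalAtlas' hx)
  have h3 : coord e ∘ ι =ᶠ[𝓝 x] L ∘ coord d := by
    filter_upwards [d.open_source.mem_nhds hx] with z hz using h.coord_eq z hz
  have h4 : (coordDeriv e (ι x)).comp (mapDeriv ι x) = L.comp (coordDeriv d x) :=
    hasMFDerivAt_unique h1 (h2.congr_of_eventuallyEq h3)
  exact DFunLike.congr_fun h4 w

/-- A continuous unit normal field along a hypersurface. -/
structure IsUnitNormal (g : Met (n + 1) M) (ι : X → M) (ν : X → Euc (n + 1)) : Prop where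
  continuous : Continuous fun x => (⟨ι x, ν x⟩ : TangentBundle (𝓡∂ (n + 1)) M)
  normal : ∀ x w, metricAt g (ι x) (ν x) (mapDeriv ι x w) = 0
  unit : ∀ x, metricAt g (ι x) (ν x) (ν x) = 1

variable {g : Met (n + 1) M} {ι : X → M} {ν : X → Euc (n + 1)}
  {e : OpenPartialHomeomorph M (EuclideanHalfSpace (n + 1))}
  {d : OpenPartialHomeomorph X (EuclideanHalfSpace n)} {L : Euc n →L[ℝ] Euc (n + 1)}
  {ℓ : Euc (n + 1) →L[ℝ] ℝ}

theorem IsSliceChart.exists_mapDeriv_eq (hι : IsProperlyEmbedded (n := n) ι)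
    (h : IsSliceChart ι e d L ℓ) {x : X} (hx : x ∈ d.source) {V : Euc (n + 1)}
    (hV : ℓ (coordDeriv e (ι x) V) = 0) : ∃ w, mapDeriv ι x w = V := by
  obtain ⟨v, hv⟩ := (h.ker_eq _).1 hV
  obtain ⟨w, hw⟩ := exists_coordDeriv_eq h.mem_maximalAtlas' hx v
  refine ⟨w, ?_⟩
  have hxe := (h.mem_iff x).2 hx
  rw [← coordSymmDeriv_coordDeriv h.mem_maximalAtlas hxe V, ← hv, ← hw,
    ← h.coordDeriv_mapDeriv hx (hι.mdifferentiableAt x),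
    coordSymmDeriv_coordDeriv h.mem_maximalAtlas hxe]

/-- Otherwise the normal would be tangent to the hypersurface, hence orthogonal to itself. -/
theorem IsUnitNormal.slice_ne_zero (hν : IsUnitNormal g ι ν) (hι : IsProperlyEmbedded (n := n) ι)
    (h : IsSliceChart ι e d L ℓ) {x : X} (hx : x ∈ d.source) :
    ℓ (coordDeriv e (ι x) (ν x)) ≠ 0 := fun h0 => by
  obtain ⟨w, hw⟩ := h.exists_mapDeriv_eq hι hx h0
  have h1 := hν.normal x w
  rw [hw, hν.unit x] at h1
  exact one_ne_zero h1

/-- The decomposition of a vector into its normal and tangential parts. -/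
theorem IsUnitNormal.exists_eq (hν : IsUnitNormal g ι ν) (hι : IsProperlyEmbedded (n := n) ι)
    (x : X) (V : Euc (n + 1)) :
    ∃ w, V = metricAt g (ι x) (ν x) V • ν x + mapDeriv ι x w := by
  obtain ⟨e, d, L, ℓ, h, -, hxe, -⟩ := hι.exists_isSliceChart x isOpen_univ (mem_univ _)
  have hx := (h.mem_iff x).1 hxe
  have h0 := hν.slice_ne_zero hι h hx
  set a := ℓ (coordDeriv e (ι x) V) / ℓ (coordDeriv e (ι x) (ν x)) with ha
  obtain ⟨w, hw⟩ := h.exists_mapDeriv_eq hι hx (V := V - a • ν x) (by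
    rw [map_sub, map_sub, map_smul, map_smul, smul_eq_mul, ha, div_mul_cancel₀ _ h0, sub_self])
  have h1 := hν.normal x w
  rw [hw, map_sub, map_smul, hν.unit x, smul_eq_mul, mul_one, sub_eq_zero] at h1
  exact ⟨w, by rw [h1, hw]; abel⟩

theorem IsDefiningOn.diffAt_mapDeriv (hι : IsProperlyEmbedded (n := n) ι) {O : Set M} {F : M → ℝ}
    (hF : IsDefiningOn ι ν O F) {x : X} (hx : ι x ∈ O) (w : Euc n) :
    diffAt F (ι x) (mapDeriv ι x w) = 0 := by
  rw [← diffAt_comp (hι.mdifferentiableAt x)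
    ((hF.contMDiffOn.contMDiffAt (hF.isOpen.mem_nhds hx)).mdifferentiableAt (by simp)),
    diffAt_congr (f' := fun _ => 0), diffAt_const]
  · rfl
  · filter_upwards [(hF.isOpen.preimage hι.isSmoothEmbedding.2.continuous).mem_nhds hx] with z hz
      using hF.eq_zero z hz

/-- The differential vanishes on tangent vectors, so only the normal part of `V` contributes: up to
the factor dF(ν), it is g(ν, ·). -/
theorem IsDefiningOn.diffAt_eq (hι : IsProperlyEmbedded (n := n) ι) (hν : IsUnitNormal g ι ν)
    {O : Set M} {F : M → ℝ} (hF : IsDefiningOn ι ν O F) {x : X} (hx : ι x ∈ O) (V : Euc (n + 1)) :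
    diffAt F (ι x) V = metricAt g (ι x) (ν x) V * diffAt F (ι x) (ν x) := by
  obtain ⟨w, hw⟩ := hν.exists_eq hι x V
  conv_lhs => rw [hw]
  rw [map_add, hF.diffAt_mapDeriv hι hx, add_zero, map_smul, smul_eq_mul]

/-- A function vanishing on the hypersurface and increasing at a point in the normal direction is a
local defining function. -/
theorem IsUnitNormal.exists_isDefiningOn_of_pos (hν : IsUnitNormal g ι ν)
    (hι : IsProperlyEmbedded (n := n) ι) {O : Set M} (hO : IsOpen O) {F : M → ℝ}
    (hF : ContMDiffOn (𝓡∂ (n + 1)) 𝓘(ℝ, ℝ) ∞ F O) (h0 : ∀ x, ι x ∈ O → F (ι x) = 0) {x₀ : X}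
    (hx₀ : ι x₀ ∈ O) (hpos : 0 < diffAt F (ι x₀) (ν x₀)) :
    ∃ O' ⊆ O, ι x₀ ∈ O' ∧ IsDefiningOn ι ν O' F := by
  have hc := continuousOn_diffAt_along (ν := ν) hν.continuous hO hF
  have ho := hc.isOpen_inter_preimage (hO.preimage hι.isSmoothEmbedding.2.continuous)
    (isOpen_Ioi (a := (0 : ℝ)))
  obtain ⟨A, hA, hAX⟩ := hι.isSmoothEmbedding.2.isInducing.isOpen_iff.1 ho
  refine ⟨O ∩ A, inter_subset_left, ⟨hx₀, ?_⟩, hO.inter hA, hF.mono inter_subset_left,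
    fun x hx => h0 x hx.1, fun x hx => ?_⟩
  · change x₀ ∈ ι ⁻¹' A
    rw [hAX]
    exact ⟨hx₀, hpos⟩
  · have : x ∈ ι ⁻¹' A := hx.2
    rw [hAX] at this
    exact this.2

/-- A smooth defining function on a neighbourhood of the hypersurface. -/
theorem IsUnitNormal.exists_isDefiningOn [CompactSpace X] [T2Space M] [SecondCountableTopology M]
    (hν : IsUnitNormal g ι ν) (hι : IsProperlyEmbedded (n := n) ι) :
    ∃ O F, range ι ⊆ O ∧ IsDefiningOn ι ν O F := by
  obtain ⟨O, F, hO, hF, -⟩ := exists_isDefiningOn_of_local (m := n + 1) (ι := ι) (ν := ν)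
    (isCompact_range hι.isSmoothEmbedding.2.continuous) (B := ∅) (N := fun _ => ∅)
    (f₀ := fun _ => 0) fun x => by
      obtain ⟨e, d, L, ℓ, h, -, hxe, -⟩ := hι.exists_isSliceChart x isOpen_univ (mem_univ _)
      have hx := (h.mem_iff x).1 hxe
      have hne := hν.slice_ne_zero hι h hx
      -- The form of a slice chart has no preferred sign; the global normal fixes one, so that the
      -- local functions can be averaged.
      obtain ⟨s, hs⟩ : ∃ s : ℝ, 0 < (s • ℓ) (coordDeriv e (ι x) (ν x)) :=
        ⟨ℓ (coordDeriv e (ι x) (ν x)), by simpa using mul_self_pos.2 hne⟩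
      obtain ⟨O, hO, hxO, hF⟩ := hν.exists_isDefiningOn_of_pos hι e.open_source
        (F := (s • ℓ) ∘ coord e)
        ((s • ℓ).contMDiff.comp_contMDiffOn (contMDiffOn_coord h.mem_maximalAtlas))
        (fun z hz => by
          have hz' := (h.mem_iff z).1 hz
          rw [comp_apply, h.coord_eq z hz', smul_apply, (h.ker_eq _).2 ⟨_, rfl⟩,
            smul_zero]) hxe (by
          rw [diffAt_comp_coord h.mem_maximalAtlas hxe EventuallyEq.rfl
            (s • ℓ).hasFDerivWithinAt]
          exact hs)
      exact ⟨O, _, hxO, hF, by simp⟩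
  exact ⟨O, F, hO, hF⟩

end DefiningFunction

/-! ### Boundary normals and a defining function with tangential gradient -/

section BoundaryNormal

variable {m : ℕ} [NeZero m] {M : Type*} [TopologicalSpace M]
  [ChartedSpace (EuclideanHalfSpace m) M] [IsManifold (𝓡∂ m) ∞ M]
  {e : OpenPartialHomeomorph M (EuclideanHalfSpace m)}

/-- The vectors orthogonal to the boundary. -/
def boundaryNormalSpace (g : Met m M) (p : M) : Set (Euc m) :=
  {η | ∀ v ∈ boundaryTangentSpace p, metricAt g p η v = 0}

/-- The gradient of the first coordinate of a chart, read in the chart. -/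
def coordNormal (g : Met m M) (e : OpenPartialHomeomorph M (EuclideanHalfSpace m)) (y : Euc m) :
    Euc m :=
  (metricCoord g e y).inverse (coordZero m)

theorem metricCoord_coordNormal (he : e ∈ IsManifold.maximalAtlas (𝓡∂ m) ∞ M) (g : Met m M)
    {y : Euc m} (hy : y ∈ coordTarget e) (v : Euc m) :
    metricCoord g e y (coordNormal g e y) v = v 0 := by
  rw [coordNormal, apply_inverse_of_pos fun _ => metricCoord_pos he g hy]
  rfl

theorem coordNormal_zero_pos (he : e ∈ IsManifold.maximalAtlas (𝓡∂ m) ∞ M) (g : Met m M)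
    {y : Euc m} (hy : y ∈ coordTarget e) : 0 < coordNormal g e y 0 := by
  refine apply_inverse_self_pos (α := coordZero m) (fun _ => metricCoord_pos he g hy) fun h => ?_
  have := DFunLike.congr_fun h (EuclideanSpace.single 0 1)
  simp at this

theorem contDiffOn_coordNormal (he : e ∈ IsManifold.maximalAtlas (𝓡∂ m) ∞ M) (g : Met m M) :
    ContDiffOn ℝ ∞ (coordNormal g e) (coordTarget e) :=
  contDiffOn_inverse_apply (contDiffOn_metricCoord he g)
    (fun _ hy _ => metricCoord_pos he g hy) contDiffOn_const

theorem coordSymmDeriv_coordNormal_mem (he : e ∈ IsManifold.maximalAtlas (𝓡∂ m) ∞ M)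
    (g : Met m M) {y : Euc m} (hy : y ∈ coordTarget e) (h0 : y 0 = 0) :
    coordSymmDeriv e y (coordNormal g e y) ∈ boundaryNormalSpace g (coordSymm e y) := by
  intro v hv
  have hp := coordSymm_mem hy
  have h1 := (mem_boundaryTangentSpace_iff he hp (by rwa [coord_coordSymm hy])).1 hv
  have h2 := coordSymmDeriv_coordDeriv he hp v
  rw [coord_coordSymm hy] at h2
  have h3 := metricCoord_coordNormal he g hy (coordDeriv e (coordSymm e y) v)
  rw [metricCoord_apply, h2, h1] at h3
  exact h3

/-- A normal vector pairs to zero with the hyperplane of tangential vectors, so its dual form is a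
multiple of the first coordinate. -/
theorem exists_coordDeriv_eq_smul_coordNormal (he : e ∈ IsManifold.maximalAtlas (𝓡∂ m) ∞ M)
    {g : Met m M} {p : M} (hp : p ∈ e.source) (h0 : coord e p 0 = 0) {η : Euc m}
    (hη : η ∈ boundaryNormalSpace g p) :
    ∃ b : ℝ, coordDeriv e p η = b • coordNormal g e (coord e p) := by
  have hy := coord_mem hp
  set G := metricCoord g e (coord e p) with hG
  have hker : ∀ w : Euc m, w 0 = 0 → G (coordDeriv e p η) w = 0 := fun w hw => by
    obtain ⟨v, rfl⟩ := exists_coordDeriv_eq he hp w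
    rw [hG, metricCoord_coordDeriv he g hp]
    exact hη v ((mem_boundaryTangentSpace_iff he hp h0).2 hw)
  refine ⟨G (coordDeriv e p η) (EuclideanSpace.single 0 1), ?_⟩
  rw [coordNormal, ← map_smul]
  refine (inverse_eq_of_apply_eq (fun _ => metricCoord_pos he g hy) ?_).symm
  ext w
  have := hker (w - w 0 • EuclideanSpace.single 0 1) (by simp)
  rw [map_sub, map_smul, sub_eq_zero] at this
  rw [this, smul_eq_mul, mul_comm]
  rfl

end BoundaryNormal

section Adapted

variable {n : ℕ} [NeZero n]
  {X : Type*} [TopologicalSpace X] [ChartedSpace (EuclideanHalfSpace n) X]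
  [IsManifold (𝓡∂ n) ∞ X]
  {M : Type*} [TopologicalSpace M] [ChartedSpace (EuclideanHalfSpace (n + 1)) M]
  [IsManifold (𝓡∂ (n + 1)) ∞ M]
  {g : Met (n + 1) M} {ι : X → M} {ν : X → Euc (n + 1)}

/-- The only use of the orthogonality hypothesis. -/
theorem IsDefiningOn.diffAt_boundaryNormal (hι : IsProperlyEmbedded (n := n) ι)
    (hν : IsUnitNormal g ι ν) (horth : MeetsBoundaryOrthogonally (n := n) g ι) {O : Set M}
    {F : M → ℝ} (hF : IsDefiningOn ι ν O F) {x : X} (hx : ι x ∈ O)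
    (hxb : x ∈ (𝓡∂ n).boundary X) {η : Euc (n + 1)} (hη : η ∈ boundaryNormalSpace g (ι x)) :
    diffAt F (ι x) η = 0 := by
  have h : metricAt g (ι x) (ν x) η = 0 := horth x hxb (ν x) η (hν.normal x) hη
  rw [hF.diffAt_eq hι hν hx, h, zero_mul]

/-- Near a point of the hypersurface, a defining function can be modified away from the boundary so
that its gradient is tangent to the boundary. -/
theorem IsDefiningOn.exists_local_tangent (hι : IsProperlyEmbedded (n := n) ι)
    (hν : IsUnitNormal g ι ν) (horth : MeetsBoundaryOrthogonally (n := n) g ι) {O₀ : Set M}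
    {f₀ : M → ℝ} (hf₀ : IsDefiningOn ι ν O₀ f₀) {x₀ : X} (hx₀ : ι x₀ ∈ O₀) :
    ∃ O F, ι x₀ ∈ O ∧ IsDefiningOn ι ν O F ∧ ∀ p ∈ (𝓡∂ (n + 1)).boundary M ∩ O,
      F p = f₀ p ∧ ∀ η ∈ boundaryNormalSpace g p, diffAt F p η = 0 := by
  by_cases hb : x₀ ∈ (𝓡∂ n).boundary X
  swap
  -- At an interior point, removing the closed set ∂M makes the boundary conditions vacuous.
  · have hb' : ι x₀ ∈ ((𝓡∂ (n + 1)).boundary M)ᶜ := fun h => hb (by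
      rw [← hι.preimage_boundary]; exact h)
    have hc : IsOpen ((𝓡∂ (n + 1)).boundary M)ᶜ :=
      ((𝓡∂ (n + 1)).isClosed_boundary (M := M) (n := ∞) (by simp)).isOpen_compl
    exact ⟨O₀ ∩ ((𝓡∂ (n + 1)).boundary M)ᶜ, f₀, ⟨hx₀, hb'⟩, ⟨hf₀.isOpen.inter hc,
      hf₀.contMDiffOn.mono inter_subset_left, fun x hx => hf₀.eq_zero x hx.1,
      fun x hx => hf₀.pos x hx.1⟩, fun p hp => absurd hp.1 hp.2.2⟩
  obtain ⟨e, d, L, ℓ, h, heO, hxe, hζ⟩ := hι.exists_isSliceChart x₀ hf₀.isOpen hx₀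
  obtain ⟨ζ, hζ0, hℓζ⟩ := hζ hb
  have he := h.mem_maximalAtlas
  have hf₀e := hf₀.contMDiffOn.mono heO
  set α : Euc (n + 1) → Euc (n + 1) →L[ℝ] ℝ := fun y =>
    (diffAt f₀ (coordSymm e y)).comp (coordSymmDeriv e y) with hα
  -- The derivative of `f₀` along the boundary normal, divided by that of the boundary coordinate ρ.
  -- Subtracting cρ from `f₀` cancels the normal derivative on ∂M.
  set c : Euc (n + 1) → ℝ := fun y => α y (coordNormal g e y) / coordNormal g e y 0 with hc
  have hcs : ContDiffOn ℝ ∞ c (coordTarget e) :=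
    ((contDiffOn_diffAt_coordSymm he hf₀e).clm_apply (contDiffOn_coordNormal he g)).div
      ((coordZero (n + 1)).contDiff.comp_contDiffOn (contDiffOn_coordNormal he g))
      fun y hy => (coordNormal_zero_pos he g hy).ne'
  have hc0 : ∀ y ∈ coordTarget e, y 0 = 0 → ℓ y = 0 → c y = 0 := fun y hy hy0 hℓy => by
    have hp := coordSymm_mem hy
    obtain ⟨x, hx⟩ := h.mem_range _ hp (by rwa [coord_coordSymm hy])
    have hxb : x ∈ (𝓡∂ n).boundary X := by
      rw [← hι.preimage_boundary, mem_preimage, hx, mem_boundary_iff he hp, coord_coordSymm hy, hy0]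
    have hη := coordSymmDeriv_coordNormal_mem he g hy hy0
    have hxO : ι x ∈ O₀ := by rw [hx]; exact heO hp
    rw [← hx] at hη
    have := hf₀.diffAt_boundaryNormal hι hν horth hxO hxb hη
    rw [hx] at this
    simp only [hc, hα, ContinuousLinearMap.comp_apply, this, zero_div]
  -- `c` vanishes on ∂X but not on all of X, so f₀ - cρ need not vanish on X. The projection onto
  -- the boundary hyperplane along ζ preserves the slice because ℓ ζ = 0; thus c ∘ P vanishes on X
  -- and agrees with `c` on ∂M.
  set P : Euc (n + 1) → Euc (n + 1) := fun y => y - y 0 • ζ with hP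
  have hPs : ContDiff ℝ ∞ P :=
    contDiff_id.sub ((coordZero (n + 1)).contDiff.smul contDiff_const)
  have hP0 : ∀ y, P y 0 = 0 := fun y => by simp [hP, hζ0]
  have hPid : ∀ y : Euc (n + 1), y 0 = 0 → P y = y := fun y hy => by simp [hP, hy]
  have hℓP : ∀ y, ℓ (P y) = ℓ y := fun y => by simp [hP, hℓζ]
  set O₁ : Set M := e.source ∩ coord e ⁻¹' (P ⁻¹' ((𝓡∂ (n + 1)).symm ⁻¹' e.target)) with hO₁
  have hO₁o : IsOpen O₁ := (contMDiffOn_coord he).continuousOn.isOpen_inter_preimage e.open_source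
    ((isOpen_preimage_target e).preimage hPs.continuous)
  have hPT : ∀ p ∈ O₁, P (coord e p) ∈ coordTarget e := fun p hp => by
    rw [coordTarget_eq]
    exact ⟨mem_halfSpace.2 (hP0 _).ge, hp.2⟩
  have hks : ContMDiffOn (𝓡∂ (n + 1)) 𝓘(ℝ, ℝ) ∞ (fun p => c (P (coord e p))) O₁ :=
    hcs.contMDiffOn.comp (hPs.contMDiff.comp_contMDiffOn
      ((contMDiffOn_coord he).mono inter_subset_left)) hPT
  have hρs := (contMDiffOn_coord_zero he).mono (inter_subset_left : O₁ ⊆ e.source)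
  set F : M → ℝ := fun p => f₀ p - coord e p 0 * c (P (coord e p)) with hF
  have hFs : ContMDiffOn (𝓡∂ (n + 1)) 𝓘(ℝ, ℝ) ∞ F O₁ :=
    (hf₀e.mono inter_subset_left).sub (hρs.mul hks)
  have hdF : ∀ p ∈ O₁, coord e p 0 = 0 → ∀ v, diffAt F p v =
      diffAt f₀ p v - c (coord e p) * coordDeriv e p v 0 := fun p hp hp0 v => by
    have hm := hO₁o.mem_nhds hp
    have d1 := (hρs.contMDiffAt hm).mdifferentiableAt (by simp)
    have d2 := (hks.contMDiffAt hm).mdifferentiableAt (by simp)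
    have d3 := ((hf₀e.mono inter_subset_left).contMDiffAt hm).mdifferentiableAt (by simp)
    have d4 : MDifferentiableAt (𝓡∂ (n + 1)) 𝓘(ℝ, ℝ)
        (fun p => coord e p 0 * c (P (coord e p))) p := d1.mul d2
    rw [hF, diffAt_sub d3 d4, diffAt_mul d1 d2, hp0, hPid _ hp0, zero_smul, zero_add,
      sub_apply, smul_apply, diffAt_coord_zero he hp.1, smul_eq_mul]
  have hx₀b : coord e (ι x₀) 0 = 0 := by
    rw [← mem_boundary_iff he hxe, ← mem_preimage, hι.preimage_boundary]
    exact hb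
  have hℓ0 : ∀ x, ι x ∈ e.source → ℓ (coord e (ι x)) = 0 := fun x hx =>
    (h.ker_eq _).2 ⟨_, (h.coord_eq x ((h.mem_iff x).1 hx)).symm⟩
  have hx₀O₁ : ι x₀ ∈ O₁ := by
    refine ⟨hxe, ?_⟩
    have := coord_mem hxe
    rw [coordTarget_eq] at this
    rw [mem_preimage, mem_preimage, hPid _ hx₀b]
    exact this.2
  have hF0 : ∀ x, ι x ∈ O₁ → F (ι x) = 0 := fun x hx => by
    rw [hF]
    simp only
    rw [hf₀.eq_zero x (heO hx.1), hc0 _ (hPT _ hx) (hP0 _) (by rw [hℓP, hℓ0 x hx.1])]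
    simp
  have hFpos : 0 < diffAt F (ι x₀) (ν x₀) := by
    rw [hdF _ hx₀O₁ hx₀b, hc0 _ (coord_mem hxe) hx₀b (hℓ0 _ hxe), zero_mul, sub_zero]
    exact hf₀.pos _ hx₀
  obtain ⟨O, hO, hxO, hdef⟩ := hν.exists_isDefiningOn_of_pos hι hO₁o hFs hF0 hx₀O₁ hFpos
  refine ⟨O, F, hxO, hdef, fun p hp => ?_⟩
  have hpO := hO hp.2
  have hp0 := (mem_boundary_iff he hpO.1).1 hp.1
  refine ⟨by simp [hF, hp0], fun η hη => ?_⟩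
  obtain ⟨b, hbη⟩ := exists_coordDeriv_eq_smul_coordNormal he hpO.1 hp0 hη
  have hαη : diffAt f₀ p η = α (coord e p) (coordDeriv e p η) := by
    simp only [hα, ContinuousLinearMap.comp_apply]
    rw [coordSymmDeriv_coordDeriv he hpO.1, coordSymm_coord hpO.1]
  rw [hdF p hpO hp0, hαη, hbη, map_smul, hc]
  have := (coordNormal_zero_pos he g (coord_mem hpO.1)).ne'
  simp only [smul_eq_mul, PiLp.smul_apply]
  field_simp
  ring

/-- A defining function whose gradient is tangent to the boundary. -/
theorem exists_isDefiningOn_tangent [CompactSpace X] [T2Space M] [SecondCountableTopology M]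
    (hι : IsProperlyEmbedded (n := n) ι) (hν : IsUnitNormal g ι ν)
    (horth : MeetsBoundaryOrthogonally (n := n) g ι) :
    ∃ O f, range ι ⊆ O ∧ IsDefiningOn ι ν O f ∧
      ∀ p ∈ (𝓡∂ (n + 1)).boundary M ∩ O, ∀ η ∈ boundaryNormalSpace g p, diffAt f p η = 0 := by
  obtain ⟨O₀, f₀, hO₀, hf₀⟩ := hν.exists_isDefiningOn hι
  exact exists_isDefiningOn_of_local (isCompact_range hι.isSmoothEmbedding.2.continuous)
    fun x => hf₀.exists_local_tangent hι hν horth (hO₀ ⟨x, rfl⟩)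

end Adapted

/-! ### Charts adapted to the rescaled gradient -/

section FlowChart

variable {m : ℕ} [NeZero m] {M : Type*} [TopologicalSpace M]
  [ChartedSpace (EuclideanHalfSpace m) M] [IsManifold (𝓡∂ m) ∞ M]

/-- If the gradient of a function is tangent to the boundary, then the rescaled gradient is smooth
and tangent to the boundary in a chart around each noncritical point. -/
theorem exists_isFlowChart {g : Met m M} {f : M → ℝ} {O : Set M} (hO : IsOpen O)
    (hf : ContMDiffOn (𝓡∂ m) 𝓘(ℝ, ℝ) ∞ f O)
    (htan : ∀ p ∈ (𝓡∂ m).boundary M ∩ O, ∀ η ∈ boundaryNormalSpace g p, diffAt f p η = 0)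
    {p : M} (hp : p ∈ O) (hne : diffAt (m := m) f p ≠ 0) :
    ∃ e, IsFlowChart (unitRateField g f) e ∧ p ∈ e.source ∧ e.source ⊆ O ∧
      ∀ q ∈ e.source, diffAt (m := m) f q ≠ 0 := by
  set e₀ := (chartAt (EuclideanHalfSpace m) p).restr O with he₀
  have he₀M : e₀ ∈ IsManifold.maximalAtlas (𝓡∂ m) ∞ M :=
    restr_mem_maximalAtlas _ (IsManifold.chart_mem_maximalAtlas p) hO
  have hsrc : e₀.source = (chartAt (EuclideanHalfSpace m) p).source ∩ O :=
    OpenPartialHomeomorph.restr_source' _ _ hO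
  have hp₀ : p ∈ e₀.source := by
    rw [hsrc]; exact ⟨mem_chart_source _ p, hp⟩
  have hsO : e₀.source ⊆ O := by rw [hsrc]; exact inter_subset_right
  have hαs := contDiffOn_diffAt_coordSymm he₀M (hf.mono hsO)
  set α : Euc m → Euc m →L[ℝ] ℝ := fun y =>
    (diffAt f (coordSymm e₀ y)).comp (coordSymmDeriv e₀ y) with hα
  have hW : IsOpen (e₀.source ∩ (fun q => α (coord e₀ q)) ⁻¹' {0}ᶜ) :=
    (hαs.continuousOn.comp (contMDiffOn_coord he₀M).continuousOn
      fun q hq => coord_mem hq).isOpen_inter_preimage e₀.open_source isOpen_compl_singleton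
  set W := e₀.source ∩ (fun q => α (coord e₀ q)) ⁻¹' {0}ᶜ with hWdef
  have hWs : (e₀.restr W).source = W := by
    rw [e₀.restr_source' _ hW]
    exact inter_eq_right.2 inter_subset_left
  have heM : e₀.restr W ∈ IsManifold.maximalAtlas (𝓡∂ m) ∞ M :=
    restr_mem_maximalAtlas _ he₀M hW
  have hWne : ∀ q ∈ W, diffAt (m := m) f q ≠ 0 := fun q hq h => by
    refine hq.2 ?_
    simp only [hα, coordSymm_coord hq.1, h]
    exact ContinuousLinearMap.zero_comp _
  have hWO : W ⊆ O := inter_subset_left.trans hsO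
  refine ⟨e₀.restr W, ⟨heM, ?_, fun y hy hy0 => ?_⟩, ?_, by rwa [hWs], by rwa [hWs]⟩
  · exact contDiffOn_coordField_unitRateField heM g (hf.mono (by rwa [hWs])) (by rwa [hWs])
  · set e := e₀.restr W
    have hq := coordSymm_mem hy
    have hqb : coordSymm e y ∈ (𝓡∂ m).boundary M := by
      rw [mem_boundary_iff heM hq, coord_coordSymm hy, hy0]
    have hη := coordSymmDeriv_coordNormal_mem heM g hy hy0
    have h1 := htan _ ⟨hqb, hWO (by rwa [hWs] at hq)⟩ _ hη
    -- The first component of the gradient is its product with the boundary normal, that is, the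
    -- derivative of `f` along that normal, which vanishes.
    have h2 := metricCoord_coordNormal heM g hy
      (coordDeriv e (coordSymm e y) (grad g f (coordSymm e y)))
    have h3 := coordSymmDeriv_coordDeriv heM hq (grad g f (coordSymm e y))
    rw [coord_coordSymm hy] at h3
    rw [metricCoord_apply, h3, metricAt_symm, metricAt_grad, h1] at h2
    rw [coordField, unitRateField, map_smul, PiLp.smul_apply, ← h2, smul_zero]
  · rw [hWs]
    refine ⟨hp₀, fun h => hne ?_⟩
    ext v
    have := DFunLike.congr_fun h (coordDeriv e₀ p v)
    simp only [hα, coordSymm_coord hp₀, ContinuousLinearMap.comp_apply] at this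
    rwa [coordSymmDeriv_coordDeriv he₀M hp₀] at this

end FlowChart

/-! ### The zero set of a defining function near the hypersurface -/

section ZeroSet

variable {n : ℕ} [NeZero n]
  {X : Type*} [TopologicalSpace X] [ChartedSpace (EuclideanHalfSpace n) X]
  [IsManifold (𝓡∂ n) ∞ X]
  {M : Type*} [TopologicalSpace M] [ChartedSpace (EuclideanHalfSpace (n + 1)) M]
  [IsManifold (𝓡∂ (n + 1)) ∞ M]
  {g : Met (n + 1) M} {ι : X → M} {ν : X → Euc (n + 1)}

/-- A function on a convex set whose derivative in some direction does not vanish is injective on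
lines in that direction. -/
theorem eq_zero_of_apply_add_smul_eq {E : Type*} [NormedAddCommGroup E] [NormedSpace ℝ E]
    {s : Set E} (hs : Convex ℝ s) {φ : E → ℝ} {φ' : E → E →L[ℝ] ℝ} {ξ w : E} {c : ℝ}
    (hφ : ∀ y ∈ s, HasFDerivWithinAt φ (φ' y) s y) (hne : ∀ y ∈ s, φ' y ξ ≠ 0)
    (hw : w ∈ s) (hz : w + c • ξ ∈ s) (heq : φ w = φ (w + c • ξ)) : c = 0 := by
  by_contra hc
  set l : ℝ → E := fun t => w + t • (c • ξ) with hl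
  have hmem : ∀ t ∈ Icc (0 : ℝ) 1, l t ∈ s := fun t ht => by
    have := hs.add_smul_sub_mem hw hz ht
    simpa [hl] using this
  have hd : ∀ t ∈ Icc (0 : ℝ) 1, HasDerivWithinAt (φ ∘ l) (φ' (l t) (c • ξ)) (Icc 0 1) t :=
    fun t ht => by
    have h1 : HasDerivAt l (c • ξ) t := by
      have := ((hasDerivAt_id t).smul_const (c • ξ)).const_add w
      rw [one_smul] at this
      exact this
    exact (hφ _ (hmem t ht)).comp_hasDerivWithinAt t h1.hasDerivWithinAt hmem
  obtain ⟨t, ht, h0⟩ := exists_hasDerivAt_eq_zero (f := φ ∘ l) (f' := fun t => φ' (l t) (c • ξ))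
    zero_lt_one (fun t ht => (hd t ht).continuousWithinAt) (by simpa [hl] using heq)
    fun t ht => (hd t (Ioo_subset_Icc_self ht)).hasDerivAt (Icc_mem_nhds ht.1 ht.2)
  simp only [map_smul, smul_eq_mul, mul_eq_zero, hc, false_or] at h0
  exact hne _ (hmem t (Ioo_subset_Icc_self ht)) h0

/-- Near the hypersurface, a defining function vanishes on the hypersurface only. -/
theorem IsDefiningOn.exists_zero_subset (hι : IsProperlyEmbedded (n := n) ι)
    (hν : IsUnitNormal g ι ν) {O : Set M} {f : M → ℝ} (hf : IsDefiningOn ι ν O f)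
    (hO : range ι ⊆ O) :
    ∃ B ⊆ O, IsOpen B ∧ range ι ⊆ B ∧ ∀ p ∈ B, f p = 0 → p ∈ range ι := by
  suffices h : ∀ x, ∃ B ⊆ O, IsOpen B ∧ ι x ∈ B ∧ ∀ p ∈ B, f p = 0 → p ∈ range ι by
    choose B hBO hB hxB hB0 using h
    refine ⟨⋃ x, B x, iUnion_subset hBO, isOpen_iUnion hB, ?_, fun p hp => ?_⟩
    · rintro _ ⟨x, rfl⟩
      exact mem_iUnion.2 ⟨x, hxB x⟩
    · obtain ⟨x, hx⟩ := mem_iUnion.1 hp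
      exact hB0 x p hx
  intro x
  obtain ⟨e, d, L, ℓ, h, heO, hxe, hζ⟩ := hι.exists_isSliceChart x hf.isOpen (hO ⟨x, rfl⟩)
  have he := h.mem_maximalAtlas
  have hxd := (h.mem_iff x).1 hxe
  have hy := coord_mem hxe
  have hfe := hf.contMDiffOn.mono heO
  -- A direction transverse to the slice. At a boundary point it is made tangent to the boundary by
  -- subtracting a multiple of ζ, so that sliding along it stays in the half-space.
  obtain ⟨ξ, hξ, hξ0⟩ : ∃ ξ : Euc (n + 1), ℓ ξ = 1 ∧ (ξ 0 = 0 ∨ 0 < coord e (ι x) 0) := by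
    have hne := hν.slice_ne_zero hι h hxd
    obtain ⟨ξ, hξ⟩ : ∃ ξ, ℓ ξ = 1 := ⟨(ℓ (coordDeriv e (ι x) (ν x)))⁻¹ • coordDeriv e (ι x) (ν x),
      by rw [map_smul, smul_eq_mul, inv_mul_cancel₀ hne]⟩
    by_cases hb : x ∈ (𝓡∂ n).boundary X
    · obtain ⟨ζ, hζ0, hℓζ⟩ := hζ hb
      exact ⟨ξ - ξ 0 • ζ, by simp [hξ, hℓζ], Or.inl (by simp [hζ0])⟩
    · rw [← hι.preimage_boundary, mem_preimage, mem_boundary_iff he hxe] at hb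
      exact ⟨ξ, hξ, Or.inr (lt_of_le_of_ne (mem_halfSpace.1 (coordTarget_subset hy))
        (Ne.symm hb))⟩
  set α : Euc (n + 1) → Euc (n + 1) →L[ℝ] ℝ := fun y =>
    (diffAt f (coordSymm e y)).comp (coordSymmDeriv e y) with hα
  have hαs : ContinuousOn (fun y => α y ξ) (coordTarget e) :=
    (contDiffOn_diffAt_coordSymm he hfe).continuousOn.clm_apply continuousOn_const
  have hα0 : α (coord e (ι x)) ξ ≠ 0 := fun h0 => by
    simp only [hα, ContinuousLinearMap.comp_apply, coordSymm_coord hxe] at h0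
    rw [hf.diffAt_eq hι hν (heO hxe)] at h0
    have h1 := (mul_eq_zero.1 h0).resolve_right (hf.pos x (heO hxe)).ne'
    obtain ⟨w, hw⟩ := hν.exists_eq hι x (coordSymmDeriv e (coord e (ι x)) ξ)
    rw [h1, zero_smul, zero_add] at hw
    have h2 := coordDeriv_coordSymmDeriv he hy ξ
    rw [coordSymm_coord hxe, hw, h.coordDeriv_mapDeriv hxd (hι.mdifferentiableAt x)] at h2
    rw [← h2, (h.ker_eq _).2 ⟨_, rfl⟩] at hξ
    exact zero_ne_one hξ
  have hnhds : {y ∈ coordTarget e | α y ξ ≠ 0} ∈ 𝓝[halfSpace (n + 1)] coord e (ι x) := by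
    have h1 : 𝓝[halfSpace (n + 1)] coord e (ι x) = 𝓝[coordTarget e] coord e (ι x) :=
      le_antisymm (nhdsWithin_le_iff.2 (coordTarget_mem_nhdsWithin hy))
        (nhdsWithin_mono _ coordTarget_subset)
    rw [h1]
    exact inter_mem self_mem_nhdsWithin
      ((hαs _ hy).eventually (isOpen_ne.mem_nhds hα0))
  obtain ⟨r, hr, hrs⟩ : ∃ r > 0, ball (coord e (ι x)) r ∩ halfSpace (n + 1) ⊆
      {y ∈ coordTarget e | α y ξ ≠ 0} ∧
      (0 < coord e (ι x) 0 → ball (coord e (ι x)) r ⊆ halfSpace (n + 1)) := by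
    obtain ⟨r₁, hr₁, h1⟩ := Metric.mem_nhdsWithin_iff.1 hnhds
    by_cases hpos : 0 < coord e (ι x) 0
    · obtain ⟨r₂, hr₂, h2⟩ := Metric.mem_nhds_iff.1 (halfSpace_mem_nhds hpos)
      exact ⟨min r₁ r₂, lt_min hr₁ hr₂, (inter_subset_inter_left _
        (ball_subset_ball (min_le_left _ _))).trans h1,
        fun _ => (ball_subset_ball (min_le_right _ _)).trans h2⟩
    · exact ⟨r₁, hr₁, h1, fun h => absurd h hpos⟩
  obtain ⟨hrs, hrS⟩ := hrs
  have hprc : Continuous fun z : Euc (n + 1) => z - ℓ z • ξ := by fun_prop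
  have hℓ0 : ℓ (coord e (ι x)) = 0 := (h.ker_eq _).2 ⟨_, (h.coord_eq x hxd).symm⟩
  refine ⟨e.source ∩ coord e ⁻¹' (ball (coord e (ι x)) r ∩
      (fun z => z - ℓ z • ξ) ⁻¹' ball (coord e (ι x)) r), inter_subset_left.trans heO,
    (contMDiffOn_coord he).continuousOn.isOpen_inter_preimage e.open_source
      (isOpen_ball.inter (isOpen_ball.preimage hprc)), ⟨hxe, mem_ball_self hr, ?_⟩, ?_⟩
  · rw [mem_preimage, hℓ0, zero_smul, sub_zero]
    exact mem_ball_self hr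
  · rintro p ⟨hpe, hp1, hp2⟩ hp0
    rw [mem_preimage] at hp2
    have hzS := coordTarget_subset (coord_mem hpe)
    set z := coord e p with hz
    have hwS : z - ℓ z • ξ ∈ halfSpace (n + 1) := by
      rcases hξ0 with h0 | h0
      · rw [mem_halfSpace] at hzS ⊢
        simpa [h0] using hzS
      · exact hrS h0 hp2
    have hwT := (hrs ⟨hp2, hwS⟩).1
    have hℓw : ℓ (z - ℓ z • ξ) = 0 := by simp [hξ]
    obtain ⟨x', hx'⟩ := h.mem_range _ (coordSymm_mem hwT) (by rwa [coord_coordSymm hwT])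
    have hfw : f (coordSymm e (z - ℓ z • ξ)) = 0 := by
      rw [← hx']
      exact hf.eq_zero x' (by rw [hx']; exact heO (coordSymm_mem hwT))
    -- Slide `z` along ξ to the slice, where f = 0. As f also vanishes at `z` and its ξ-derivative
    -- has no zero in between, Rolle forces ℓ z = 0.
    refine h.mem_range p hpe (eq_zero_of_apply_add_smul_eq (φ := f ∘ coordSymm e) (φ' := α) (ξ := ξ)
      (w := z - ℓ z • ξ) ((convex_ball (coord e (ι x)) r).inter convex_halfSpace)
      (fun y hy => ?_) (fun y hy => (hrs hy).2) ⟨hp2, hwS⟩ ?_ ?_)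
    · have hyT := (hrs hy).1
      exact (hasFDerivWithinAt_comp_coordSymm he hyT ((hfe.contMDiffAt
        (e.open_source.mem_nhds (coordSymm_mem hyT))).mdifferentiableAt (by simp))).mono
        fun z hz => (hrs hz).1
    · rw [sub_add_cancel]
      exact ⟨hp1, hzS⟩
    · rw [sub_add_cancel, comp_apply, comp_apply, hfw, hz, coordSymm_coord hpe, hp0]

end ZeroSet

/-! ### The flow as a collar of the hypersurface -/

/-- The inclusion of an interval has derivative one. -/
theorem hasMFDerivAt_interval_val {δ : ℝ} (t : interval δ) :
    HasMFDerivAt 𝓘(ℝ, ℝ) 𝓘(ℝ, ℝ) (Subtype.val : interval δ → ℝ) t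
      (ContinuousLinearMap.id ℝ ℝ) := by
  refine ⟨continuous_subtype_val.continuousAt, ?_⟩
  have h := TopologicalSpace.Opens.chartAt_subtype_val_symm_eventuallyEq (H := ℝ) (interval δ)
    (x := t)
  refine HasFDerivAt.hasFDerivWithinAt ((hasFDerivAt_id _).congr_of_eventuallyEq ?_)
  exact h.symm

section Flow

variable {m : ℕ} [NeZero m] {M : Type*} [TopologicalSpace M]
  [ChartedSpace (EuclideanHalfSpace m) M] [IsManifold (𝓡∂ m) ∞ M]

theorem IsFlowLineAt.const_add {V : M → Euc m} {γ : ℝ → M} {s t : ℝ}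
    (h : IsFlowLineAt V γ (s + t)) : IsFlowLineAt V (fun τ => γ (s + τ)) t := by
  have h1 : HasMFDerivAt 𝓘(ℝ, ℝ) 𝓘(ℝ, ℝ) (fun τ => s + τ) t (ContinuousLinearMap.id ℝ ℝ) :=
    hasMFDerivAt_iff_hasFDerivAt.2 ((hasFDerivAt_id t).const_add s)
  exact (HasMFDerivAt.comp t h h1).congr_mfderiv (ContinuousLinearMap.comp_id _)

/-- A function which grows at unit rate along a vector field is affine along its flow lines. -/
theorem apply_flowLine_eq {V : M → Euc m} {γ : ℝ → M} {f : M → ℝ} {ε : ℝ}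
    (hγ : ∀ t ∈ Ioo (-ε) ε, IsFlowLineAt V γ t)
    (hf : ∀ t ∈ Ioo (-ε) ε, MDifferentiableAt (𝓡∂ m) 𝓘(ℝ, ℝ) f (γ t) ∧ diffAt f (γ t) (V (γ t)) = 1)
    {t : ℝ} (ht : t ∈ Ioo (-ε) ε) : f (γ t) = f (γ 0) + t := by
  have hd : ∀ t ∈ Ioo (-ε) ε, HasDerivAt (fun t => f (γ t) - t) 0 t := fun t ht => by
    have h1 := (hγ t ht).hasDerivAt_comp (hf t ht).1
    rw [(hf t ht).2] at h1
    have h2 := h1.sub (hasDerivAt_id t)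
    rw [sub_self] at h2
    exact h2
  have hε : 0 < ε := by linarith [ht.1, ht.2]
  have := isOpen_Ioo.is_const_of_deriv_eq_zero isPreconnected_Ioo
    (fun t ht => (hd t ht).differentiableAt.differentiableWithinAt) (fun t ht => (hd t ht).deriv)
    ht (y := 0) (by simp [hε])
  simp only [sub_zero] at this
  linarith

/-- The flow property. -/
theorem flow_flow [T2Space M] {V : M → Euc m} {O : Set M} {ε : ℝ} {θ : M → ℝ → M}
    (hθ : ∀ p ∈ O, θ p 0 = p ∧ ∀ t ∈ Ioo (-ε) ε, IsFlowLineAt V (θ p) t ∧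
      ∃ e, IsFlowChart V e ∧ θ p t ∈ e.source) {p : M} {s t : ℝ} (hp : p ∈ O)
    (hs : s ∈ Ioo (-ε) ε) (hq : θ p s ∈ O) (ht : t ∈ Ioo (-ε) ε) (hst : s + t ∈ Ioo (-ε) ε) :
    θ (θ p s) t = θ p (s + t) := by
  have hε : 0 < ε := by linarith [ht.1, ht.2]
  -- The interval consists of the τ for which both τ and s + τ lie in (-ε, ε).
  refine eqOn_Ioo_of_isFlowLineAt (V := V) (γ := θ (θ p s)) (γ' := fun τ => θ p (s + τ))
    (a := max (-ε) (-ε - s)) (b := min ε (ε - s)) (t₀ := 0) ?_ (fun τ hτ => ?_)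
    (fun τ hτ => ?_) ?_ ?_
  · exact ⟨max_lt (by linarith) (by linarith [hs.1]), lt_min hε (by linarith [hs.2])⟩
  · exact (hθ _ hq).2 τ ⟨(le_max_left _ _).trans_lt hτ.1, hτ.2.trans_le (min_le_left _ _)⟩
  · refine ((hθ _ hp).2 (s + τ) ⟨?_, ?_⟩).1.const_add
    · linarith [(le_max_right (-ε) (-ε - s)).trans_lt hτ.1]
    · linarith [hτ.2.trans_le (min_le_right ε (ε - s))]
  · rw [(hθ _ hq).1, add_zero]
  · exact ⟨max_lt ht.1 (by linarith [hst.1]), lt_min ht.2 (by linarith [hst.2])⟩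

end Flow

section Collar

variable {n : ℕ} [NeZero n]
  {X : Type*} [TopologicalSpace X] [ChartedSpace (EuclideanHalfSpace n) X]
  [IsManifold (𝓡∂ n) ∞ X]
  {M : Type*} [TopologicalSpace M] [ChartedSpace (EuclideanHalfSpace (n + 1)) M]
  [IsManifold (𝓡∂ (n + 1)) ∞ M]

/-- The differential of a map on a product with an interval, as a linear map of the model
spaces. -/
def prodDeriv {δ : ℝ} (F : X × interval δ → M) (q : X × interval δ) :
    (Euc n × ℝ) →L[ℝ] Euc (n + 1) :=
  mfderiv ((𝓡∂ n).prod 𝓘(ℝ, ℝ)) (𝓡∂ (n + 1)) F q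

theorem prodDeriv_snd {δ : ℝ} {F : X × interval δ → M} {x : X} {t : interval δ}
    (hF : MDifferentiableAt ((𝓡∂ n).prod 𝓘(ℝ, ℝ)) (𝓡∂ (n + 1)) F (x, t)) {V : M → Euc (n + 1)}
    {γ : ℝ → M} (hγ : IsFlowLineAt V γ t) (hFγ : ∀ s : interval δ, F (x, s) = γ s) :
    prodDeriv F (x, t) (0, 1) = V (F (x, t)) := by
  have h0 : HasMFDerivAt ((𝓡∂ n).prod 𝓘(ℝ, ℝ)) (𝓡∂ (n + 1)) F (x, t) (prodDeriv F (x, t)) :=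
    hF.hasMFDerivAt
  have h1 : HasMFDerivAt 𝓘(ℝ, ℝ) ((𝓡∂ n).prod 𝓘(ℝ, ℝ)) (fun s : interval δ => (x, s)) t
      ((0 : ℝ →L[ℝ] Euc n).prod (ContinuousLinearMap.id ℝ ℝ)) :=
    (hasMFDerivAt_const x t).prodMk (hasMFDerivAt_id t)
  have h2 : HasMFDerivAt 𝓘(ℝ, ℝ) (𝓡∂ (n + 1)) (fun s : interval δ => F (x, s)) t
      ((prodDeriv F (x, t)).comp
        ((0 : ℝ →L[ℝ] Euc n).prod (ContinuousLinearMap.id ℝ ℝ))) := h0.comp t h1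
  have h3 : HasMFDerivAt 𝓘(ℝ, ℝ) (𝓡∂ (n + 1)) (fun s : interval δ => γ s) t
      ((ContinuousLinearMap.toSpanSingleton ℝ (V (γ t))).comp (ContinuousLinearMap.id ℝ ℝ)) :=
    HasMFDerivAt.comp t hγ (hasMFDerivAt_interval_val t)
  have h4 : (prodDeriv F (x, t)).comp
        ((0 : ℝ →L[ℝ] Euc n).prod (ContinuousLinearMap.id ℝ ℝ)) =
      (ContinuousLinearMap.toSpanSingleton ℝ (V (γ t))).comp (ContinuousLinearMap.id ℝ ℝ) :=
    hasMFDerivAt_unique h2 (h3.congr_of_eventuallyEq (Eventually.of_forall hFγ))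
  have h5 := DFunLike.congr_fun h4 (1 : ℝ)
  rw [hFγ t]
  simpa using h5

/-- The flow of a vector field starting from a hypersurface parametrizes a neighbourhood of the
hypersurface. -/
theorem exists_collar [CompactSpace X] [T2Space M] {ι : X → M}
    (hι : IsProperlyEmbedded (n := n) ι) {V : M → Euc (n + 1)} {W B : Set M} {f : M → ℝ}
    (hW : IsOpen W) (hf : ContMDiffOn (𝓡∂ (n + 1)) 𝓘(ℝ, ℝ) ∞ f W)
    (hfV : ∀ p ∈ W, diffAt f p (V p) = 1) (hfι : ∀ x, f (ι x) = 0)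
    (hV : ∀ p ∈ range ι, ∃ e, IsFlowChart V e ∧ p ∈ e.source ∧ e.source ⊆ W)
    (hB : IsOpen B) (hιB : range ι ⊆ B) (hfB : ∀ p ∈ B, f p = 0 → p ∈ range ι) :
    ∃ δ > 0, ∃ (U : TopologicalSpace.Opens M)
      (Φ : Diffeomorph ((𝓡∂ n).prod 𝓘(ℝ, ℝ)) (𝓡∂ (n + 1)) (X × interval δ) U ∞) (r : M → M),
      range ι ⊆ (U : Set M) ∧
      (∀ (x : X) (t : interval δ), (t : ℝ) = 0 → (Φ (x, t) : M) = ι x) ∧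
      (∀ q, (Φ q : M) ∈ W ∧ f (Φ q) = q.2 ∧ r (Φ q) = ι q.1 ∧
        prodDeriv (fun q => (Φ q : M)) q (0, 1) = V (Φ q)) ∧
      ContMDiffOn (𝓡∂ (n + 1)) (𝓡∂ (n + 1)) ∞ r U := by
  have hemb := hι.isSmoothEmbedding.2
  have hC : IsCompact (range ι) := isCompact_range hemb.continuous
  obtain ⟨ε, hε, O, hO, hCO, θ, hθ, hθs⟩ := exists_flow_near_compact hC hV
  have hθ0 : ∀ p ∈ O, θ p 0 = p := fun p hp => (hθ p hp).1
  have h0ε : (0 : ℝ) ∈ Ioo (-ε) ε := ⟨neg_lt_zero.2 hε, hε⟩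
  have hOW : O ⊆ W := fun p hp => by
    have := ((hθ p hp).2 0 h0ε).2.1
    rwa [hθ0 p hp] at this
  have hfθ : ∀ p ∈ O, ∀ t ∈ Ioo (-ε) ε, f (θ p t) = f p + t := fun p hp t ht => by
    have := apply_flowLine_eq (γ := θ p) (f := f) (fun t ht => ((hθ p hp).2 t ht).1)
      (fun t ht => ⟨(hf.contMDiffAt (hW.mem_nhds ((hθ p hp).2 t ht).2.1)).mdifferentiableAt
        (by simp), hfV _ ((hθ p hp).2 t ht).2.1⟩) ht
    rwa [hθ0 p hp] at this
  have hθθ : ∀ {p : M} {s t : ℝ}, p ∈ O → s ∈ Ioo (-ε) ε → θ p s ∈ O → t ∈ Ioo (-ε) ε →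
      s + t ∈ Ioo (-ε) ε → θ (θ p s) t = θ p (s + t) := fun hp hs hq ht hst =>
    flow_flow (fun p hp => ⟨(hθ p hp).1, fun t ht =>
      ⟨((hθ p hp).2 t ht).1, ((hθ p hp).2 t ht).2.2⟩⟩) hp hs hq ht hst
  have hθc := hθs.continuousOn
  -- By compactness, flow lines from X remain for a uniform time in the set where the flow can be
  -- restarted, as the backward flow requires.
  obtain ⟨δ, hδ, hδε, hδO⟩ : ∃ δ > 0, δ ≤ ε ∧ ∀ x, ∀ t ∈ Ioo (-δ) δ, θ (ι x) t ∈ O := by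
    have hopen := hθc.isOpen_inter_preimage (hO.prod isOpen_Ioo) hO
    obtain ⟨u, v, hu, hv, hCu, h0v, huv⟩ := generalized_tube_lemma hC
      (isCompact_singleton (x := (0 : ℝ))) hopen (by
        rintro ⟨p, t⟩ ⟨hp, rfl⟩
        refine ⟨⟨hCO hp, h0ε⟩, ?_⟩
        rw [mem_preimage, hθ0 p (hCO hp)]
        exact hCO hp)
    obtain ⟨r, hr, hrv⟩ := Metric.isOpen_iff.1 hv 0 (h0v rfl)
    refine ⟨min r ε, lt_min hr hε, min_le_right _ _, fun x t ht => ?_⟩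
    refine (huv (mk_mem_prod (hCu ⟨x, rfl⟩) (hrv ?_))).2
    rw [Real.ball_eq_Ioo, zero_sub, zero_add]
    exact Ioo_subset_Ioo (neg_le_neg (min_le_left _ _)) (min_le_left _ _) ht
  have hIoo : Ioo (-δ) δ ⊆ Ioo (-ε) ε := Ioo_subset_Ioo (neg_le_neg hδε) hδε
  have hιO : ∀ x, ι x ∈ O := fun x => hCO ⟨x, rfl⟩
  have hfc : ContinuousOn f O := hf.continuousOn.mono hOW
  have hO₁ : IsOpen (O ∩ f ⁻¹' Ioo (-δ) δ) := hfc.isOpen_inter_preimage hO isOpen_Ioo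
  have hrs : ContMDiffOn (𝓡∂ (n + 1)) (𝓡∂ (n + 1)) ∞ (fun q => θ q (-(f q)))
      (O ∩ f ⁻¹' Ioo (-δ) δ) := by
    refine hθs.comp (contMDiffOn_id.prodMk (hf.mono (inter_subset_left.trans hOW)).neg)
      fun q hq => ⟨hq.1, hIoo ⟨neg_lt_neg hq.2.2, ?_⟩⟩
    have := neg_lt_neg hq.2.1
    rwa [neg_neg] at this
  -- Points whose backward flow for time f(q) is defined and lands in `B`, hence on X, and in `O`,
  -- so that the flow can return to q.
  set U : TopologicalSpace.Opens M := ⟨(O ∩ f ⁻¹' Ioo (-δ) δ) ∩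
    (fun q => θ q (-(f q))) ⁻¹' (B ∩ O), hrs.continuousOn.isOpen_inter_preimage hO₁ (hB.inter hO)⟩
    with hU
  have hneg : ∀ q ∈ U, -(f q) ∈ Ioo (-ε) ε := fun q hq => hIoo (by
    have h1 := hq.1.2
    rw [mem_preimage] at h1
    exact ⟨by linarith [h1.2], by linarith [h1.1]⟩)
  have hrange : ∀ q ∈ U, θ q (-(f q)) ∈ range ι := fun q hq => by
    refine hfB _ hq.2.1 ?_
    rw [hfθ q hq.1.1 _ (hneg q hq), add_neg_cancel]
  have hfΦ : ∀ x, ∀ t ∈ Ioo (-δ) δ, f (θ (ι x) t) = t := fun x t ht => by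
    rw [hfθ _ (hιO x) _ (hIoo ht), hfι, zero_add]
  have hrΦ : ∀ x, ∀ t ∈ Ioo (-δ) δ, θ (θ (ι x) t) (-(f (θ (ι x) t))) = ι x := fun x t ht => by
    have ht' : -t ∈ Ioo (-ε) ε := hIoo ⟨by linarith [ht.2], by linarith [ht.1]⟩
    rw [hfΦ x t ht, hθθ (hιO x) (hIoo ht) (hδO x t ht) ht' (by simpa using hε), add_neg_cancel,
      hθ0 _ (hιO x)]
  have hΦU : ∀ x, ∀ t ∈ Ioo (-δ) δ, θ (ι x) t ∈ U := fun x t ht => by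
    refine ⟨⟨hδO x t ht, ?_⟩, ?_⟩
    · rw [mem_preimage, hfΦ x t ht]
      exact ht
    · rw [mem_preimage, hrΦ x t ht]
      exact ⟨hιB ⟨x, rfl⟩, hιO x⟩
  have hinj : Injective ι := hemb.injective
  set ρ : U → X := fun q => (hrange q q.2).choose with hρ
  have hιρ : ∀ q : U, ι (ρ q) = θ q (-(f q)) := fun q => (hrange q q.2).choose_spec
  have hΦs : ContMDiff ((𝓡∂ n).prod 𝓘(ℝ, ℝ)) (𝓡∂ (n + 1)) ∞
      (fun q : X × interval δ => θ (ι q.1) q.2) := by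
    rw [← contMDiffOn_univ]
    refine hθs.comp ((hι.isSmoothEmbedding.contMDiff.comp contMDiff_fst).prodMk
      (contMDiff_subtype_val.comp contMDiff_snd)).contMDiffOn
      fun q _ => ⟨hιO q.1, hIoo q.2.2⟩
  -- `ρ` is defined by choice; its smoothness follows from that of ι ∘ ρ, since ι is a smooth
  -- immersion and a topological embedding.
  have hρs : ContMDiff (𝓡∂ (n + 1)) (𝓡∂ n) ∞ ρ := by
    have h1 : ContMDiff (𝓡∂ (n + 1)) (𝓡∂ (n + 1)) ∞ (ι ∘ ρ) := by
      rw [show ι ∘ ρ = (fun q => θ q (-(f q))) ∘ (Subtype.val : U → M) from funext hιρ]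
      rw [← contMDiffOn_univ]
      exact hrs.comp contMDiff_subtype_val.contMDiffOn fun q _ => q.2.1
    exact (ContMDiff.iff_comp_isImmersion hι.isSmoothEmbedding.1).2
      ⟨hemb.isInducing.continuous_iff.2 h1.continuous, h1⟩
  let Φ : Diffeomorph ((𝓡∂ n).prod 𝓘(ℝ, ℝ)) (𝓡∂ (n + 1)) (X × interval δ) U ∞ :=
    { toFun := fun q => ⟨θ (ι q.1) q.2, hΦU q.1 q.2 q.2.2⟩
      invFun := fun q => (ρ q, ⟨f q, q.2.1.2⟩)
      left_inv := fun q => by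
        refine Prod.ext (hinj ?_) (Subtype.ext (hfΦ q.1 q.2 q.2.2))
        rw [hιρ]
        exact hrΦ q.1 q.2 q.2.2
      right_inv := fun q => by
        refine Subtype.ext ?_
        change θ (ι (ρ q)) (f q) = q
        have hq := q.2
        have hfq : f q ∈ Ioo (-ε) ε := hIoo hq.1.2
        rw [hιρ, hθθ hq.1.1 (hneg _ hq) hq.2.2 hfq (by simpa using hε), neg_add_cancel,
          hθ0 _ hq.1.1]
      contMDiff_toFun := (ContMDiff.subtypeVal_comp_iff U _).1 hΦs
      contMDiff_invFun := by
        refine hρs.prodMk ((ContMDiff.subtypeVal_comp_iff (interval δ) _).1 ?_)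
        rw [← contMDiffOn_univ]
        exact (hf.mono hOW).comp contMDiff_subtype_val.contMDiffOn fun q _ => q.2.1.1 }
  refine ⟨δ, hδ, U, Φ, fun q => θ q (-(f q)), ?_, fun x t ht => ?_, fun q => ⟨?_, ?_, ?_, ?_⟩,
    hrs.mono inter_subset_left⟩
  · rintro _ ⟨x, rfl⟩
    have := hΦU x 0 ⟨neg_lt_zero.2 hδ, hδ⟩
    rwa [hθ0 _ (hιO x)] at this
  · change θ (ι x) t = ι x
    rw [ht, hθ0 _ (hιO x)]
  · exact hOW (hδO q.1 q.2 q.2.2)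
  · exact hfΦ q.1 q.2 q.2.2
  · exact hrΦ q.1 q.2 q.2.2
  · exact prodDeriv_snd (hΦs.mdifferentiableAt (by simp))
      ((hθ _ (hιO q.1)).2 _ (hIoo q.2.2)).1 fun _ => rfl

end Collar

/-! ### The induced metrics on the slices and the norm of the gradient -/

section Tensor

/-- The form is bounded below by a positive constant on the compact unit sphere. This supplies the
boundedness of unit balls that is part of the data of a Riemannian metric. -/
theorem isBounded_setOf_apply_lt_one {E : Type*} [NormedAddCommGroup E] [NormedSpace ℝ E]
    [FiniteDimensional ℝ E] {G : E →L[ℝ] E →L[ℝ] ℝ} (hG : ∀ v, v ≠ 0 → 0 < G v v) :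
    Bornology.IsBounded {v | G v v < 1} := by
  have hc : Continuous fun v => G v v := by fun_prop
  obtain ⟨c, hc0, hc⟩ := (isCompact_sphere (0 : E) 1).exists_forall_le' hc.continuousOn (a := 0)
    fun v hv => hG v (ne_zero_of_mem_unit_sphere ⟨v, hv⟩)
  refine (isBounded_iff_forall_norm_le).2 ⟨√(1 / c), fun v hv => ?_⟩
  refine Real.le_sqrt_of_sq_le ?_
  rw [le_div_iff₀ hc0]
  rcases eq_or_ne v 0 with rfl | hv0
  · simp
  have hn : 0 < ‖v‖ := norm_pos_iff.2 hv0
  have h1 := hc (‖v‖⁻¹ • v) (by simp [norm_smul, hn.ne'])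
  rw [map_smul, map_smul, smul_apply, smul_eq_mul, smul_eq_mul] at h1
  have h2 : G v v = ‖v‖ ^ 2 * (‖v‖⁻¹ * (‖v‖⁻¹ * G v v)) := by field_simp
  have h3 : G v v < 1 := hv
  nlinarith [mul_le_mul_of_nonneg_left h1 (sq_nonneg ‖v‖)]

/-- A family of linear maps on Euclidean space is smooth if its values on fixed vectors are. -/
theorem contMDiffAt_clm_of_apply {k : ℕ} {F : Type*} [NormedAddCommGroup F] [NormedSpace ℝ F]
    {EN HN N : Type*} [NormedAddCommGroup EN] [NormedSpace ℝ EN] [TopologicalSpace HN]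
    {J : ModelWithCorners ℝ EN HN} [TopologicalSpace N] [ChartedSpace HN N]
    {A : N → Euc k →L[ℝ] F} {q : N}
    (h : ∀ v, ContMDiffAt J 𝓘(ℝ, F) ∞ (fun z => A z v) q) :
    ContMDiffAt J 𝓘(ℝ, Euc k →L[ℝ] F) ∞ A q := by
  have hA : A = fun z => ∑ i, ContinuousLinearMap.smulRightL ℝ (Euc k) F (EuclideanSpace.proj i)
      (A z (EuclideanSpace.single i 1)) := by
    funext z
    ext v
    conv_lhs => rw [← (EuclideanSpace.basisFun (Fin k) ℝ).sum_repr v]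
    simp
  rw [hA]
  exact contMDiffAt_finsetSum fun i _ =>
    (ContinuousLinearMap.contMDiff _).contMDiffAt.comp q (h _)

end Tensor

section Pullback

variable {n : ℕ} [NeZero n]
  {X : Type*} [TopologicalSpace X] [ChartedSpace (EuclideanHalfSpace n) X]
  [IsManifold (𝓡∂ n) ∞ X]
  {M : Type*} [TopologicalSpace M] [ChartedSpace (EuclideanHalfSpace (n + 1)) M]
  [IsManifold (𝓡∂ (n + 1)) ∞ M]
  {δ : ℝ}

/-- The differential of a map on a product with an interval along the first factor. -/
def sliceDeriv (F : X × interval δ → M) (q : X × interval δ) : Euc n →L[ℝ] Euc (n + 1) :=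
  (prodDeriv F q).comp (ContinuousLinearMap.inl ℝ (Euc n) ℝ)

/-- The metric induced on the slices of a product with an interval. -/
def sliceTensor (g : Met (n + 1) M) (F : X × interval δ → M) (q : X × interval δ) :
    Euc n →L[ℝ] Euc n →L[ℝ] ℝ :=
  (metricAt g (F q)).bilinearComp (sliceDeriv F q) (sliceDeriv F q)

theorem sliceTensor_apply (g : Met (n + 1) M) (F : X × interval δ → M) (q : X × interval δ)
    (v w : Euc n) :
    sliceTensor g F q v w = metricAt g (F q) (sliceDeriv F q v) (sliceDeriv F q w) := rfl

/-- The pushforward of a smooth section tangent to the slices is smooth. -/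
theorem contMDiffAt_sliceDeriv {F : X × interval δ → M}
    (hF : ContMDiff ((𝓡∂ n).prod 𝓘(ℝ, ℝ)) (𝓡∂ (n + 1)) ∞ F) {σ : X → Euc n}
    {q : X × interval δ}
    (hσ : ContMDiffAt (𝓡∂ n) (𝓡∂ n).tangent ∞ (fun x => (⟨x, σ x⟩ : TangentBundle (𝓡∂ n) X)) q.1) :
    ContMDiffAt ((𝓡∂ n).prod 𝓘(ℝ, ℝ)) (𝓡∂ (n + 1)).tangent ∞
      (fun z => (⟨F z, sliceDeriv F z (σ z.1)⟩ : TangentBundle (𝓡∂ (n + 1)) M)) q := by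
  have h1 : ContMDiffAt ((𝓡∂ n).prod 𝓘(ℝ, ℝ)) ((𝓡∂ n).tangent.prod 𝓘(ℝ, ℝ).tangent) ∞
      (fun z : X × interval δ => ((⟨z.1, σ z.1⟩ : TangentBundle (𝓡∂ n) X),
        (⟨z.2, 0⟩ : TangentBundle 𝓘(ℝ, ℝ) (interval δ)))) q := by
    refine (hσ.comp q contMDiffAt_fst).prodMk ?_
    have h0 : ContMDiff 𝓘(ℝ, ℝ) 𝓘(ℝ, ℝ).tangent ∞
        (fun t : interval δ => (⟨t, 0⟩ : TangentBundle 𝓘(ℝ, ℝ) (interval δ))) :=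
      contMDiff_zeroSection ℝ (TangentSpace 𝓘(ℝ, ℝ) (M := interval δ))
    exact h0.contMDiffAt.comp q contMDiffAt_snd
  have h2 := (contMDiff_equivTangentBundleProd_symm (I := 𝓡∂ n) (M := X) (I' := 𝓘(ℝ, ℝ))
    (M' := interval δ) (n := ∞)).contMDiffAt.comp q h1
  have h3 := (hF.contMDiff_tangentMap (m := ∞) (by simp)).contMDiffAt.comp q h2
  exact h3

/-- Smoothness is tested on the local sections with constant components in a trivialization of TX;
on these the tensor is g applied to pushed-forward smooth fields. -/
theorem contMDiff_sliceTensor (g : Met (n + 1) M) {F : X × interval δ → M}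
    (hF : ContMDiff ((𝓡∂ n).prod 𝓘(ℝ, ℝ)) (𝓡∂ (n + 1)) ∞ F) :
    ContMDiff ((𝓡∂ n).prod 𝓘(ℝ, ℝ))
      ((𝓡∂ n).prod 𝓘(ℝ, EuclideanSpace ℝ (Fin n) →L[ℝ] EuclideanSpace ℝ (Fin n) →L[ℝ] ℝ)) ∞
      (fun q : X × interval δ =>
        TotalSpace.mk' (EuclideanSpace ℝ (Fin n) →L[ℝ] EuclideanSpace ℝ (Fin n) →L[ℝ] ℝ)
          (E := fun x : X => TangentSpace (𝓡∂ n) x →L[ℝ] TangentSpace (𝓡∂ n) x →L[ℝ] ℝ)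
          q.1 (sliceTensor g F q)) := by
  intro q
  rw [contMDiffAt_hom_bundle]
  refine ⟨contMDiffAt_fst, contMDiffAt_clm_of_apply fun v => contMDiffAt_clm_of_apply fun w => ?_⟩
  set e := trivializationAt (EuclideanSpace ℝ (Fin n)) (TangentSpace (𝓡∂ n) (M := X)) q.1 with he
  have hbase : e.baseSet ∈ 𝓝 q.1 :=
    e.open_baseSet.mem_nhds (FiberBundle.mem_baseSet_trivializationAt' q.1)
  have hσ : ∀ v : Euc n, ContMDiffAt (𝓡∂ n) (𝓡∂ n).tangent ∞
      (fun x => (⟨x, e.symm x v⟩ : TangentBundle (𝓡∂ n) X)) q.1 := fun v => by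
    have h1 := (e.contMDiffOn_symm (IB := 𝓡∂ n) (n := ∞)).contMDiffAt (x := (q.1, v))
      (e.open_target.mem_nhds (e.mk_mem_target.2 (mem_of_mem_nhds hbase)))
    have h2 : ContMDiffAt (𝓡∂ n) ((𝓡∂ n).prod 𝓘(ℝ, EuclideanSpace ℝ (Fin n))) ∞
        (fun x : X => (x, v)) q.1 := contMDiffAt_id.prodMk contMDiffAt_const
    refine (h1.comp q.1 h2).congr_of_eventuallyEq ?_
    filter_upwards [hbase] with x hx using e.mk_symm hx v
  have hmain := contMDiffWithinAt_inner g (s := univ)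
    (contMDiffAt_sliceDeriv hF (hσ v)).contMDiffWithinAt
    (contMDiffAt_sliceDeriv hF (hσ w)).contMDiffWithinAt
  rw [contMDiffWithinAt_univ] at hmain
  refine hmain.congr_of_eventuallyEq ?_
  filter_upwards [continuous_fst.continuousAt.preimage_mem_nhds hbase] with z hz
  have key := inCoordinates_apply_eq₂ (𝕜 := ℝ) (F₁ := EuclideanSpace ℝ (Fin n)) (F₂ := EuclideanSpace ℝ (Fin n))
    (F₃ := ℝ) (E₁ := TangentSpace (𝓡∂ n) (M := X)) (E₂ := TangentSpace (𝓡∂ n) (M := X))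
    (E₃ := Trivial X ℝ) (x₀ := q.1) (x := z.1) (ϕ := sliceTensor g F z) (v := v) (w := w)
    hz hz (mem_univ _)
  simp only [Trivial.fiberBundle_trivializationAt', Trivial.linearMapAt_trivialization,
    LinearMap.id_coe, id_eq] at key
  exact key

/-- The metric induced on a slice of a product with an interval. -/
def sliceMetric (g : Met (n + 1) M) {F : X × interval δ → M}
    (hF : ContMDiff ((𝓡∂ n).prod 𝓘(ℝ, ℝ)) (𝓡∂ (n + 1)) ∞ F)
    (hinj : ∀ (q : X × interval δ) (v : Euc n), sliceDeriv F q v = 0 → v = 0) (t : interval δ) : Met n X where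
  inner x := sliceTensor g F (x, t)
  symm x v w := metricAt_symm g (F (x, t)) (sliceDeriv F (x, t) v) (sliceDeriv F (x, t) w)
  pos x v hv := metricAt_pos g (F (x, t)) (v := sliceDeriv F (x, t) v)
    fun h => hv (hinj (x, t) v h)
  isVonNBounded x := (NormedSpace.isVonNBounded_iff ℝ).2
    (isBounded_setOf_apply_lt_one (G := sliceTensor g F (x, t))
      fun v hv => metricAt_pos g (F (x, t)) fun h => hv (hinj (x, t) v h))
  contMDiff := (contMDiff_sliceTensor g hF).comp (contMDiff_id.prodMk contMDiff_const)

end Pullback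

section GradNorm

variable {m : ℕ} [NeZero m] {M : Type*} [TopologicalSpace M]
  [ChartedSpace (EuclideanHalfSpace m) M] [IsManifold (𝓡∂ m) ∞ M]

/-- The squared norm of the gradient of a smooth function is smooth. -/
theorem contMDiffOn_diffAt_grad (g : Met m M) {f : M → ℝ} {W : Set M} (hW : IsOpen W)
    (hf : ContMDiffOn (𝓡∂ m) 𝓘(ℝ, ℝ) ∞ f W) :
    ContMDiffOn (𝓡∂ m) 𝓘(ℝ, ℝ) ∞ (fun p => diffAt f p (grad g f p)) W := by
  intro p hp
  set e := (chartAt (EuclideanHalfSpace m) p).restr W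
  have he : e ∈ IsManifold.maximalAtlas (𝓡∂ m) ∞ M :=
    restr_mem_maximalAtlas _ (IsManifold.chart_mem_maximalAtlas p) hW
  have hsrc : e.source = (chartAt (EuclideanHalfSpace m) p).source ∩ W :=
    OpenPartialHomeomorph.restr_source' _ _ hW
  have hpe : p ∈ e.source := by
    rw [hsrc]; exact ⟨mem_chart_source _ p, hp⟩
  have hα := contDiffOn_diffAt_coordSymm he (hf.mono (by rw [hsrc]; exact inter_subset_right))
  have hκ := hα.clm_apply (contDiffOn_inverse_apply (contDiffOn_metricCoord he g)
    (fun y hy v => metricCoord_pos he g hy) hα)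
  have h1 := hκ.contMDiffOn.comp (contMDiffOn_coord he) fun q hq => coord_mem hq
  refine ((h1.congr fun q hq => ?_).contMDiffAt (e.open_source.mem_nhds hpe)).contMDiffWithinAt
  have h2 := coordDeriv_grad he g f (coord_mem hq)
  rw [coordSymm_coord hq] at h2
  rw [comp_apply, coordSymm_coord hq, ← h2, ContinuousLinearMap.comp_apply,
    coordSymmDeriv_coordDeriv he hq]

end GradNorm

section Normal

variable {n : ℕ} [NeZero n]
  {X : Type*} [TopologicalSpace X] [ChartedSpace (EuclideanHalfSpace n) X]
  [IsManifold (𝓡∂ n) ∞ X]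
  {M : Type*} [TopologicalSpace M] [ChartedSpace (EuclideanHalfSpace (n + 1)) M]
  [IsManifold (𝓡∂ (n + 1)) ∞ M]
  {δ : ℝ}

theorem IsProperlyEmbedded.mapDeriv_injective {ι : X → M} (hι : IsProperlyEmbedded (n := n) ι)
    {x : X} {v : Euc n} (hv : mapDeriv ι x v = 0) : v = 0 := by
  obtain ⟨e, d, L, ℓ, h, -, hxe, -⟩ := hι.exists_isSliceChart x isOpen_univ (mem_univ _)
  have hx := (h.mem_iff x).1 hxe
  have h1 := h.coordDeriv_mapDeriv hx (hι.mdifferentiableAt x) v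
  rw [hv, map_zero] at h1
  have h2 : coordDeriv d x v = 0 := h.injective (by rw [← h1, map_zero])
  rw [← coordSymmDeriv_coordDeriv h.mem_maximalAtlas' hx v, h2, map_zero]

theorem hasMFDerivAt_prodDeriv {F : X × interval δ → M} {q : X × interval δ}
    (hF : MDifferentiableAt ((𝓡∂ n).prod 𝓘(ℝ, ℝ)) (𝓡∂ (n + 1)) F q) :
    HasMFDerivAt ((𝓡∂ n).prod 𝓘(ℝ, ℝ)) (𝓡∂ (n + 1)) F q (prodDeriv F q) :=
  hF.hasMFDerivAt

theorem prodDeriv_apply (F : X × interval δ → M) (q : X × interval δ) (v : Euc n) (a : ℝ) :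
    prodDeriv F q (v, a) = sliceDeriv F q v + a • prodDeriv F q (0, 1) := by
  rw [sliceDeriv, ← map_smul, ContinuousLinearMap.comp_apply, ← map_add]
  simp

/-- A map with a left inverse up to an immersion has injective differential along the slices. -/
theorem sliceDeriv_injective {ι : X → M} (hι : IsProperlyEmbedded (n := n) ι)
    {F : X × interval δ → M} {q : X × interval δ}
    (hF : MDifferentiableAt ((𝓡∂ n).prod 𝓘(ℝ, ℝ)) (𝓡∂ (n + 1)) F q) {r : M → M}
    (hr : MDifferentiableAt (𝓡∂ (n + 1)) (𝓡∂ (n + 1)) r (F q)) (hrF : ∀ q, r (F q) = ι q.1)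
    {v : Euc n} (hv : sliceDeriv F q v = 0) : v = 0 := by
  let r' : Euc (n + 1) →L[ℝ] Euc (n + 1) := mfderiv (𝓡∂ (n + 1)) (𝓡∂ (n + 1)) r (F q)
  have h0 : HasMFDerivAt (𝓡∂ (n + 1)) (𝓡∂ (n + 1)) r (F q) r' := hr.hasMFDerivAt
  have hι' : HasMFDerivAt (𝓡∂ n) (𝓡∂ (n + 1)) ι q.1 (mapDeriv ι q.1) :=
    (hι.mdifferentiableAt q.1).hasMFDerivAt
  have h1 : HasMFDerivAt ((𝓡∂ n).prod 𝓘(ℝ, ℝ)) (𝓡∂ (n + 1)) (r ∘ F) q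
      (r'.comp (prodDeriv F q)) := h0.comp q (hasMFDerivAt_prodDeriv hF)
  have h2 : HasMFDerivAt ((𝓡∂ n).prod 𝓘(ℝ, ℝ)) (𝓡∂ (n + 1)) (ι ∘ Prod.fst) q
      ((mapDeriv ι q.1).comp (ContinuousLinearMap.fst ℝ (Euc n) ℝ)) :=
    hι'.comp q (hasMFDerivAt_fst q)
  have h3 : r'.comp (prodDeriv F q) = (mapDeriv ι q.1).comp (ContinuousLinearMap.fst ℝ (Euc n) ℝ) :=
    hasMFDerivAt_unique h1 (h2.congr_of_eventuallyEq (Eventually.of_forall hrF))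
  refine hι.mapDeriv_injective (x := q.1) ?_
  have h4 := DFunLike.congr_fun h3 (v, 0)
  rw [ContinuousLinearMap.comp_apply, show prodDeriv F q (v, 0) = 0 from hv, map_zero] at h4
  exact h4.symm

/-- If the second coordinate of a product with an interval is given by a function `f`, then `f` is
constant on the slices. -/
theorem diffAt_sliceDeriv {F : X × interval δ → M} {q : X × interval δ}
    (hF : MDifferentiableAt ((𝓡∂ n).prod 𝓘(ℝ, ℝ)) (𝓡∂ (n + 1)) F q) {f : M → ℝ}
    (hf : MDifferentiableAt (𝓡∂ (n + 1)) 𝓘(ℝ, ℝ) f (F q)) (hfF : ∀ q, f (F q) = q.2) (v : Euc n) :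
    diffAt f (F q) (sliceDeriv F q v) = 0 := by
  have h1 : HasMFDerivAt ((𝓡∂ n).prod 𝓘(ℝ, ℝ)) 𝓘(ℝ, ℝ) (f ∘ F) q
      ((diffAt f (F q)).comp (prodDeriv F q)) :=
    (hasMFDerivAt_diffAt hf).comp q (hasMFDerivAt_prodDeriv hF)
  have h2 : HasMFDerivAt ((𝓡∂ n).prod 𝓘(ℝ, ℝ)) 𝓘(ℝ, ℝ)
      ((Subtype.val : interval δ → ℝ) ∘ Prod.snd) q
      ((ContinuousLinearMap.id ℝ ℝ).comp (ContinuousLinearMap.snd ℝ (Euc n) ℝ)) :=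
    (hasMFDerivAt_interval_val q.2).comp q (hasMFDerivAt_snd q)
  have h3 : (diffAt f (F q)).comp (prodDeriv F q) =
      (ContinuousLinearMap.id ℝ ℝ).comp (ContinuousLinearMap.snd ℝ (Euc n) ℝ) :=
    hasMFDerivAt_unique h1 (h2.congr_of_eventuallyEq (Eventually.of_forall hfF))
  exact DFunLike.congr_fun h3 (v, 0)

end Normal

end NormalForm

end

/-! ### Assembly of the normal form -/

theorem proposition2p3 {n : ℕ} [NeZero n]
    {X : Type*} [TopologicalSpace X] [CompactSpace X]
    [ChartedSpace (EuclideanHalfSpace n) X] [IsManifold (𝓡∂ n) ∞ X]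
    {M : Type*} [TopologicalSpace M] [T2Space M] [SecondCountableTopology M]
    [ChartedSpace (EuclideanHalfSpace (n + 1)) M] [IsManifold (𝓡∂ (n + 1)) ∞ M]
    (g : NormalForm.Met (n + 1) M) (ι : X → M)
    (hι : NormalForm.IsProperlyEmbedded (n := n) ι)
    (htwo : NormalForm.IsTwoSided (n := n) g ι)
    (horth : NormalForm.MeetsBoundaryOrthogonally (n := n) g ι) :
    ∃ (δ : ℝ) (U : TopologicalSpace.Opens M)
      (Φ : Diffeomorph ((𝓡∂ n).prod 𝓘(ℝ, ℝ)) (𝓡∂ (n + 1)) (X × NormalForm.interval δ) U ∞)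
      (u : X × NormalForm.interval δ → ℝ) (h : NormalForm.interval δ → NormalForm.Met n X),
      0 < δ ∧ Set.range ι ⊆ (U : Set M) ∧
      (∀ (x : X) (t : NormalForm.interval δ), (t : ℝ) = 0 → (Φ (x, t) : M) = ι x) ∧
      ContMDiff ((𝓡∂ n).prod 𝓘(ℝ, ℝ)) 𝓘(ℝ, ℝ) ∞ u ∧ (∀ q, 0 < u q) ∧
      NormalForm.IsSmoothFamily h ∧
      NormalForm.PullbackIsBlock g Φ u h := by
  open NormalForm in
  obtain ⟨ν, hνs, hν⟩ := htwo
  have hνU : IsUnitNormal g ι ν :=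
    ⟨hνs.continuous, fun x w => (hν x).1 w, fun x => (hν x).2⟩
  obtain ⟨O, f, hιO, hf, htan⟩ := exists_isDefiningOn_tangent hι hνU horth
  obtain ⟨B, -, hB, hιB, hfB⟩ := hf.exists_zero_subset hι hνU hιO
  have hchart : ∀ p ∈ O, diffAt (m := n + 1) f p ≠ 0 →
      ∃ e, IsFlowChart (unitRateField g f) e ∧ p ∈ e.source ∧ e.source ⊆ O ∧
        ∀ q ∈ e.source, diffAt (m := n + 1) f q ≠ 0 := fun p hp hne =>
    exists_isFlowChart hf.isOpen hf.contMDiffOn htan hp hne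
  -- The region where the rescaled gradient makes sense. It contains X because f increases along ν
  -- there.
  set W : Set M := {p | p ∈ O ∧ diffAt (m := n + 1) f p ≠ 0}
  have hW : IsOpen W := isOpen_iff_mem_nhds.2 fun p hp => by
    obtain ⟨e, -, hpe, heO, hene⟩ := hchart p hp.1 hp.2
    exact Filter.mem_of_superset (e.open_source.mem_nhds hpe) fun q hq => ⟨heO hq, hene q hq⟩
  have hfW := hf.contMDiffOn.mono (fun p hp => hp.1 : W ⊆ O)
  obtain ⟨δ, hδ, U, Φ, r, hιU, hΦ0, hΦ, hr⟩ := exists_collar hι (V := unitRateField g f) (W := W)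
    hW hfW (fun p hp => diffAt_unitRateField g hp.2) (fun x => hf.eq_zero x (hιO ⟨x, rfl⟩))
    (by
      rintro _ ⟨x, rfl⟩
      have hx := hιO ⟨x, rfl⟩
      obtain ⟨e, he, hpe, heO, hene⟩ := hchart _ hx fun h0 => by
        have := hf.pos x hx
        rw [h0] at this
        exact lt_irrefl _ this
      exact ⟨e, he, hpe, fun q hq => ⟨heO hq, hene q hq⟩⟩)
    hB hιB hfB
  set F : X × interval δ → M := fun q => (Φ q : M) with hF
  have hFs : ContMDiff ((𝓡∂ n).prod 𝓘(ℝ, ℝ)) (𝓡∂ (n + 1)) ∞ F :=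
    contMDiff_subtype_val.comp Φ.contMDiff
  have hFd : ∀ q, MDifferentiableAt ((𝓡∂ n).prod 𝓘(ℝ, ℝ)) (𝓡∂ (n + 1)) F q :=
    fun q => hFs.mdifferentiableAt (by simp)
  have hFU : ∀ q, F q ∈ U := fun q => (Φ q).2
  have hinj : ∀ (q : X × interval δ) (v : Euc n), sliceDeriv F q v = 0 → v = 0 := fun q v hv =>
    sliceDeriv_injective hι (hFd q) ((hr.contMDiffAt (U.2.mem_nhds (hFU q))).mdifferentiableAt
      (by simp)) (fun q => (hΦ q).2.2.1) hv
  have hpos : ∀ q, 0 < diffAt f (F q) (grad g f (F q)) := fun q => diffAt_grad_pos g (hΦ q).1.2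
  have hNs : ContMDiff ((𝓡∂ n).prod 𝓘(ℝ, ℝ)) 𝓘(ℝ, ℝ) ∞
      fun q => diffAt f (F q) (grad g f (F q)) := by
    rw [← contMDiffOn_univ]
    exact (contMDiffOn_diffAt_grad g hW hfW).comp hFs.contMDiffOn fun q _ => (hΦ q).1
  -- Split each vector into a slice part and a multiple of V. The cross terms vanish since slice
  -- vectors are killed by df, and g(V, V) = 1/|grad f|².
  have key : ∀ (x : X) (t : interval δ) (v w : Euc n) (a b : ℝ),
      metricAt g (F (x, t)) (prodDeriv F (x, t) (v, a)) (prodDeriv F (x, t) (w, b)) =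
        (√(diffAt f (F (x, t)) (grad g f (F (x, t)))))⁻¹ ^ 2 * (a * b) +
          sliceTensor g F (x, t) v w := by
    intro x t v w a b
    have hfd : MDifferentiableAt (𝓡∂ (n + 1)) 𝓘(ℝ, ℝ) f (F (x, t)) :=
      (hfW.contMDiffAt (hW.mem_nhds (hΦ (x, t)).1)).mdifferentiableAt (by simp)
    have hV : prodDeriv F (x, t) (0, 1) = unitRateField g f (F (x, t)) := (hΦ (x, t)).2.2.2
    have h1 : diffAt f (F (x, t)) (unitRateField g f (F (x, t))) = 1 :=
      diffAt_unitRateField g (hΦ (x, t)).1.2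
    have h0 : ∀ v, metricAt g (F (x, t)) (unitRateField g f (F (x, t)))
        (sliceDeriv F (x, t) v) = 0 := fun v => by
      rw [metricAt_unitRateField, diffAt_sliceDeriv (hFd _) hfd (fun q => (hΦ q).2.1), mul_zero]
    have h0' : ∀ v, metricAt g (F (x, t)) (sliceDeriv F (x, t) v)
        (unitRateField g f (F (x, t))) = 0 := fun v => by rw [metricAt_symm, h0]
    rw [prodDeriv_apply, prodDeriv_apply F (x, t) w, hV, sliceTensor_apply, inv_pow,
      Real.sq_sqrt (hpos _).le]
    simp only [map_add, map_smul, add_apply, smul_apply, h0, h0', smul_eq_mul,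
      metricAt_unitRateField, h1]
    ring
  refine ⟨δ, U, Φ, fun q => (√(diffAt f (F q) (grad g f (F q))))⁻¹,
    fun t => sliceMetric g hFs hinj t, hδ, hιU, hΦ0, fun q => ?_,
    fun q => inv_pos.2 (Real.sqrt_pos.2 (hpos q)), contMDiff_sliceTensor g hFs, ?_⟩
  · have h1 : ContDiffAt ℝ ∞ (fun s : ℝ => (√s)⁻¹) (diffAt f (F q) (grad g f (F q))) :=
      (Real.contDiffAt_sqrt (hpos q).ne').inv (Real.sqrt_pos.2 (hpos q)).ne'
    have h2 : ContMDiffAt 𝓘(ℝ, ℝ) 𝓘(ℝ, ℝ) ∞ (fun s : ℝ => (√s)⁻¹)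
        (diffAt f (F q) (grad g f (F q))) := h1.contMDiffAt
    exact ContMDiffAt.comp q (f := fun q => diffAt f (F q) (grad g f (F q))) h2 (hNs q)
  · exact fun x t v w a b => key x t v w a b
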